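/- Let $n\ge 2$ and let $Cl_n$ be the real Clifford algebra with $e_ie_j+e_je_i=-2\delta_{ij}$, containing $\mathbb R^n$; a nonzero vector $x$ has the inverse $x^{-1}=-x/\|x\|^2$. Let $a\mapsto a^*$ be the algebra automorphism of $Cl_n$ with $e_n^*=-e_n$ and $e_i^*=e_i$ for $i<n$, and for $a=P+e_nQ$ with $P,Q$ in the subalgebra generated by $e_1,\dots,e_{n-1}$ put $Qa:=Q$. A differentiable function $f$ on an open subset of $H^+=\{x\in\mathbb R^n: x_n>0\}$ with values in $Cl_n$ is called left hypermonogenic if $x_n\,Df+(n-2)\,Qf=0$, where $D=\sum_i e_i\,\partial/\partial x_i$. Let $m>1$ be an integer, $\Gamma=\{m^k:k\in\mathbb Z\}$ acting on $H^+$ by dilations, $\mathcal S_+=H^+/\Gamma$ with projection $p:H^+\to\mathcal S_+$, and let $0<s<2n-3$ (for instance $s=1/2$). Put $$p_1(x,y)=\frac{(x-y)^{-1}}{\|x-y\|^{n-2}\|x-y^*\|^{n-2}},\qquad p_2(x,y)=\frac{(x^*-y)^{-1}}{\|x-y\|^{n-2}\|x^*-y\|^{n-2}},$$ and let $h_j(x,y)=\sum_{k\in\mathbb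 Z}m^{ks}\,p_j(m^kx,y)$, $j=1,2$, be their $\Gamma$-periodizations. Let $U'\subset\mathcal S_+$ be open and let $K'\subset\mathcal S_+$ be an open set with compact closure $\overline{K'}\subset U'$ and with Lipschitz boundary $S'=\partial K'$. Let $f'$ be a left hypermonogenic section over $U'$, that is, a left hypermonogenic function $f$ on $p^{-1}(U')$ such that $f(x)=m^{k(n-1-s)}f(m^kx)$ for all $k\in\mathbb Z$. Let $n(x)$ be the outer unit normal of $p^{-1}(K')$ (defined at almost every point $x$ of $p^{-1}(S')$), $\sigma$ the Euclidean surface measure on $p^{-1}(S')$, and $\omega_n$ the surface area of the unit sphere of $\mathbb R^n$. Then for every $y\in p^{-1}(K')$ the series defining $h_j(x,y)$, $j=1,2$, converge (unconditionally) for all $x\in p^{-1}(S')$, and $$f(y)=\frac{2^{n-2}y_n^{n-2}}{\omega_n}\left(\int_{S'}h_1(x,y)\,n(x)\,f(x)\,d\sigma(x)-\int_{S'}h_2(x,y)\,n(x)^*\,f(x)^*\,d\sigma(x)\right),$$ where $\int_{S'}$ denotes the integral over $p^{-1}(S')\cap F$ for an arbitrary Borel set $F\subset H^+$ containing exactly one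 point of every $\Gamma$-orbit; both integrals converge absolutely, and the formula holds for every such $F$. -/

import Mathlib

open MeasureTheory Topology
open scoped RealInnerProductSpace

noncomputable section

namespace HalfHopf

/-! Throughout, the dimension is `n = d + 2` (so `n ≥ 2`, `n - 2 = d`, `n - 1 = d + 1`). -/

/-- The Euclidean space `ℝⁿ`, `n = d + 2`. -/
abbrev E (d : ℕ) : Type := EuclideanSpace ℝ (Fin (d + 2))

/-- The basis vector `e_i` of `ℝⁿ`. -/
def stdVec {d : ℕ} (i : Fin (d + 2)) : E d := EuclideanSpace.single i 1

/-- The last coordinate `x_n`. -/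
def lastCoord {d : ℕ} (x : E d) : ℝ := x (Fin.last (d + 1))

/-- The quadratic form `x ↦ -‖x‖²` on `ℝⁿ`. -/
def negForm (d : ℕ) : QuadraticForm ℝ (E d) :=
  -LinearMap.BilinMap.toQuadraticMap (innerₗ (E d))

theorem negForm_apply {d : ℕ} (x : E d) : negForm d x = -‖x‖ ^ 2 := by
  simp [negForm]

/-- The real Clifford algebra `Cl_n`, in which `e_i e_j + e_j e_i = -2 δ_ij`. -/
abbrev Cl (d : ℕ) : Type := CliffordAlgebra (negForm d)

/-- The embedding of `ℝⁿ` in `Cl_n`. -/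
def vec {d : ℕ} (x : E d) : Cl d := CliffordAlgebra.ι (negForm d) x

/-- The basis of `Cl_n` indexed by the subsets of `{1, …, n}`, given by the linear isomorphism of
`Cl_n` with the exterior algebra. -/
def clBasis (d : ℕ) : Module.Basis (Finset (Fin (d + 2))) ℝ (Cl d) :=
  ((EuclideanSpace.basisFun (Fin (d + 2)) ℝ).toBasis.ExteriorAlgebra).map
    (CliffordAlgebra.equivExterior (negForm d)).symm

/-- The coordinates of an element of `Cl_n`. -/
def clCoords (d : ℕ) : Cl d ≃ₗ[ℝ] EuclideanSpace ℝ (Finset (Fin (d + 2))) :=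
  (clBasis d).equivFun.trans (WithLp.linearEquiv 2 ℝ (Finset (Fin (d + 2)) → ℝ)).symm

/-- The norm on `Cl_n`: the Euclidean norm of the coordinates. -/
instance instNormedAddCommGroupCl (d : ℕ) : NormedAddCommGroup (Cl d) :=
  NormedAddCommGroup.induced (Cl d) (EuclideanSpace ℝ (Finset (Fin (d + 2))))
    (clCoords d).toLinearMap (clCoords d).injective

instance instNormedSpaceCl (d : ℕ) : NormedSpace ℝ (Cl d) :=
  NormedSpace.induced ℝ (Cl d) (EuclideanSpace ℝ (Finset (Fin (d + 2)))) (clCoords d).toLinearMap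

/-- `x ↦ x^*` on vectors: the reflection with `e_n^* = -e_n` and `e_i^* = e_i` for `i < n`. -/
def starVec (d : ℕ) : E d ≃ₗᵢ[ℝ] E d :=
  (Submodule.span ℝ {(stdVec (Fin.last (d + 1)) : E d)})ᗮ.reflection

/-- The automorphism `a ↦ a^*` of `Cl_n` with `e_n^* = -e_n` and `e_i^* = e_i` for `i < n`. -/
def starCl (d : ℕ) : Cl d →ₐ[ℝ] Cl d :=
  CliffordAlgebra.map
    { toLinearMap := (starVec d).toLinearEquiv.toLinearMap
      map_app' := fun x => by
        rw [negForm_apply, negForm_apply]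
        exact congrArg (fun t : ℝ => -t ^ 2) ((starVec d).norm_map x) }

/-- The part `Q` in the decomposition `a = P + e_n Q` with `P`, `Q` in the subalgebra generated by
`e_1, …, e_{n-1}`, that is, the component of `-e_n a` in that subalgebra.
Since `a^* = P - e_n Q`, it is `-e_n (a - a^*) / 2`. -/
def qPart {d : ℕ} (a : Cl d) : Cl d :=
  -((1 / 2 : ℝ) • (vec (stdVec (Fin.last (d + 1))) * (a - starCl d a)))

/-- The Euclidean Dirac operator `D f = ∑ e_i ∂f/∂x_i`. -/
def dirac {d : ℕ} (f : E d → Cl d) (x : E d) : Cl d :=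
  ∑ i : Fin (d + 2), vec (stdVec i) * fderiv ℝ f x (stdVec i)

/-- `f` is left hypermonogenic on the open set `W`: it is differentiable there and
`x_n D f + (n - 2) Q f = 0`. -/
def IsLeftHypermonogenicOn {d : ℕ} (f : E d → Cl d) (W : Set (E d)) : Prop :=
  (∀ x ∈ W, DifferentiableAt ℝ f x) ∧
    ∀ x ∈ W, lastCoord x • dirac f x + (d : ℝ) • qPart (f x) = 0

/-! ### Half the Hopf manifold -/

/-- The upper half-space `H⁺(ℝⁿ)`. -/
def upperHalf (d : ℕ) : Set (E d) := {x | 0 < lastCoord x}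

/-- Two points of the half-space are identified if they differ by a dilation `m ^ k`. -/
def dilationSetoid (d m : ℕ) (hm : 1 < m) : Setoid (upperHalf d) where
  r x y := ∃ k : ℤ, (y : E d) = (m : ℝ) ^ k • (x : E d)
  iseqv :=
    { refl := fun x => ⟨0, by simp⟩
      symm := by
        rintro x y ⟨k, hk⟩
        have h0 : (m : ℝ) ≠ 0 := by positivity
        exact ⟨-k, by rw [hk, smul_smul, ← zpow_add₀ h0]; simp⟩
      trans := by
        rintro x y z ⟨k, hk⟩ ⟨l, hl⟩
        have h0 : (m : ℝ) ≠ 0 := by positivity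
        exact ⟨l + k, by rw [hl, hk, smul_smul, ← zpow_add₀ h0]⟩ }

/-- Half the Hopf manifold `S₊ = H⁺(ℝⁿ) / {m ^ k : k ∈ ℤ}`, with the quotient topology. -/
abbrev Splus (d m : ℕ) (hm : 1 < m) : Type := Quotient (dilationSetoid d m hm)

/-- The preimage `p⁻¹(A')` in the half-space of a subset `A'` of `S₊`. -/
def preim {d m : ℕ} {hm : 1 < m} (A' : Set (Splus d m hm)) : Set (E d) :=
  {x | ∃ hx : x ∈ upperHalf d, (Quotient.mk (dilationSetoid d m hm) ⟨x, hx⟩) ∈ A'}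

/-- A left hypermonogenic section on `U'` of the bundle over `S₊` that is obtained from
`H⁺(ℝⁿ) × Cl_n` by the identifications `(x, X) ↔ (m ^ k x, m ^ (-k w) X)`, given as a function on
`p⁻¹(U')`. -/
def IsHypermonogenicSection {d m : ℕ} {hm : 1 < m} (w : ℝ) (U' : Set (Splus d m hm))
    (f : E d → Cl d) : Prop :=
  (∀ x ∈ preim U', ∀ k : ℤ, f ((m : ℝ) ^ k • x) = (m : ℝ) ^ (-((k : ℝ) * w)) • f x) ∧
    IsLeftHypermonogenicOn f (preim U')

/-- Near `x`, the set `A` is, in suitable orthonormal coordinates, the part of space above the graph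
of a Lipschitz function. -/
def IsLipschitzGraphAt {d : ℕ} (A : Set (E d)) (x : E d) : Prop :=
  ∃ ν : E d, ‖ν‖ = 1 ∧
    ∃ (φ : (Submodule.span ℝ {ν})ᗮ → ℝ) (C : NNReal), LipschitzWith C φ ∧
      ∀ᶠ z in 𝓝 x, z ∈ A ↔ φ ((Submodule.span ℝ {ν})ᗮ.orthogonalProjectionOnto z) < ⟪ν, z⟫

/-- `K'` has a Lipschitz boundary in `S₊` (tested in the half-space, to which `S₊` is locally
diffeomorphic). -/
def HasLipschitzBoundary {d m : ℕ} {hm : 1 < m} (K' : Set (Splus d m hm)) : Prop :=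
  ∀ x ∈ preim (frontier K'), IsLipschitzGraphAt (preim K') x

/-- `ν` is the outer unit normal of `A` at `x`: up to `o(‖z - x‖)`, the set `A` lies on the side
`⟪ν, z - x⟫ ≤ 0` and its complement on the side `⟪ν, z - x⟫ ≥ 0`. There is at most one such `ν`. -/
def IsOuterNormal {d : ℕ} (A : Set (E d)) (x ν : E d) : Prop :=
  ‖ν‖ = 1 ∧ ∀ ε > 0, ∀ᶠ z in 𝓝 x,
    (z ∈ A → ⟪ν, z - x⟫ ≤ ε * ‖z - x‖) ∧ (z ∉ A → -(ε * ‖z - x‖) ≤ ⟪ν, z - x⟫)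

open Classical in
/-- The outer unit normal `n(x)`; for a Lipschitz boundary it exists at almost every boundary
point. -/
def outerNormal {d : ℕ} (A : Set (E d)) (x : E d) : E d :=
  if h : ∃ ν, IsOuterNormal A x ν then h.choose else 0

/-- `F` is a Borel subset of the half-space that contains exactly one point of each orbit. -/
def IsFundamentalSet (d m : ℕ) (F : Set (E d)) : Prop :=
  MeasurableSet F ∧ F ⊆ upperHalf d ∧ ∀ x ∈ upperHalf d, ∃! k : ℤ, (m : ℝ) ^ k • x ∈ F

/-! ### The kernels -/

/-- The inverse `-x / ‖x‖²` of a nonzero vector in `Cl_n`. -/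
def vecInv {d : ℕ} (x : E d) : E d := -((‖x‖ ^ 2)⁻¹ • x)

/-- `p₁(x, y) = (x - y)⁻¹ / (‖x - y‖^(n-2) ‖x - y^*‖^(n-2))`. -/
def p₁ {d : ℕ} (x y : E d) : Cl d :=
  (‖x - y‖ ^ d * ‖x - starVec d y‖ ^ d)⁻¹ • vec (vecInv (x - y))

/-- `p₂(x, y) = (x^* - y)⁻¹ / (‖x - y‖^(n-2) ‖x^* - y‖^(n-2))`. -/
def p₂ {d : ℕ} (x y : E d) : Cl d :=
  (‖x - y‖ ^ d * ‖starVec d x - y‖ ^ d)⁻¹ • vec (vecInv (starVec d x - y))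

/-- The `k`-th term of the periodization, with weight `s`, of a kernel `p`. -/
def periodTerm {d : ℕ} (m : ℕ) (s : ℝ) (p : E d → E d → Cl d) (x y : E d) (k : ℤ) : Cl d :=
  (m : ℝ) ^ ((k : ℝ) * s) • p ((m : ℝ) ^ k • x) y

/-- The periodization `h₁(x, y) = ∑_{k ∈ ℤ} m^(k s) p₁(m^k x, y)`. -/
def h₁ {d : ℕ} (m : ℕ) (s : ℝ) (x y : E d) : Cl d := ∑' k : ℤ, periodTerm m s p₁ x y k

/-- The periodization `h₂(x, y) = ∑_{k ∈ ℤ} m^(k s) p₂(m^k x, y)`. -/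
def h₂ {d : ℕ} (m : ℕ) (s : ℝ) (x y : E d) : Cl d := ∑' k : ℤ, periodTerm m s p₂ x y k

/-- The surface area `ω_n` of the unit sphere of `ℝⁿ`. -/
def sphereArea (d : ℕ) : ℝ := ((volume : Measure (E d)).toSphere Set.univ).toReal

/-- The integrand `h₁(x, y) n(x) f(x)`, with `n` the outer normal of `A`. -/
def integrand₁ {d : ℕ} (m : ℕ) (s : ℝ) (A : Set (E d)) (f : E d → Cl d) (y x : E d) : Cl d :=
  h₁ m s x y * vec (outerNormal A x) * f x

/-- The integrand `h₂(x, y) n(x)^* f(x)^*`, with `n` the outer normal of `A`. -/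
def integrand₂ {d : ℕ} (m : ℕ) (s : ℝ) (A : Set (E d)) (f : E d → Cl d) (y x : E d) : Cl d :=
  h₂ m s x y * starCl d (vec (outerNormal A x)) * starCl d (f x)

end HalfHopf

end

/-! Unfolding. The normal of `preim K'` is invariant under dilations, `f (m^k x) = m^(-k(n-1-s)) f
x`, and surface measure scales by `m^(k(n-1))`. The product of the last two factors is `m^(ks)`, the
weight of the periodization, so the integral of a periodized kernel over a fundamental set is the
integral of the bare kernel over all of `p⁻¹(S')` (`integral_unfold`, `unfold_boundary`). Away from
`y` the kernels are `O((1 + ‖x‖)^(-(2n-3)))`, so the `k`-th dilate is bounded by `growth`, which is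
summable in both directions because `0 < s < 2n - 3`.

Cauchy's formula on the unbounded domain `p⁻¹(K')`. Put `α = (x - y)⁻¹` and `β = (x - y^*)⁻¹`; let
`p` and `q` be these divided by the common weight `‖x - y‖^(n-2) ‖x - y^*‖^(n-2)`. Then `p = p₁` and
`q^* = p₂`. The full weight of `p` would make it the monogenic Cauchy kernel if `y^*` were absent,
so differentiating `p` from the right leaves only the term from the other pole, a multiple of `αβ`;
for `q` it is `βα`. The relations `αβ = β^* α^*` and `2 x_n αβ e_n = α - β^*` give
`kernel_identity`: for hypermonogenic `f`, the volume density of `p` in the Gauss formula is the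
star of that of `q`. Hence in (Gauss for `p`) minus the star of (Gauss for `q`) only gradients of
cutoff functions survive (`gauss_kern`). Cutoffs at the scales `m^N` and `m^(-N)` contribute
`O(growth)` and disappear in the limit; the cutoff at `y` yields an approximate identity for `p`,
with limit `ω_n (2 y_n)^(-(n-2)) f y`, and nothing for `q` (`boundary_eq`, `cauchy_formula`).

Gauss formula. Since `f` is only differentiable, its partial derivatives may be discontinuous, but
the equation makes `dirac f` continuous. Accordingly the divergence theorem is proved for
differentiable fields with continuous divergence. It is tested against Lipschitz functions by
mollification; steep Lipschitz steps across a Lipschitz graph give the theorem above the graph; the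
area formula for graphs identifies the boundary term with Hausdorff measure; a partition of unity
globalizes. -/

noncomputable section

namespace HalfHopf

/-! ### The divergence theorem without boundary -/

/-- The divergence of a vector field on `ℝⁿ`. -/
def divergence {d : ℕ} (v : E d → E d) (x : E d) : ℝ :=
  ∑ i : Fin (d + 2), fderiv ℝ v x (stdVec i) i

theorem coord_sum {d : ℕ} (w : E d) : ∑ i, w i • (stdVec i : E d) = w := by
  ext j
  simp [stdVec, Pi.single_apply]

/-- The divergence theorem on a cube around the support applies, and all its face integrals vanish.
It asks for differentiability and an integrable divergence, not for continuous partial derivatives.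
-/
theorem integral_divergence_eq_zero {d : ℕ} {v : E d → E d} (hv : Differentiable ℝ v)
    (hc : HasCompactSupport v) (hi : Integrable (divergence v)) : ∫ x, divergence v x = 0 := by
  obtain ⟨R, hR0, hR⟩ : ∃ R : ℝ, 0 < R ∧ ∀ x : E d, R ≤ ‖x‖ → v x = 0 := by
    obtain ⟨R, hR⟩ := hc.isCompact.isBounded.subset_ball (0 : E d)
    refine ⟨max R 1, by positivity, fun x hx => ?_⟩
    by_contra h
    have := hR (subset_tsupport v h)
    rw [mem_ball_zero_iff] at this
    exact absurd hx (not_le.2 (this.trans_le (le_max_left _ _)))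
  let eL : E d ≃L[ℝ] (Fin (d + 2) → ℝ) := EuclideanSpace.equiv (Fin (d + 2)) ℝ
  let f : Fin (d + 2) → (Fin (d + 2) → ℝ) → ℝ := fun i x => v (eL.symm x) i
  let f' : Fin (d + 2) → (Fin (d + 2) → ℝ) → (Fin (d + 2) → ℝ) →L[ℝ] ℝ := fun i x =>
    (EuclideanSpace.proj i : E d →L[ℝ] ℝ).comp
      ((fderiv ℝ v (eL.symm x)).comp (eL.symm : (Fin (d + 2) → ℝ) →L[ℝ] E d))
  have hder : ∀ i x, HasFDerivAt (f i) (f' i x) x := fun i x =>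
    (EuclideanSpace.proj i : E d →L[ℝ] ℝ).hasFDerivAt.comp x
      ((hv _).hasFDerivAt.comp x eL.symm.hasFDerivAt)
  have hsum : ∀ x, ∑ i, f' i x (Pi.single i 1) = divergence v (eL.symm x) := by
    intro x
    rfl
  have hmp : MeasurePreserving (fun x => eL.symm x) (volume : Measure (Fin (d + 2) → ℝ))
      (volume : Measure (E d)) := PiLp.volume_preserving_toLp (Fin (d + 2))
  have hemb : MeasurableEmbedding (fun x => eL.symm x) :=
    eL.symm.toHomeomorph.measurableEmbedding
  have hi' : Integrable (fun x => ∑ i, f' i x (Pi.single i 1)) := by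
    simp_rw [hsum]
    exact (hmp.integrable_comp_emb hemb).2 hi
  have hzero : ∀ (x : Fin (d + 2) → ℝ) (i : Fin (d + 2)), R ≤ |x i| → v (eL.symm x) = 0 := by
    intro x i hx
    apply hR
    refine hx.trans ?_
    have := EuclideanSpace.norm_eq (eL.symm x)
    exact (PiLp.norm_apply_le (eL.symm x) i)
  have key := integral_divergence_of_hasFDerivAt_off_countable' (E := ℝ) (n := d + 1)
    (fun _ => -R) (fun _ => R) (fun i => by linarith) f f' ∅ Set.countable_empty
    (fun i => fun x _ => (hder i x).continuousAt.continuousWithinAt)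
    (fun x _ i => hder i x) hi'.integrableOn
  rw [Finset.sum_eq_zero] at key
  · rw [← hmp.integral_comp hemb]
    rw [← key]
    simp_rw [← hsum]
    refine (setIntegral_eq_integral_of_forall_compl_eq_zero fun x hx => ?_).symm
    have : ∃ i, R < |x i| := by
      by_contra! h
      exact hx ⟨fun i => (abs_le.1 (h i)).1, fun i => (abs_le.1 (h i)).2⟩
    obtain ⟨i, hi⟩ := this
    rw [hsum]
    have hnh : ∀ᶠ z in 𝓝 (eL.symm x), v z = 0 := by
      have ho : IsOpen {z : E d | R < |z i|} :=
        isOpen_lt continuous_const (by fun_prop)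
      filter_upwards [ho.mem_nhds (show eL.symm x ∈ {z : E d | R < |z i|} from hi)] with z hz
      exact hR z (hz.le.trans (PiLp.norm_apply_le z i))
    have : fderiv ℝ v (eL.symm x) = 0 := by
      have h2 : v =ᶠ[𝓝 (eL.symm x)] fun _ => 0 := hnh
      rw [h2.fderiv_eq]
      simp
    simp [divergence, this]
  · intro i _
    have h1 : ∀ z : Fin (d + 1) → ℝ, f i (i.insertNth R z) = 0 := fun z => by
      have := hzero (i.insertNth R z) i (by simp [le_abs_self])
      simp [f, this]
    have h2 : ∀ z : Fin (d + 1) → ℝ, f i (i.insertNth (-R) z) = 0 := fun z => by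
      have := hzero (i.insertNth (-R) z) i (by simp [le_abs_self])
      simp [f, this]
    simp [h1, h2]

theorem divergence_smul {d : ℕ} {v : E d → E d} {ψ : E d → ℝ} {x : E d}
    (hv : DifferentiableAt ℝ v x) (hψ : DifferentiableAt ℝ ψ x) :
    divergence (fun z => ψ z • v z) x = ψ x * divergence v x + fderiv ℝ ψ x (v x) := by
  have : fderiv ℝ ψ x (v x) = ∑ i, v x i * fderiv ℝ ψ x (stdVec i) := by
    conv_lhs => rw [← coord_sum (v x)]
    simp
  simp only [divergence]
  rw [fderiv_fun_smul hψ hv, this, Finset.mul_sum, ← Finset.sum_add_distrib]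
  refine Finset.sum_congr rfl fun i _ => ?_
  simp
  ring

theorem divergence_eq_zero_of_notMem_tsupport {d : ℕ} {v : E d → E d} {x : E d}
    (hx : x ∉ tsupport v) : divergence v x = 0 := by
  have : v =ᶠ[𝓝 x] fun _ => 0 := notMem_tsupport_iff_eventuallyEq.1 hx
  simp [divergence, this.fderiv_eq]

theorem hasCompactSupport_divergence {d : ℕ} {v : E d → E d} (hc : HasCompactSupport v) :
    HasCompactSupport (divergence v) :=
  HasCompactSupport.intro hc.isCompact fun _ hx => divergence_eq_zero_of_notMem_tsupport hx

/-- The integral of `divergence (ψ • v)` is zero. In other words, the pointwise divergence is also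
the distributional one. -/
theorem integral_divergence_smul {d : ℕ} {v : E d → E d} (hv : Differentiable ℝ v)
    (hc : HasCompactSupport v) (hd : Continuous (divergence v)) {ψ : E d → ℝ}
    (hψ : ContDiff ℝ 1 ψ) :
    ∫ x, fderiv ℝ ψ x (v x) = - ∫ x, ψ x * divergence v x := by
  have hψ' := hψ.differentiable one_ne_zero
  have h1 : Integrable (fun x => ψ x * divergence v x) :=
    (hψ.continuous.mul hd).integrable_of_hasCompactSupport
      (hasCompactSupport_divergence hc).mul_left
  have h2 : Integrable (fun x => fderiv ℝ ψ x (v x)) := by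
    refine Continuous.integrable_of_hasCompactSupport ?_ ?_
    · exact (hψ.continuous_fderiv one_ne_zero).clm_apply hv.continuous
    · exact HasCompactSupport.intro hc.isCompact fun x hx => by
        rw [image_eq_zero_of_notMem_tsupport hx, map_zero]
  have e : divergence (fun z => ψ z • v z) =
      fun x => ψ x * divergence v x + fderiv ℝ ψ x (v x) :=
    funext fun x => divergence_smul (hv x) (hψ' x)
  have := integral_divergence_eq_zero (v := fun z => ψ z • v z) (hψ'.smul hv)
    (hc.smul_left (f := ψ)) (by rw [e]; exact h1.add h2)
  rw [e, integral_add h1 h2] at this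
  linarith

open scoped Convolution in
/-- The divergence theorem, tested against a Lipschitz function. The field need not be `C¹`: it is
enough that its divergence is continuous. -/
theorem integral_fderiv_lipschitz_eq {d : ℕ} {v : E d → E d} (hv : Differentiable ℝ v)
    (hc : HasCompactSupport v) (hd : Continuous (divergence v)) {χ : E d → ℝ} {C : NNReal}
    (hχ : LipschitzWith C χ) :
    ∫ x, fderiv ℝ χ x (v x) = - ∫ x, χ x * divergence v x := by
  -- Mollifiers of radius `1 / (k + 1) ≤ 1`: all mollified functions then live on the 1-thickening
  -- `K` of the support, which gives one dominating function for the whole sequence.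
  let ρ : ℕ → ContDiffBump (0 : E d) := fun k =>
    ⟨1 / (2 * ((k : ℝ) + 1)), 1 / ((k : ℝ) + 1), by positivity, by
      apply one_div_lt_one_div_of_lt <;> [positivity; linarith [(k.cast_nonneg : (0 : ℝ) ≤ k)]]⟩
  have hρ : Filter.Tendsto (fun k => (ρ k).rOut) Filter.atTop (𝓝 0) :=
    tendsto_one_div_add_atTop_nhds_zero_nat
  have hρ1 : ∀ k, (ρ k).rOut ≤ 1 := fun k => by
    show 1 / ((k : ℝ) + 1) ≤ 1
    rw [div_le_one (by positivity)]
    linarith [(k.cast_nonneg : (0 : ℝ) ≤ k)]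
  let r : ℕ → E d → ℝ := fun k => (ρ k).normed volume
  let K : Set (E d) := Metric.cthickening 1 (tsupport v)
  have hK : IsCompact K := hc.isCompact.cthickening
  -- mollification of a continuous function supported in `tsupport v`
  have conv_bound : ∀ g : E d → ℝ, Continuous g → (∀ x ∉ tsupport v, g x = 0) →
      ∃ M : ℝ, 0 ≤ M ∧ ∀ k x, |(r k ⋆[ContinuousLinearMap.lsmul ℝ ℝ, volume] g) x| ≤
        K.indicator (fun _ => M) x := by
    intro g hg hg0
    have hgc : HasCompactSupport g := HasCompactSupport.intro hc.isCompact hg0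
    obtain ⟨M, hM⟩ := hgc.exists_bound_of_continuous hg
    have hM0 : 0 ≤ M := (norm_nonneg _).trans (hM 0)
    -- `2 * M` bounds the oscillation of `g`, hence the distance from `g` to its mollification; the
    -- other `M` bounds `g`.
    refine ⟨2 * M + M, by positivity, fun k x => ?_⟩
    by_cases hx : x ∈ K
    · rw [Set.indicator_of_mem hx]
      have h1 := (ρ k).dist_normed_convolution_le (μ := volume) (g := g) (x₀ := x) (ε := 2 * M)
        hg.aestronglyMeasurable (fun z _ => by
          rw [dist_eq_norm]
          linarith [norm_sub_le (g z) (g x), hM z, hM x])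
      have h2 := hM x
      rw [Real.dist_eq] at h1
      rw [Real.norm_eq_abs] at h2
      have h3 := abs_sub_abs_le_abs_sub ((r k ⋆[ContinuousLinearMap.lsmul ℝ ℝ, volume] g) x) (g x)
      have h1' : |(r k ⋆[ContinuousLinearMap.lsmul ℝ ℝ, volume] g) x - g x| ≤ 2 * M := h1
      linarith
    · rw [Set.indicator_of_notMem hx]
      have hz : ∀ z ∈ Metric.ball x (ρ k).rOut, g z = 0 := by
        intro z hz
        apply hg0
        intro hzs
        apply hx
        refine Metric.mem_cthickening_of_dist_le x z 1 _ hzs ?_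
        rw [dist_comm]
        exact (Metric.mem_ball.1 hz).le.trans (hρ1 k)
      have := (ρ k).normed_convolution_eq_right (μ := volume) (g := g) (x₀ := x)
        (fun z hz' => by rw [hz z hz', hz x (Metric.mem_ball_self (ρ k).rOut_pos)])
      have h' : (r k ⋆[ContinuousLinearMap.lsmul ℝ ℝ, volume] g) x = g x := this
      rw [h', hz x (Metric.mem_ball_self (ρ k).rOut_pos), abs_zero]
  have hr : ∀ k, ContDiff ℝ 1 (r k) := fun k => (ρ k).contDiff_normed
  have hrc : ∀ k, HasCompactSupport (r k) := fun k => (ρ k).hasCompactSupport_normed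
  let vi : Fin (d + 2) → E d → ℝ := fun i x => v x i
  have hvi : ∀ i, Continuous (vi i) := fun i => by
    have := hv.continuous
    fun_prop
  have hvi0 : ∀ i, ∀ x ∉ tsupport v, vi i x = 0 := fun i x hx => by
    simp [vi, image_eq_zero_of_notMem_tsupport hx]
  have hvic : ∀ i, HasCompactSupport (vi i) := fun i =>
    HasCompactSupport.intro hc.isCompact (hvi0 i)
  let w : ℕ → Fin (d + 2) → E d → ℝ := fun k i =>
    r k ⋆[ContinuousLinearMap.lsmul ℝ ℝ, volume] vi i
  let G : ℕ → E d → ℝ := fun k => r k ⋆[ContinuousLinearMap.lsmul ℝ ℝ, volume] divergence v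
  have hwc : ∀ k i, HasCompactSupport (w k i) := fun k i =>
    (hrc k).convolution _ (hvic i)
  have hwd : ∀ k i, ContDiff ℝ 1 (w k i) := fun k i =>
    (hrc k).contDiff_convolution_left _ (hr k) (hvi i).locallyIntegrable
  -- The divergence of the mollified field is the mollified divergence: the derivatives fall on the
  -- mollifier, and `z ↦ r k (x - z)`, whose gradient carries a minus sign, is an admissible `ψ` in
  -- `integral_divergence_smul`.
  have hdw : ∀ k x, ∑ i, fderiv ℝ (w k i) x (stdVec i) = G k x := by
    intro k x
    have h1 : ∀ i, fderiv ℝ (w k i) x (stdVec i) =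
        ∫ z, fderiv ℝ (r k) (x - z) (stdVec i) * v z i := by
      intro i
      rw [((hrc k).hasFDerivAt_convolution_left _ (hr k) (hvi i).locallyIntegrable x).fderiv]
      rw [convolution_eq_swap]
      rw [ContinuousLinearMap.integral_apply]
      · rfl
      · refine Continuous.integrable_of_hasCompactSupport ?_ ?_
        · have := (hr k).continuous_fderiv one_ne_zero
          have h3 := hvi i
          fun_prop
        · refine HasCompactSupport.intro hc.isCompact fun z hz => ?_
          simp [hvi0 i z hz]
    have hintg : ∀ i, Integrable (fun z => fderiv ℝ (r k) (x - z) (stdVec i) * v z i) := by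
      intro i
      refine Continuous.integrable_of_hasCompactSupport ?_ ?_
      · have := (hr k).continuous_fderiv one_ne_zero
        have h3 := hvi i
        exact ((this.comp (continuous_const.sub continuous_id)).clm_apply continuous_const).mul h3
      · exact (hvic i).mul_left
    simp_rw [h1]
    rw [← integral_finsetSum _ (fun i _ => hintg i)]
    have hψ : ContDiff ℝ 1 (fun z => r k (x - z)) := (hr k).comp (contDiff_const.sub contDiff_id)
    have h2 := integral_divergence_smul hv hc hd hψ
    have h3 : ∀ z, fderiv ℝ (fun z => r k (x - z)) z (v z) =
        - ∑ i, fderiv ℝ (r k) (x - z) (stdVec i) * v z i := by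
      intro z
      have : HasFDerivAt (fun z => r k (x - z))
          ((fderiv ℝ (r k) (x - z)).comp (-ContinuousLinearMap.id ℝ (E d))) z :=
        (((hr k).differentiable one_ne_zero) (x - z)).hasFDerivAt.comp z
          ((hasFDerivAt_id z).const_sub x)
      rw [this.fderiv]
      conv_lhs => rw [← coord_sum (v z)]
      simp [mul_comm]
    simp_rw [h3, integral_neg, neg_inj] at h2
    rw [h2]
    show _ = (r k ⋆[ContinuousLinearMap.lsmul ℝ ℝ, volume] divergence v) x
    rw [convolution_eq_swap]
    rfl
  -- The components of the mollified field are `C¹` with compact support, so integration by parts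
  -- against the Lipschitz `χ` is possible one coordinate at a time.
  have hlip : ∀ k i, ∫ x, lineDeriv ℝ χ x (stdVec i) * w k i x =
      - ∫ x, χ x * fderiv ℝ (w k i) x (stdVec i) := by
    intro k i
    obtain ⟨D, hD⟩ := (hwd k i).lipschitzWith_of_hasCompactSupport (hwc k i) one_ne_zero
    rw [hχ.integral_lineDeriv_mul_eq hD (hwc k i), ← integral_neg]
    congr with x
    rw [(((hwd k i).differentiable one_ne_zero) x).lineDeriv_eq_fderiv]
    simp [mul_comm]
  have hLm : ∀ i, Measurable (fun x => lineDeriv ℝ χ x (stdVec i)) := fun i =>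
    measurable_lineDeriv hχ.continuous
  have hLb : ∀ i x, |lineDeriv ℝ χ x (stdVec i)| ≤ C := fun i x => by
    have := norm_lineDeriv_le_of_lipschitz ℝ hχ (x₀ := x) (v := stdVec i)
    simpa [stdVec] using this
  have hKint : ∀ M : ℝ, Integrable (K.indicator (fun _ => M) : E d → ℝ) := fun M =>
    IntegrableOn.integrable_indicator (integrableOn_const hK.measure_lt_top.ne) hK.measurableSet
  have hk : ∀ k, ∑ i, ∫ x, lineDeriv ℝ χ x (stdVec i) * w k i x = - ∫ x, χ x * G k x := by
    intro k
    simp_rw [hlip, Finset.sum_neg_distrib, neg_inj]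
    rw [← integral_finsetSum]
    · simp_rw [← Finset.mul_sum, hdw]
    · intro i _
      refine Continuous.integrable_of_hasCompactSupport ?_ ?_
      · exact hχ.continuous.mul (((hwd k i).continuous_fderiv one_ne_zero).clm_apply
          continuous_const)
      · exact ((hwc k i).fderiv_apply ℝ _).mul_left
  have lim1 : ∀ i, Filter.Tendsto (fun k => ∫ x, lineDeriv ℝ χ x (stdVec i) * w k i x)
      Filter.atTop (𝓝 (∫ x, lineDeriv ℝ χ x (stdVec i) * v x i)) := by
    intro i
    obtain ⟨M, hM0, hM⟩ := conv_bound (vi i) (hvi i) (hvi0 i)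
    refine tendsto_integral_of_dominated_convergence (fun x => K.indicator (fun _ => C * M) x)
      (fun k => ?_) (hKint _) (fun k => Filter.Eventually.of_forall fun x => ?_)
      (Filter.Eventually.of_forall fun x => ?_)
    · exact ((hLm i).aestronglyMeasurable).mul (hwd k i).continuous.aestronglyMeasurable
    · rw [norm_mul, Real.norm_eq_abs, Real.norm_eq_abs]
      have h1 := mul_le_mul (hLb i x) (hM k x) (abs_nonneg _) C.2
      refine h1.trans (le_of_eq ?_)
      by_cases hx : x ∈ K <;> simp [hx]
    · exact tendsto_const_nhds.mul
        (ContDiffBump.convolution_tendsto_right_of_continuous hρ (hvi i) x)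
  have lim2 : Filter.Tendsto (fun k => ∫ x, χ x * G k x)
      Filter.atTop (𝓝 (∫ x, χ x * divergence v x)) := by
    obtain ⟨M, hM0, hM⟩ := conv_bound (divergence v) hd
      (fun x hx => divergence_eq_zero_of_notMem_tsupport hx)
    obtain ⟨X, hX⟩ := hK.exists_bound_of_continuousOn hχ.continuous.continuousOn
    refine tendsto_integral_of_dominated_convergence (fun x => K.indicator (fun _ => X * M) x)
      (fun k => ?_) (hKint _) (fun k => Filter.Eventually.of_forall fun x => ?_)
      (Filter.Eventually.of_forall fun x => ?_)
    · refine hχ.continuous.aestronglyMeasurable.mul (Continuous.aestronglyMeasurable ?_)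
      exact ((hrc k).contDiff_convolution_left (n := 1) _ (hr k) hd.locallyIntegrable).continuous
    · rw [norm_mul]
      by_cases hx : x ∈ K
      · have := hM k x
        rw [Set.indicator_of_mem hx] at this ⊢
        exact mul_le_mul (hX x hx) this (norm_nonneg _) ((norm_nonneg _).trans (hX x hx))
      · have := hM k x
        rw [Set.indicator_of_notMem hx] at this ⊢
        rw [show G k x = 0 from abs_nonpos_iff.1 this, norm_zero, mul_zero]
    · exact tendsto_const_nhds.mul
        (ContDiffBump.convolution_tendsto_right_of_continuous hρ hd x)
  have lim := tendsto_nhds_unique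
    ((tendsto_finsetSum Finset.univ fun i _ => lim1 i).congr hk) lim2.neg
  rw [← lim, ← integral_finsetSum]
  · refine integral_congr_ae ?_
    filter_upwards [hχ.ae_differentiableAt (μ := volume)] with x hx
    conv_lhs => rw [← coord_sum (v x)]
    simp only [map_sum, map_smul, smul_eq_mul]
    refine Finset.sum_congr rfl fun i _ => ?_
    rw [hx.lineDeriv_eq_fderiv, mul_comm]
  · intro i _
    refine Integrable.bdd_mul (c := C) ((hvi i).integrable_of_hasCompactSupport (hvic i))
      (hLm i).aestronglyMeasurable (Filter.Eventually.of_forall fun x => hLb i x)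

/-! ### The area formula for Lipschitz graphs -/

theorem euclideanHausdorffMeasure_image_le {X Y : Type*} [EMetricSpace X] [MeasurableSpace X]
    [BorelSpace X] [EMetricSpace Y] [MeasurableSpace Y] [BorelSpace Y] {K : NNReal} {f : X → Y}
    {s : Set X} (h : LipschitzOnWith K f s) (k : ℕ) :
    Measure.euclideanHausdorffMeasure k (f '' s) ≤
      (K : ENNReal) ^ k * Measure.euclideanHausdorffMeasure k s := by
  have := h.hausdorffMeasure_image_le (d := k) k.cast_nonneg
  rw [ENNReal.rpow_natCast] at this
  rw [Measure.euclideanHausdorffMeasure_def, Measure.euclideanHausdorffMeasure_def,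
    Measure.smul_apply, Measure.smul_apply]
  rw [mul_smul_comm]
  gcongr

section Graph

variable {H : Type*} [NormedAddCommGroup H] [InnerProductSpace ℝ H]

/-- The hyperplane orthogonal to `ν`. -/
abbrev hyper (ν : H) : Submodule ℝ H := (Submodule.span ℝ {ν})ᗮ

/-- The orthogonal projection to the hyperplane orthogonal to `ν`. -/
abbrev hproj (ν : H) : H →L[ℝ] hyper ν := (hyper ν).orthogonalProjectionOnto

/-- The parametrization of the graph of `φ` in the direction `ν`. -/
def graphMap (ν : H) (φ : hyper ν → ℝ) (x : hyper ν) : H := x + φ x • ν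

theorem inner_hyper (ν : H) (x : hyper ν) : ⟪ν, (x : H)⟫ = 0 :=
  Submodule.mem_orthogonal_singleton_iff_inner_right.1 x.2

theorem hproj_hyper (ν : H) (x : hyper ν) : hproj ν x = x :=
  Submodule.orthogonalProjectionOnto_mem_subspace_eq_self x

theorem hproj_normal (ν : H) : hproj ν ν = 0 :=
  Submodule.orthogonalProjectionOnto_orthogonalComplement_singleton_eq_zero ν

theorem hproj_add_smul (ν : H) (x : hyper ν) (t : ℝ) : hproj ν ((x : H) + t • ν) = x := by
  rw [map_add, map_smul, hproj_hyper, hproj_normal, smul_zero, add_zero]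

theorem inner_add_smul {ν : H} (hν : ‖ν‖ = 1) (x : hyper ν) (t : ℝ) :
    ⟪ν, (x : H) + t • ν⟫ = t := by
  rw [inner_add_right, inner_hyper, inner_smul_right, real_inner_self_eq_norm_sq, hν]
  simp

theorem hproj_add_inner {ν : H} (hν : ‖ν‖ = 1) (z : H) :
    (hproj ν z : H) + ⟪ν, z⟫ • ν = z := by
  have h := (Submodule.span ℝ {ν}).starProjection_add_starProjection_orthogonal z
  rw [Submodule.starProjection_unit_singleton ℝ hν] at h
  rw [add_comm]
  exact h

theorem hproj_graphMap (ν : H) (φ : hyper ν → ℝ) (x : hyper ν) :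
    hproj ν (graphMap ν φ x) = x := hproj_add_smul ν x _

theorem norm_add_smul_sq {ν : H} (hν : ‖ν‖ = 1) (x : hyper ν) (t : ℝ) :
    ‖(x : H) + t • ν‖ ^ 2 = ‖x‖ ^ 2 + t ^ 2 := by
  rw [norm_add_sq_real, inner_smul_right, real_inner_comm, inner_hyper, norm_smul, hν]
  simp

/-- The area density of the graph of a function with derivative `ℓ`. -/
def areaDensity {V : Type*} [NormedAddCommGroup V] [NormedSpace ℝ V] (ℓ : V →L[ℝ] ℝ) : ℝ :=
  √(1 + ‖ℓ‖ ^ 2)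

theorem one_le_areaDensity {V : Type*} [NormedAddCommGroup V] [NormedSpace ℝ V]
    (ℓ : V →L[ℝ] ℝ) : 1 ≤ areaDensity ℓ :=
  Real.one_le_sqrt.2 (by nlinarith [sq_nonneg ‖ℓ‖])

/-- `√(1 + t²)` is 1-Lipschitz in `t` and at least `1`, so an additive error `c` costs at most a
factor `1 + c`. A multiplicative error survives summation over infinitely many pieces, even of
infinite total area. -/
theorem areaDensity_le {V : Type*} [NormedAddCommGroup V] [NormedSpace ℝ V]
    {ℓ ℓ' : V →L[ℝ] ℝ} {c : ℝ} (h : ‖ℓ - ℓ'‖ ≤ c) :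
    areaDensity ℓ ≤ (1 + c) * areaDensity ℓ' := by
  have h1 := one_le_areaDensity ℓ'
  have hc : 0 ≤ c := (norm_nonneg _).trans h
  have h2 : ‖ℓ‖ ≤ ‖ℓ'‖ + c := by
    have := norm_sub_norm_le ℓ ℓ'
    linarith
  have hsq : areaDensity ℓ' ^ 2 = 1 + ‖ℓ'‖ ^ 2 := Real.sq_sqrt (by positivity)
  have h3 : ‖ℓ'‖ ≤ areaDensity ℓ' := Real.le_sqrt_of_sq_le (by linarith)
  refine Real.sqrt_le_iff.2 ⟨by positivity, ?_⟩
  have h4 : ‖ℓ‖ ^ 2 ≤ (‖ℓ'‖ + c) ^ 2 := by gcongr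
  nlinarith [mul_nonneg hc (sub_nonneg.2 h3), sq_nonneg c, mul_nonneg hc (norm_nonneg ℓ'),
    mul_nonneg hc (mul_nonneg (norm_nonneg ℓ') (norm_nonneg ℓ')), mul_nonneg hc hc,
    mul_nonneg (mul_nonneg hc hc) (sq_nonneg ‖ℓ'‖),
    mul_nonneg hc (mul_nonneg (sub_nonneg.2 h3) (le_trans zero_le_one h1)),
    mul_nonneg hc (sub_nonneg.2 h1)]

/-- A linear automorphism with the same metric distortion as the graph of `ℓ`. -/
theorem exists_graph_isometric {V : Type*} [NormedAddCommGroup V] [InnerProductSpace ℝ V]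
    [FiniteDimensional ℝ V] (ℓ : V →L[ℝ] ℝ) :
    ∃ T : V →ₗ[ℝ] V, LinearMap.det T = areaDensity ℓ ∧ ∀ x, ‖T x‖ ^ 2 = ‖x‖ ^ 2 + ℓ x ^ 2 := by
  let u : V := (InnerProductSpace.toDual ℝ V).symm ℓ
  have hu : ∀ x, ⟪u, x⟫ = ℓ x := fun x => InnerProductSpace.toDual_symm_apply
  have hun : ‖u‖ = ‖ℓ‖ := LinearIsometryEquiv.norm_map _ _
  have hℓu : ℓ u = ‖ℓ‖ ^ 2 := by rw [← hu, real_inner_self_eq_norm_sq, hun]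
  have ha := one_le_areaDensity ℓ
  have hsq : areaDensity ℓ ^ 2 = 1 + ‖ℓ‖ ^ 2 := Real.sq_sqrt (by positivity)
  set a := areaDensity ℓ
  have ha1 : (1 + a) ≠ 0 := by positivity
  -- With `T x = x + ℓ x • (1 + a)⁻¹ • u` and `‖u‖² = a² - 1`, the squared norm grows by `(2 / (1 +
  -- a) + (a² - 1) / (1 + a)²) ℓ(x)² = ℓ(x)²`, and the determinant is `1 + (a² - 1) / (1 + a) = a`.
  refine ⟨LinearMap.transvection (ℓ : V →ₗ[ℝ] ℝ) ((1 + a)⁻¹ • u), ?_, fun x => ?_⟩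
  · rw [LinearMap.transvection.det]
    simp only [ContinuousLinearMap.coe_coe, map_smul, smul_eq_mul, hℓu]
    field_simp
    nlinarith
  · rw [LinearMap.transvection.apply]
    simp only [ContinuousLinearMap.coe_coe]
    rw [norm_add_sq_real, smul_smul, inner_smul_right, real_inner_comm, hu, norm_smul, hun, mul_pow,
      Real.norm_eq_abs, sq_abs]
    have : ‖ℓ‖ ^ 2 = a ^ 2 - 1 := by linarith
    rw [this]
    field_simp
    ring

theorem lipschitzWith_graphMap {ν : H} (hν : ‖ν‖ = 1) {φ : hyper ν → ℝ} {C : NNReal}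
    (hφ : LipschitzWith C φ) : LipschitzWith (1 + C) (graphMap ν φ) := by
  have h1 : LipschitzWith 1 (fun x : hyper ν => (x : H)) := LipschitzWith.subtype_val _
  have h2 : LipschitzWith C (fun x : hyper ν => φ x • ν) := by
    refine LipschitzWith.of_dist_le_mul fun x z => ?_
    rw [dist_eq_norm, ← sub_smul, norm_smul, hν, mul_one]
    exact hφ.dist_le_mul x z
  exact h1.add h2

variable [FiniteDimensional ℝ H] [MeasurableSpace H] [BorelSpace H]

/-- Bounds for the area of the part of a graph over a set where it is nearly linear. -/
theorem graph_area_bounds {ν : H} (hν : ‖ν‖ = 1) {k : ℕ} (hk : Module.finrank ℝ (hyper ν) = k)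
    {φ : hyper ν → ℝ} {ℓ : hyper ν →L[ℝ] ℝ} {B : Set (hyper ν)} {c : NNReal} (hc : c < 1)
    (h : ApproximatesLinearOn φ ℓ B c) :
    Measure.euclideanHausdorffMeasure k (graphMap ν φ '' B) ≤
        ((1 + c : NNReal) : ENNReal) ^ k * (ENNReal.ofReal (areaDensity ℓ) * volume B) ∧
      ENNReal.ofReal (areaDensity ℓ) * volume B ≤ (((1 - c)⁻¹ : NNReal) : ENNReal) ^ k *
        Measure.euclideanHausdorffMeasure k (graphMap ν φ '' B) := by
  obtain ⟨T, hT, hTn⟩ := exists_graph_isometric ℓ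
  have hdet : LinearMap.det T ≠ 0 := by
    rw [hT]; exact (zero_lt_one.trans_le (one_le_areaDensity ℓ)).ne'
  have hvol : (Measure.euclideanHausdorffMeasure k : Measure (hyper ν)) (T '' B) =
      ENNReal.ofReal (areaDensity ℓ) * volume B := by
    rw [← hk, InnerProductSpace.euclideanHausdorffMeasure_eq_volume,
      Measure.addHaar_image_linearMap, hT, abs_of_pos (zero_lt_one.trans_le (one_le_areaDensity ℓ))]
  let e : hyper ν ≃ₗ[ℝ] hyper ν := LinearEquiv.ofIsUnitDet
    (v := Module.finBasis ℝ (hyper ν)) (v' := Module.finBasis ℝ (hyper ν)) (f := T)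
    (by rw [LinearMap.det_toMatrix]; exact isUnit_iff_ne_zero.2 hdet)
  have he : ∀ x, e x = T x := fun x => rfl
  have hsymm : ∀ x, e.symm (T x) = x := fun x => e.symm_apply_apply x
  have hlow : ∀ x : hyper ν, ‖x‖ ≤ ‖T x‖ := fun x => by
    have := hTn x
    exact le_of_sq_le_sq (by nlinarith [sq_nonneg (ℓ x)]) (norm_nonneg _)
  -- Distances on the graph of `ℓ` are those measured by `T`, and `φ` deviates from `ℓ` by at most
  -- `c * ‖x - z‖ ≤ c * ‖T (x - z)‖`. So the passage from `T '' B` to the graph of `φ` distorts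
  -- distances only by factors between `1 - c` and `1 + c`.
  have hclose : ∀ x ∈ B, ∀ z ∈ B,
      |‖graphMap ν φ x - graphMap ν φ z‖ - ‖T (x - z)‖| ≤ c * ‖T (x - z)‖ := by
    intro x hx z hz
    have h1 : ‖T (x - z)‖ = ‖((x - z : hyper ν) : H) + ℓ (x - z) • ν‖ := by
      have h2 := norm_add_smul_sq hν (x - z) (ℓ (x - z))
      rw [← hTn] at h2
      exact ((pow_left_inj₀ (norm_nonneg _) (norm_nonneg _) two_ne_zero).1 h2).symm
    have h3 : graphMap ν φ x - graphMap ν φ z - (((x - z : hyper ν) : H) + ℓ (x - z) • ν) =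
        (φ x - φ z - ℓ (x - z)) • ν := by
      simp only [graphMap, Submodule.coe_sub]
      module
    calc _ ≤ ‖graphMap ν φ x - graphMap ν φ z - (((x - z : hyper ν) : H) + ℓ (x - z) • ν)‖ := by
          rw [h1]; exact abs_norm_sub_norm_le _ _
      _ = ‖φ x - φ z - ℓ (x - z)‖ := by rw [h3, norm_smul, hν, mul_one]
      _ ≤ c * ‖x - z‖ := h x hx z hz
      _ ≤ _ := by gcongr; exact hlow _
  constructor
  · rw [← hvol]
    have hl : LipschitzOnWith (1 + c) (fun w => graphMap ν φ (e.symm w)) (T '' B) := by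
      refine LipschitzOnWith.of_dist_le_mul ?_
      rintro _ ⟨x, hx, rfl⟩ _ ⟨z, hz, rfl⟩
      rw [hsymm, hsymm, dist_eq_norm, dist_eq_norm, ← map_sub]
      have := (abs_le.1 (hclose x hx z hz)).2
      push_cast
      linarith
    have := euclideanHausdorffMeasure_image_le hl k
    rw [Set.image_image] at this
    simpa only [hsymm] using this
  · rw [← hvol]
    have hl : LipschitzOnWith (1 - c)⁻¹ (fun w => T (hproj ν w)) (graphMap ν φ '' B) := by
      refine LipschitzOnWith.of_dist_le_mul ?_
      rintro _ ⟨x, hx, rfl⟩ _ ⟨z, hz, rfl⟩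
      rw [hproj_graphMap, hproj_graphMap, dist_eq_norm, dist_eq_norm, ← map_sub]
      have := (abs_le.1 (hclose x hx z hz)).1
      have hpos : (0 : ℝ) < 1 - c := by
        have : (c : ℝ) < 1 := by exact_mod_cast hc
        linarith
      rw [NNReal.coe_inv, NNReal.coe_sub hc.le, NNReal.coe_one, ← div_eq_inv_mul,
        le_div_iff₀ hpos]
      linarith
    have := euclideanHausdorffMeasure_image_le hl k
    rw [Set.image_image] at this
    simpa only [hproj_graphMap] using this

/-- `ApproximatesLinearOn.norm_fderiv_sub_le` concerns maps of a space to itself. It is applied to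
`x ↦ φ x • u` with a unit vector `u`, whose existence is the reason for `Nontrivial V`. -/
theorem norm_fderiv_sub_le_of_approximatesLinearOn {V : Type*} [NormedAddCommGroup V]
    [InnerProductSpace ℝ V] [FiniteDimensional ℝ V] [MeasurableSpace V] [BorelSpace V]
    [Nontrivial V] {φ : V → ℝ} {ℓ : V →L[ℝ] ℝ} {s : Set V} {c : NNReal}
    (h : ApproximatesLinearOn φ ℓ s c) (hs : MeasurableSet s)
    (hφ : ∀ x ∈ s, DifferentiableAt ℝ φ x) :
    ∀ᵐ x ∂(volume.restrict s), ‖fderiv ℝ φ x - ℓ‖ ≤ c := by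
  obtain ⟨u, hu⟩ := exists_norm_eq V (zero_le_one (α := ℝ))
  have h' : ApproximatesLinearOn (fun x => φ x • u) (ℓ.smulRight u) s c := by
    intro x hx z hz
    have := h x hx z hz
    rw [ContinuousLinearMap.smulRight_apply, ← sub_smul, ← sub_smul, norm_smul, hu, mul_one]
    exact this
  filter_upwards [h'.norm_fderiv_sub_le volume hs (fun x => (fderiv ℝ φ x).smulRight u)
    (fun x hx => ((hφ x hx).hasFDerivAt.smul_const u).hasFDerivWithinAt)] with x hx
  have e : (fderiv ℝ φ x).smulRight u - ℓ.smulRight u = (fderiv ℝ φ x - ℓ).smulRight u := by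
    ext z
    simp [sub_smul]
  have hx' : ‖(fderiv ℝ φ x).smulRight u - ℓ.smulRight u‖ ≤ c := hx
  rw [e, ContinuousLinearMap.norm_smulRight_apply, hu, mul_one] at hx'
  exact hx'

/-- The area formula for the graph of a Lipschitz function. -/
theorem graph_area {ν : H} (hν : ‖ν‖ = 1) {k : ℕ} (hk : Module.finrank ℝ (hyper ν) = k)
    [Nontrivial (hyper ν)] {φ : hyper ν → ℝ} {C : NNReal} (hφ : LipschitzWith C φ)
    {B : Set (hyper ν)} (hB : MeasurableSet B) :
    Measure.euclideanHausdorffMeasure k (graphMap ν φ '' B) =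
      ∫⁻ x in B, ENNReal.ofReal (areaDensity (fderiv ℝ φ x)) := by
  have hgl := lipschitzWith_graphMap hν hφ
  have hginj : Function.Injective (graphMap ν φ) := Function.LeftInverse.injective
    (g := fun z => hproj ν z) (hproj_graphMap ν φ)
  have hgemb : MeasurableEmbedding (graphMap ν φ) := hgl.continuous.measurableEmbedding hginj
  -- reduction to the set of points of differentiability
  set D : Set (hyper ν) := {x | DifferentiableAt ℝ φ x} with hD
  have hDm : MeasurableSet D := measurableSet_of_differentiableAt ℝ φ
  have hDc : volume Dᶜ = 0 := hφ.ae_differentiableAt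
  -- Rademacher's theorem makes `B \ D` a null set, and a Lipschitz map keeps it null for the
  -- `k`-dimensional measure.
  have hnull : Measure.euclideanHausdorffMeasure k (graphMap ν φ '' (B \ D)) = 0 := by
    refine le_antisymm ((euclideanHausdorffMeasure_image_le (hgl.lipschitzOnWith (s := B \ D))
      k).trans ?_) (zero_le)
    rw [← hk, InnerProductSpace.euclideanHausdorffMeasure_eq_volume,
      measure_mono_null (fun x hx => hx.2) hDc, mul_zero]
  set s := B ∩ D with hs
  have hsm : MeasurableSet s := hB.inter hDm
  have e1 : Measure.euclideanHausdorffMeasure k (graphMap ν φ '' B) =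
      Measure.euclideanHausdorffMeasure k (graphMap ν φ '' s) := by
    refine le_antisymm ?_ (measure_mono (Set.image_mono Set.inter_subset_left))
    calc _ = Measure.euclideanHausdorffMeasure k
          (graphMap ν φ '' s ∪ graphMap ν φ '' (B \ D)) := by
          rw [← Set.image_union, Set.inter_union_sdiff]
      _ ≤ _ := (measure_union_le _ _).trans (by rw [hnull, add_zero])
  have e2 : ∫⁻ x in B, ENNReal.ofReal (areaDensity (fderiv ℝ φ x)) =
      ∫⁻ x in s, ENNReal.ofReal (areaDensity (fderiv ℝ φ x)) := by
    refine setLIntegral_congr ?_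
    refine (inter_ae_eq_left_of_ae_eq_univ ?_).symm
    exact ae_eq_univ.2 hDc
  rw [e1, e2]
  set I := ∫⁻ x in s, ENNReal.ofReal (areaDensity (fderiv ℝ φ x)) with hI
  set M := Measure.euclideanHausdorffMeasure k (graphMap ν φ '' s) with hM
  -- Countably many pieces on each of which `φ` is `c`-close to a linear map. On a piece, `k`
  -- factors of the distortion come from comparing measures, and one further factor `1 + c` from
  -- replacing the density at `x` by that of the linear map. Both inequalities become sharp as `c →
  -- 0`.
  have key : ∀ c : NNReal, 0 < c → c < 1 →
      M ≤ ((1 + c : NNReal) : ENNReal) ^ (k + 1) * I ∧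
      I ≤ ((1 + c : NNReal) : ENNReal) * (((1 - c)⁻¹ : NNReal) : ENNReal) ^ k * M := by
    intro c hc0 hc1
    obtain ⟨t, ℓ, htd, htm, hst, happ, -⟩ :=
      exists_partition_approximatesLinearOn_of_hasFDerivWithinAt φ s (fderiv ℝ φ)
        (fun x hx => hx.2.hasFDerivAt.hasFDerivWithinAt) (fun _ => c) (fun _ => hc0.ne')
    have hsU : s = ⋃ n, s ∩ t n := by
      rw [← Set.inter_iUnion]; exact (Set.inter_eq_left.2 hst).symm
    have hdisj : Pairwise (Function.onFun Disjoint fun n => s ∩ t n) := fun i j hij =>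
      (htd hij).mono Set.inter_subset_right Set.inter_subset_right
    have hIs : I = ∑' n, ∫⁻ x in s ∩ t n, ENNReal.ofReal (areaDensity (fderiv ℝ φ x)) := by
      rw [hI]
      conv_lhs => rw [hsU]
      exact lintegral_iUnion (fun n => hsm.inter (htm n)) hdisj _
    have hMs : M = ∑' n, Measure.euclideanHausdorffMeasure k (graphMap ν φ '' (s ∩ t n)) := by
      rw [hM]
      conv_lhs => rw [hsU, Set.image_iUnion]
      refine measure_iUnion (fun i j hij => ?_) fun n =>
        hgemb.measurableSet_image.2 (hsm.inter (htm n))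
      exact (Set.disjoint_image_iff hginj).2 (hdisj hij)
    have hae : ∀ n, ∀ᵐ x ∂(volume.restrict (s ∩ t n)), ‖fderiv ℝ φ x - ℓ n‖ ≤ c := fun n =>
      norm_fderiv_sub_le_of_approximatesLinearOn (happ n) (hsm.inter (htm n)) fun x hx => hx.1.2
    have hof : ∀ a : ℝ, ENNReal.ofReal ((1 + (c : ℝ)) * a) =
        ((1 + c : NNReal) : ENNReal) * ENNReal.ofReal a := fun a => by
      rw [ENNReal.ofReal_mul (by positivity)]
      congr 1
      rw [← ENNReal.ofReal_coe_nnreal]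
      simp
    rw [hIs, hMs, ← ENNReal.tsum_mul_left, ← ENNReal.tsum_mul_left]
    constructor
    · refine ENNReal.tsum_le_tsum fun n => ?_
      refine (graph_area_bounds hν hk hc1 (happ n)).1.trans ?_
      rw [pow_succ, mul_assoc]
      refine mul_le_mul_right ?_ _
      rw [← setLIntegral_const, ← lintegral_const_mul' _ _ ENNReal.coe_ne_top]
      refine lintegral_mono_ae ?_
      filter_upwards [hae n] with x hx
      rw [← hof]
      exact ENNReal.ofReal_le_ofReal (areaDensity_le (by rwa [norm_sub_rev]))
    · refine ENNReal.tsum_le_tsum fun n => ?_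
      rw [mul_assoc]
      refine le_trans ?_ (mul_le_mul_right (graph_area_bounds hν hk hc1 (happ n)).2 _)
      rw [← setLIntegral_const, ← lintegral_const_mul' _ _ ENNReal.coe_ne_top]
      refine lintegral_mono_ae ?_
      filter_upwards [hae n] with x hx
      rw [← hof]
      exact ENNReal.ofReal_le_ofReal (areaDensity_le hx)
  have hev : ∀ᶠ c : NNReal in 𝓝[>] 0, 0 < c ∧ c < 1 := by
    filter_upwards [Ioo_mem_nhdsGT (zero_lt_one (α := NNReal))] with c hc using hc
  refine le_antisymm ?_ ?_
  · have hlim : Filter.Tendsto (fun c : NNReal => ((1 + c : NNReal) : ENNReal) ^ (k + 1) * I)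
        (𝓝[>] 0) (𝓝 (1 * I)) := by
      refine ENNReal.Tendsto.mul_const ?_ (Or.inl one_ne_zero)
      have : Continuous fun c : NNReal => ((1 + c : NNReal) : ENNReal) ^ (k + 1) := by fun_prop
      simpa using (this.tendsto 0).mono_left nhdsWithin_le_nhds
    rw [one_mul] at hlim
    exact ge_of_tendsto hlim (hev.mono fun c hc => (key c hc.1 hc.2).1)
  · have hlim : Filter.Tendsto (fun c : NNReal =>
        ((1 + c : NNReal) : ENNReal) * (((1 - c)⁻¹ : NNReal) : ENNReal) ^ k * M)
        (𝓝[>] 0) (𝓝 (1 * M)) := by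
      refine ENNReal.Tendsto.mul_const ?_ (Or.inl one_ne_zero)
      have : ContinuousAt (fun c : NNReal => (((1 + c) * ((1 - c)⁻¹) ^ k : NNReal) : ENNReal)) 0 := by
        refine ENNReal.continuous_coe.continuousAt.comp ?_
        refine ContinuousAt.mul (by fun_prop) (ContinuousAt.pow (ContinuousAt.inv₀ ?_ (by simp)) k)
        exact (continuous_const.sub continuous_id).continuousAt
      simpa [-inv_pow] using this.tendsto.mono_left nhdsWithin_le_nhds
    rw [one_mul] at hlim
    exact ge_of_tendsto hlim (hev.mono fun c hc => (key c hc.1 hc.2).2)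

theorem measurableEmbedding_graphMap {ν : H} (hν : ‖ν‖ = 1) {φ : hyper ν → ℝ} {C : NNReal}
    (hφ : LipschitzWith C φ) : MeasurableEmbedding (graphMap ν φ) :=
  (lipschitzWith_graphMap hν hφ).continuous.measurableEmbedding
    (Function.LeftInverse.injective (g := fun z => hproj ν z) (hproj_graphMap ν φ))

theorem measurable_areaDensity {V : Type*} [NormedAddCommGroup V] [NormedSpace ℝ V]
    [FiniteDimensional ℝ V] [MeasurableSpace V] [BorelSpace V] (φ : V → ℝ) :
    Measurable fun x => areaDensity (fderiv ℝ φ x) :=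
  (measurable_const.add ((measurable_fderiv ℝ φ).norm.pow_const 2)).sqrt

theorem map_graphMap {ν : H} (hν : ‖ν‖ = 1) {k : ℕ} (hk : Module.finrank ℝ (hyper ν) = k)
    [Nontrivial (hyper ν)] {φ : hyper ν → ℝ} {C : NNReal} (hφ : LipschitzWith C φ) :
    (volume.withDensity fun x => ENNReal.ofReal (areaDensity (fderiv ℝ φ x))).map (graphMap ν φ) =
      (Measure.euclideanHausdorffMeasure k).restrict (Set.range (graphMap ν φ)) := by
  ext s hs
  have hg := measurableEmbedding_graphMap hν hφ
  rw [hg.map_apply, withDensity_apply _ (hg.measurable hs), ← graph_area hν hk hφ (hg.measurable hs),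
    Set.image_preimage_eq_inter_range, Measure.restrict_apply hs]

end Graph

/-! ### The divergence theorem for the part of space above a Lipschitz graph -/

section Graph

variable {H : Type*} [NormedAddCommGroup H] [InnerProductSpace ℝ H]

/-- The orthogonal decomposition of a space by a unit vector. -/
def hyperProdEquiv {ν : H} (hν : ‖ν‖ = 1) : WithLp 2 (hyper ν × ℝ) ≃ₗᵢ[ℝ] H where
  toFun q := (q.fst : H) + q.snd • ν
  invFun z := WithLp.toLp 2 (hproj ν z, ⟪ν, z⟫)
  map_add' a b := by simp [add_smul]; abel
  map_smul' c a := by simp [smul_smul]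
  left_inv q := by
    refine congrArg (WithLp.toLp 2) (Prod.ext ?_ ?_)
    · exact hproj_add_smul ν q.fst q.snd
    · exact inner_add_smul hν q.fst q.snd
  right_inv z := hproj_add_inner hν z
  norm_map' q := by
    refine (pow_left_inj₀ (norm_nonneg _) (norm_nonneg _) two_ne_zero).1 ?_
    rw [WithLp.prod_norm_sq_eq_of_L2]
    refine (norm_add_smul_sq hν q.fst q.snd).trans ?_
    rw [Real.norm_eq_abs, sq_abs]

/-- Coordinates in which the graph of `φ` is flat. -/
def graphCoord (ν : H) (φ : hyper ν → ℝ) (q : hyper ν × ℝ) : H := (q.1 : H) + (φ q.1 + q.2) • ν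

theorem graphCoord_eq (ν : H) (φ : hyper ν → ℝ) (x : hyper ν) (t : ℝ) :
    graphCoord ν φ (x, t) = graphMap ν φ x + t • ν := by
  simp only [graphCoord, graphMap]
  module

theorem continuous_graphCoord {ν : H} {φ : hyper ν → ℝ} (hφ : Continuous φ) :
    Continuous (graphCoord ν φ) := by
  unfold graphCoord
  fun_prop

/-- `L x w = ⟪ν, w⟫ - φ'(x) (Pw)`, a multiple of the inner product with the inner normal of the
graph. -/
def graphConormal (ν : H) (φ : hyper ν → ℝ) (x : hyper ν) (w : H) : ℝ :=
  ⟪ν, w⟫ - fderiv ℝ φ x (hproj ν w)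

theorem abs_graphConormal_le {ν : H} (hν : ‖ν‖ = 1) {φ : hyper ν → ℝ} {C : NNReal}
    (hφ : LipschitzWith C φ) (x : hyper ν) (w : H) :
    |graphConormal ν φ x w| ≤ (1 + C) * ‖w‖ := by
  have h1 : |⟪ν, w⟫| ≤ ‖w‖ := by simpa [hν] using abs_real_inner_le_norm ν w
  have h2 : ‖fderiv ℝ φ x (hproj ν w)‖ ≤ C * ‖w‖ := by
    refine (ContinuousLinearMap.le_opNorm _ _).trans ?_
    gcongr
    · exact norm_fderiv_le_of_lipschitz ℝ hφ
    · exact Submodule.norm_orthogonalProjectionOnto_apply_le _ _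
  rw [Real.norm_eq_abs] at h2
  have h3 := abs_sub ⟪ν, w⟫ (fderiv ℝ φ x (hproj ν w))
  unfold graphConormal
  linarith

variable [FiniteDimensional ℝ H] [MeasurableSpace H] [BorelSpace H]

theorem measurePreserving_add_smul {ν : H} (hν : ‖ν‖ = 1) :
    MeasurePreserving (fun q : hyper ν × ℝ => (q.1 : H) + q.2 • ν) := by
  have h1 := (hyperProdEquiv hν).measurePreserving
  have h2 : MeasurePreserving (@WithLp.toLp 2 (hyper ν × ℝ)) :=
    MeasurePreserving.symm (MeasurableEquiv.toLp 2 (hyper ν × ℝ)).symm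
      (WithLp.volume_preserving_ofLp (hyper ν) ℝ)
  exact h1.comp h2

/-- On each line parallel to `ν` the shear is a translation, so no differentiability of `φ` is
involved. -/
theorem measurePreserving_graphCoord {ν : H} (hν : ‖ν‖ = 1) {φ : hyper ν → ℝ}
    (hφ : Continuous φ) : MeasurePreserving (graphCoord ν φ) := by
  have h1 : MeasurePreserving (fun q : hyper ν × ℝ => (q.1, φ q.1 + q.2)) :=
    (MeasurePreserving.id volume).skew_product (g := fun x t => φ x + t)
      (by fun_prop) (Filter.Eventually.of_forall fun x => (measurePreserving_add_left volume (φ x)).map_eq)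
  exact (measurePreserving_add_smul hν).comp h1

theorem measurableEmbedding_graphCoord {ν : H} (hν : ‖ν‖ = 1) {φ : hyper ν → ℝ}
    (hφ : Continuous φ) : MeasurableEmbedding (graphCoord ν φ) := by
  refine (continuous_graphCoord hφ).measurableEmbedding ?_
  refine Function.LeftInverse.injective
    (g := fun z => (hproj ν z, ⟪ν, z⟫ - φ (hproj ν z))) fun q => ?_
  simp only [graphCoord, hproj_add_smul, inner_add_smul hν]
  simp

theorem aestronglyMeasurable_graphConormal (ν : H) (φ : hyper ν → ℝ) {α : Type*}
    [MeasurableSpace α] {μ : Measure α} {p : α → hyper ν} (hp : Measurable p) {w : α → H}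
    (hw : AEStronglyMeasurable w μ) :
    AEStronglyMeasurable (fun a => graphConormal ν φ (p a) (w a)) μ := by
  have h1 : AEStronglyMeasurable (fun a => ⟪ν, w a⟫) μ := aestronglyMeasurable_const.inner hw
  have h2 : AEStronglyMeasurable (fun a => fderiv ℝ φ (p a)) μ :=
    ((measurable_fderiv ℝ φ).comp hp).aestronglyMeasurable
  have h3 : AEStronglyMeasurable (fun a => hproj ν (w a)) μ :=
    (hproj ν).continuous.comp_aestronglyMeasurable hw
  have hcont : Continuous fun q : (hyper ν →L[ℝ] ℝ) × hyper ν => q.1 q.2 :=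
    isBoundedBilinearMap_apply.continuous
  exact h1.sub (hcont.comp_aestronglyMeasurable (h2.prodMk h3))

end Graph

/-! ### The smooth step function and its derivative, a bump of integral one -/

theorem smoothTransition_contDiff : ContDiff ℝ 1 Real.smoothTransition :=
  Real.smoothTransition.contDiff

theorem deriv_smoothTransition_eq_zero {t : ℝ} (ht : t ∉ Set.Icc (0 : ℝ) 1) :
    deriv Real.smoothTransition t = 0 := by
  rw [Set.mem_Icc, not_and_or, not_le, not_le] at ht
  rcases ht with h | h
  · have : Real.smoothTransition =ᶠ[𝓝 t] fun _ => 0 := by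
      filter_upwards [Iio_mem_nhds h] with s hs
      exact Real.smoothTransition.zero_of_nonpos (le_of_lt hs)
    rw [this.deriv_eq, deriv_const]
  · have : Real.smoothTransition =ᶠ[𝓝 t] fun _ => 1 := by
      filter_upwards [Ioi_mem_nhds h] with s hs
      exact Real.smoothTransition.one_of_one_le (le_of_lt hs)
    rw [this.deriv_eq, deriv_const]

theorem continuous_deriv_smoothTransition : Continuous (deriv Real.smoothTransition) :=
  smoothTransition_contDiff.continuous_deriv le_rfl

theorem hasCompactSupport_deriv_smoothTransition :
    HasCompactSupport (deriv Real.smoothTransition) :=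
  HasCompactSupport.intro isCompact_Icc fun _ ht => deriv_smoothTransition_eq_zero ht

theorem integral_deriv_smoothTransition : ∫ t, deriv Real.smoothTransition t = 1 := by
  have h1 : ∫ t in Set.Icc (0 : ℝ) 1, deriv Real.smoothTransition t =
      ∫ t, deriv Real.smoothTransition t :=
    setIntegral_eq_integral_of_forall_compl_eq_zero fun t ht => deriv_smoothTransition_eq_zero ht
  rw [← h1, integral_Icc_eq_integral_Ioc, ← intervalIntegral.integral_of_le zero_le_one,
    intervalIntegral.integral_deriv_eq_sub]
  · simp
  · intro x _
    exact smoothTransition_contDiff.differentiable one_ne_zero x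
  · exact continuous_deriv_smoothTransition.intervalIntegrable _ _

theorem lipschitz_smoothTransition : ∃ C : NNReal, LipschitzWith C Real.smoothTransition := by
  obtain ⟨C, hC⟩ := hasCompactSupport_deriv_smoothTransition.exists_bound_of_continuous
    continuous_deriv_smoothTransition
  exact ⟨C.toNNReal, lipschitzWith_of_nnnorm_deriv_le
    (smoothTransition_contDiff.differentiable one_ne_zero) fun x => by
      rw [← NNReal.coe_le_coe, coe_nnnorm]
      exact (hC x).trans (Real.le_coe_toNNReal C)⟩

/-- The divergence theorem above a Lipschitz graph, in graph coordinates. -/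
theorem integral_divergence_epigraph {d : ℕ} {ν : E d} (hν : ‖ν‖ = 1) {φ : hyper ν → ℝ}
    {C : NNReal} (hφ : LipschitzWith C φ) {v : E d → E d} (hv : Differentiable ℝ v)
    (hc : HasCompactSupport v) (hd : Continuous (divergence v)) :
    ∫ z in {z | φ (hproj ν z) < ⟪ν, z⟫}, divergence v z =
      - ∫ x, graphConormal ν φ x (v (graphMap ν φ x)) := by
  have hΨ := measurePreserving_graphCoord hν hφ.continuous
  have hΨe := measurableEmbedding_graphCoord hν hφ.continuous
  have hΨc := continuous_graphCoord (ν := ν) hφ.continuous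
  set Ψ := graphCoord ν φ with hΨdef
  set st := Real.smoothTransition with hst
  set G := divergence v with hG
  have hpΨ : ∀ q, hproj ν (Ψ q) = q.1 := fun q => hproj_add_smul ν _ _
  have hiΨ : ∀ q, ⟪ν, Ψ q⟫ = φ q.1 + q.2 := fun q => inner_add_smul hν _ _
  have hvc : Continuous v := hv.continuous
  obtain ⟨M, hM⟩ := hc.exists_bound_of_continuous hvc
  have hM0 : 0 ≤ M := (norm_nonneg _).trans (hM 0)
  let Q : Set (hyper ν) := hproj ν '' tsupport v
  have hQ : IsCompact Q := hc.isCompact.image (hproj ν).continuous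
  have hvQ : ∀ q : hyper ν × ℝ, q.1 ∉ Q → v (Ψ q) = 0 := fun q hq => by
    by_contra h
    exact hq ⟨Ψ q, subset_tsupport v h, hpΨ q⟩
  obtain ⟨N, hN⟩ := hasCompactSupport_deriv_smoothTransition.exists_bound_of_continuous
    continuous_deriv_smoothTransition
  have hN0 : 0 ≤ N := (norm_nonneg _).trans (hN 0)
  -- a common dominating function
  let S : Set (hyper ν × ℝ) := Q ×ˢ Set.Icc (0 : ℝ) 1
  have hS : IsCompact S := hQ.prod isCompact_Icc
  let bd : hyper ν × ℝ → ℝ := S.indicator fun _ => N * ((1 + C) * M)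
  have hbd : Integrable bd :=
    IntegrableOn.integrable_indicator (integrableOn_const hS.measure_lt_top.ne) hS.measurableSet
  -- The boundary layer of thickness `a`, stretched to unit thickness. At `a = 0` it collapses onto
  -- the graph, and the integral over `q.2` only sees the total mass one of `deriv st`.
  let J : ℝ → hyper ν × ℝ → ℝ := fun a q =>
    deriv st q.2 * graphConormal ν φ q.1 (v (Ψ (q.1, a * q.2)))
  have hJm : ∀ a, AEStronglyMeasurable (J a) volume := fun a => by
    refine (continuous_deriv_smoothTransition.comp continuous_snd).aestronglyMeasurable.mul ?_
    refine aestronglyMeasurable_graphConormal ν φ measurable_fst ?_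
    exact (hvc.comp (hΨc.comp (by fun_prop))).aestronglyMeasurable
  have hJb : ∀ a q, ‖J a q‖ ≤ bd q := fun a q => by
    by_cases hq : q ∈ S
    · rw [show bd q = N * ((1 + C) * M) from Set.indicator_of_mem hq _, norm_mul]
      refine mul_le_mul (hN _) ?_ (norm_nonneg _) hN0
      refine (abs_graphConormal_le hν hφ _ _).trans ?_
      gcongr
      exact hM _
    · rw [show bd q = 0 from Set.indicator_of_notMem hq _]
      have : q.1 ∉ Q ∨ q.2 ∉ Set.Icc (0 : ℝ) 1 := by
        by_contra! h
        exact hq ⟨h.1, h.2⟩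
      rcases this with h | h
      · simp [J, hvQ (q.1, a * q.2) h, graphConormal]
      · simp [J, hst, deriv_smoothTransition_eq_zero h]
  have hJi : ∀ a, Integrable (J a) := fun a =>
    hbd.mono' (hJm a) (Filter.Eventually.of_forall (hJb a))
  -- the test functions
  have main : ∀ n : ℕ, ∫ q, J (1 / ((n : ℝ) + 1)) q =
      - ∫ q : hyper ν × ℝ, st (((n : ℝ) + 1) * q.2) * G (Ψ q) := by
    intro n
    have hn : (0 : ℝ) < (n : ℝ) + 1 := by positivity
    -- A Lipschitz function of the height above the graph that tends to the indicator of the open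
    -- epigraph; its gradient lives at heights between `0` and `1 / (n + 1)`.
    let χ : E d → ℝ := fun z => st (((n : ℝ) + 1) * (⟪ν, z⟫ - φ (hproj ν z)))
    obtain ⟨C', hC'⟩ := lipschitz_smoothTransition
    have h1 : LipschitzWith 1 (fun z : E d => hproj ν z) :=
      LipschitzWith.of_dist_le_mul fun z w => by
        rw [dist_eq_norm, dist_eq_norm, ← map_sub, NNReal.coe_one, one_mul]
        exact Submodule.norm_orthogonalProjectionOnto_apply_le _ _
    have hχ : LipschitzWith (C' * (‖(n : ℝ) + 1‖₊ * (‖innerSL ℝ ν‖₊ + C * 1))) χ :=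
      hC'.comp ((lipschitzWith_smul ((n : ℝ) + 1)).comp
        ((innerSL ℝ ν).lipschitz.sub (hφ.comp h1)))
    have h2 := integral_fderiv_lipschitz_eq hv hc hd hχ
    rw [← hΨ.integral_comp hΨe, ← hΨ.integral_comp hΨe] at h2
    have h3 : ∀ q, χ (Ψ q) * divergence v (Ψ q) = st (((n : ℝ) + 1) * q.2) * G (Ψ q) := by
      intro q
      simp only [χ, hpΨ, hiΨ, add_sub_cancel_left, hG]
    simp_rw [h3] at h2
    rw [← h2]
    have h4 : ∀ᵐ q : hyper ν × ℝ, fderiv ℝ χ (Ψ q) (v (Ψ q)) =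
        ((n : ℝ) + 1) * deriv st (((n : ℝ) + 1) * q.2) * graphConormal ν φ q.1 (v (Ψ q)) := by
      have hae : ∀ᵐ q : hyper ν × ℝ, DifferentiableAt ℝ φ q.1 :=
        Measure.quasiMeasurePreserving_fst.ae hφ.ae_differentiableAt
      filter_upwards [hae] with q hq
      have hd1 : HasFDerivAt (fun z : E d => ((n : ℝ) + 1) * (⟪ν, z⟫ - φ (hproj ν z)))
          (((n : ℝ) + 1) • (innerSL ℝ ν - (fderiv ℝ φ q.1).comp (hproj ν))) (Ψ q) := by
        refine HasFDerivAt.const_mul (HasFDerivAt.sub (innerSL ℝ ν).hasFDerivAt ?_) _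
        have hq' : HasFDerivAt φ (fderiv ℝ φ q.1) (hproj ν (Ψ q)) := by
          rw [hpΨ]; exact hq.hasFDerivAt
        exact hq'.comp (Ψ q) (hproj ν).hasFDerivAt
      have hd2 : HasDerivAt st (deriv st (((n : ℝ) + 1) * (⟪ν, Ψ q⟫ - φ (hproj ν (Ψ q)))))
          (((n : ℝ) + 1) * (⟪ν, Ψ q⟫ - φ (hproj ν (Ψ q)))) :=
        (smoothTransition_contDiff.differentiable one_ne_zero _).hasDerivAt
      have hd3 := (hd2.comp_hasFDerivAt (Ψ q) hd1).fderiv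
      have hd3' : fderiv ℝ χ (Ψ q) = _ := hd3
      rw [hd3', hiΨ, hpΨ, add_sub_cancel_left]
      simp [graphConormal]
      ring
    rw [integral_congr_ae h4]
    have hfi : Integrable (fun q : hyper ν × ℝ => ((n : ℝ) + 1) * deriv st (((n : ℝ) + 1) * q.2) *
        graphConormal ν φ q.1 (v (Ψ q))) := by
      have hS' : IsCompact (Q ×ˢ Set.Icc (0 : ℝ) 1) := hS
      have hbd' : Integrable ((Q ×ˢ Set.Icc (0 : ℝ) 1).indicator
          fun _ => ((n : ℝ) + 1) * N * ((1 + C) * M)) (volume : Measure (hyper ν × ℝ)) :=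
        IntegrableOn.integrable_indicator (integrableOn_const hS'.measure_lt_top.ne)
          hS'.measurableSet
      refine hbd'.mono' ?_ (Filter.Eventually.of_forall fun q => ?_)
      · refine AEStronglyMeasurable.mul ?_ ?_
        · exact (continuous_const.mul (continuous_deriv_smoothTransition.comp
            (by fun_prop))).aestronglyMeasurable
        · exact aestronglyMeasurable_graphConormal ν φ measurable_fst
            (hvc.comp hΨc).aestronglyMeasurable
      · by_cases hq : q ∈ Q ×ˢ Set.Icc (0 : ℝ) 1
        · rw [Set.indicator_of_mem hq, norm_mul, norm_mul, Real.norm_of_nonneg hn.le]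
          refine mul_le_mul (mul_le_mul_of_nonneg_left (hN _) hn.le) ?_ (norm_nonneg _)
            (by positivity)
          refine (abs_graphConormal_le hν hφ _ _).trans ?_
          gcongr
          exact hM _
        · rw [Set.indicator_of_notMem hq]
          have : q.1 ∉ Q ∨ q.2 ∉ Set.Icc (0 : ℝ) 1 := by
            by_contra! h
            exact hq ⟨h.1, h.2⟩
          rcases this with h | h
          · simp [hvQ q h, graphConormal]
          · rw [hst, deriv_smoothTransition_eq_zero (t := ((n : ℝ) + 1) * q.2)]
            · simp
            · contrapose! h
              rcases h with ⟨ha, hb⟩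
              have hn1 : (1 : ℝ) ≤ (n : ℝ) + 1 := by linarith [(n.cast_nonneg : (0 : ℝ) ≤ n)]
              have h0 : 0 ≤ q.2 := nonneg_of_mul_nonneg_right ha hn
              exact ⟨h0, by nlinarith⟩
    rw [Measure.volume_eq_prod, integral_prod _ (hJi _), integral_prod _ hfi]
    refine integral_congr_ae (Filter.Eventually.of_forall fun x => ?_)
    -- The substitution `t ↦ (n + 1) t` absorbs the factor `n + 1` from the steepness of `χ`.
    have h5 := Measure.integral_comp_mul_left
      (fun t => deriv st t * graphConormal ν φ x (v (Ψ (x, 1 / ((n : ℝ) + 1) * t)))) ((n : ℝ) + 1)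
    simp only [J]
    rw [abs_of_pos (inv_pos.2 hn), smul_eq_mul, eq_comm, inv_mul_eq_iff_eq_mul₀ hn.ne'] at h5
    rw [h5, ← integral_const_mul]
    refine integral_congr_ae (Filter.Eventually.of_forall fun t => ?_)
    simp only
    rw [← mul_assoc (1 / ((n : ℝ) + 1)), one_div_mul_cancel hn.ne', one_mul, mul_assoc]
  -- the limits
  have lim1 : Filter.Tendsto (fun n : ℕ => ∫ q, J (1 / ((n : ℝ) + 1)) q) Filter.atTop
      (𝓝 (∫ q, J 0 q)) := by
    refine tendsto_integral_of_dominated_convergence bd (fun n => hJm _) hbd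
      (fun n => Filter.Eventually.of_forall (hJb _)) (Filter.Eventually.of_forall fun q => ?_)
    have hcont : Continuous fun a : ℝ => J a q := by
      have : Continuous fun w => graphConormal ν φ q.1 w := by unfold graphConormal; fun_prop
      exact continuous_const.mul (this.comp (hvc.comp (hΨc.comp (by fun_prop))))
    exact (hcont.tendsto 0).comp tendsto_one_div_add_atTop_nhds_zero_nat
  have hGi : Integrable (fun q => G (Ψ q)) :=
    (hΨ.integrable_comp_emb hΨe).2
      (hd.integrable_of_hasCompactSupport (hasCompactSupport_divergence hc))
  have lim2 : Filter.Tendsto (fun n : ℕ => ∫ q : hyper ν × ℝ, st (((n : ℝ) + 1) * q.2) * G (Ψ q))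
      Filter.atTop (𝓝 (∫ q : hyper ν × ℝ, {q : hyper ν × ℝ | 0 < q.2}.indicator
        (fun q => G (Ψ q)) q)) := by
    refine tendsto_integral_of_dominated_convergence (fun q => ‖G (Ψ q)‖) (fun n => ?_) hGi.norm
      (fun n => Filter.Eventually.of_forall fun q => ?_) (Filter.Eventually.of_forall fun q => ?_)
    · exact ((Real.smoothTransition.continuous).comp (by fun_prop)).aestronglyMeasurable.mul
        hGi.aestronglyMeasurable
    · rw [norm_mul]
      refine mul_le_of_le_one_left (norm_nonneg _) ?_
      rw [Real.norm_of_nonneg (Real.smoothTransition.nonneg _)]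
      exact Real.smoothTransition.le_one _
    · by_cases hq : 0 < q.2
      · rw [Set.indicator_of_mem (show q ∈ {q : hyper ν × ℝ | 0 < q.2} from hq)]
        have ht : Filter.Tendsto (fun n : ℕ => ((n : ℝ) + 1) * q.2) Filter.atTop Filter.atTop :=
          (Filter.tendsto_atTop_add_const_right _ _ tendsto_natCast_atTop_atTop).atTop_mul_const hq
        refine tendsto_const_nhds.congr' ?_
        filter_upwards [ht.eventually_ge_atTop 1] with n hn
        rw [hst, Real.smoothTransition.one_of_one_le hn, one_mul]
      · rw [Set.indicator_of_notMem (show q ∉ {q : hyper ν × ℝ | 0 < q.2} from hq)]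
        refine tendsto_const_nhds.congr fun n => ?_
        rw [hst, Real.smoothTransition.zero_of_nonpos, zero_mul]
        exact mul_nonpos_of_nonneg_of_nonpos (by positivity) (not_lt.1 hq)
  have lim := tendsto_nhds_unique (lim1.congr main) lim2.neg
  have e1 : ∫ q, J 0 q = ∫ x, graphConormal ν φ x (v (graphMap ν φ x)) := by
    have h0 : ∀ x, Ψ (x, 0) = graphMap ν φ x := fun x => by
      rw [hΨdef, graphCoord_eq, zero_smul, add_zero]
    have : ∀ q, J 0 q = graphConormal ν φ q.1 (v (graphMap ν φ q.1)) * deriv st q.2 := fun q => by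
      simp only [J, zero_mul, h0]
      rw [mul_comm]
    simp_rw [this]
    rw [Measure.volume_eq_prod,
      integral_prod_mul (fun x => graphConormal ν φ x (v (graphMap ν φ x))) (deriv st),
      integral_deriv_smoothTransition, mul_one]
  have e2 : ∫ z in {z | φ (hproj ν z) < ⟪ν, z⟫}, G z =
      ∫ q : hyper ν × ℝ, {q : hyper ν × ℝ | 0 < q.2}.indicator (fun q => G (Ψ q)) q := by
    rw [← hΨ.setIntegral_preimage_emb hΨe, integral_indicator (measurableSet_lt measurable_const
      measurable_snd)]
    congr 2
    ext q
    simp [hpΨ, hiΨ]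
  rw [e2, ← e1, lim, neg_neg]

/-! ### Outer normals -/

/-- Along `u = ν' - ν` the two unit vectors disagree: `⟪ν, u⟫ = -‖u‖² / 2` and `⟪ν', u⟫ = ‖u‖² / 2`.
For small `t > 0` the point `x + t • u` would have to be in `A` because of `ν` and outside because
of `ν'`; `ε = ‖u‖ / 4` is small enough for both. -/
theorem IsOuterNormal.unique {d : ℕ} {A : Set (E d)} {x ν ν' : E d} (h : IsOuterNormal A x ν)
    (h' : IsOuterNormal A x ν') : ν = ν' := by
  by_contra hne
  set u := ν' - ν with hu
  have hu0 : 0 < ‖u‖ := norm_pos_iff.2 (sub_ne_zero.2 (Ne.symm hne))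
  have e1 : ⟪ν, u⟫ = -(‖u‖ ^ 2 / 2) := by
    have := norm_sub_sq_real ν' ν
    rw [h.1, h'.1, ← hu, real_inner_comm] at this
    rw [hu, inner_sub_right, real_inner_self_eq_norm_sq, h.1, ← hu]
    linarith
  have e2 : ⟪ν', u⟫ = ‖u‖ ^ 2 / 2 := by
    have := norm_sub_sq_real ν' ν
    rw [h.1, h'.1, ← hu] at this
    rw [hu, inner_sub_right, real_inner_self_eq_norm_sq, h'.1, ← hu]
    linarith
  set ε := ‖u‖ / 4
  have hε : 0 < ε := by positivity
  have hev : ∀ᶠ t : ℝ in 𝓝[>] 0,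
      (x + t • u ∈ A → ⟪ν', (x + t • u) - x⟫ ≤ ε * ‖(x + t • u) - x‖) ∧
      (x + t • u ∉ A → -(ε * ‖(x + t • u) - x‖) ≤ ⟪ν, (x + t • u) - x⟫) := by
    have hc : Filter.Tendsto (fun t : ℝ => x + t • u) (𝓝[>] 0) (𝓝 x) := by
      have : Continuous fun t : ℝ => x + t • u := by fun_prop
      simpa using (this.tendsto 0).mono_left nhdsWithin_le_nhds
    filter_upwards [hc.eventually (h.2 ε hε), hc.eventually (h'.2 ε hε)] with t h1 h2
    exact ⟨h2.1, h1.2⟩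
  obtain ⟨t, ⟨ha, hb⟩, ht⟩ := (hev.and self_mem_nhdsWithin).exists
  have ht0 : (0 : ℝ) < t := ht
  simp only [add_sub_cancel_left, inner_smul_right, norm_smul, Real.norm_of_nonneg ht0.le, e1,
    e2] at ha hb
  have hpos : 0 < t * ‖u‖ ^ 2 := by positivity
  by_cases hA : x + t • u ∈ A
  · have := ha hA
    simp only [ε] at this
    nlinarith
  · have := hb hA
    simp only [ε] at this
    nlinarith

theorem IsOuterNormal.outerNormal_eq {d : ℕ} {A : Set (E d)} {x ν : E d}
    (h : IsOuterNormal A x ν) : outerNormal A x = ν := by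
  have hex : ∃ ν, IsOuterNormal A x ν := ⟨ν, h⟩
  rw [outerNormal, dif_pos hex]
  exact hex.choose_spec.unique h

theorem norm_outerNormal_le {d : ℕ} (A : Set (E d)) (x : E d) : ‖outerNormal A x‖ ≤ 1 := by
  by_cases h : ∃ ν, IsOuterNormal A x ν
  · rw [outerNormal, dif_pos h]
    exact h.choose_spec.1.le
  · rw [outerNormal, dif_neg h, norm_zero]
    exact zero_le_one

/-- The downward unit normal of the graph of `φ`. -/
def graphNormal {d : ℕ} (ν : E d) (φ : hyper ν → ℝ) (x : hyper ν) : E d :=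
  (areaDensity (fderiv ℝ φ x))⁻¹ •
    (((InnerProductSpace.toDual ℝ (hyper ν)).symm (fderiv ℝ φ x) : E d) - ν)

theorem inner_graphNormal {d : ℕ} (ν : E d) (φ : hyper ν → ℝ) (x : hyper ν) (w : E d) :
    ⟪graphNormal ν φ x, w⟫ = -((areaDensity (fderiv ℝ φ x))⁻¹ * graphConormal ν φ x w) := by
  have h1 : ⟪((InnerProductSpace.toDual ℝ (hyper ν)).symm (fderiv ℝ φ x) : E d), w⟫ =
      fderiv ℝ φ x (hproj ν w) := by
    rw [← InnerProductSpace.toDual_symm_apply (𝕜 := ℝ) (E := hyper ν), Submodule.coe_inner,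
      ← Submodule.inner_orthogonalProjectionOnto_eq_of_mem_left]
    rfl
  rw [graphNormal, real_inner_smul_left, inner_sub_left, h1, graphConormal]
  ring

theorem norm_graphNormal {d : ℕ} {ν : E d} (hν : ‖ν‖ = 1) (φ : hyper ν → ℝ) (x : hyper ν) :
    ‖graphNormal ν φ x‖ = 1 := by
  have hpos : 0 < areaDensity (fderiv ℝ φ x) := zero_lt_one.trans_le (one_le_areaDensity _)
  have h1 := norm_add_smul_sq hν ((InnerProductSpace.toDual ℝ (hyper ν)).symm (fderiv ℝ φ x)) (-1)
  rw [neg_one_smul, ← sub_eq_add_neg, LinearIsometryEquiv.norm_map] at h1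
  have h2 : areaDensity (fderiv ℝ φ x) ^ 2 = 1 + ‖fderiv ℝ φ x‖ ^ 2 :=
    Real.sq_sqrt (by positivity)
  rw [graphNormal, norm_smul, norm_inv, Real.norm_of_nonneg hpos.le, inv_mul_eq_one₀ hpos.ne']
  refine (pow_left_inj₀ hpos.le (norm_nonneg _) two_ne_zero).1 ?_
  rw [h1, h2]
  ring

theorem measurable_graphNormal {d : ℕ} (ν : E d) (φ : hyper ν → ℝ) :
    Measurable (graphNormal ν φ) := by
  refine (measurable_areaDensity φ).inv.smul ((Measurable.sub ?_ measurable_const))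
  refine measurable_subtype_coe.comp ?_
  exact (InnerProductSpace.toDual ℝ (hyper ν)).symm.continuous.measurable.comp
    (measurable_fderiv ℝ φ)

/-- In the open set `N`, the set `A` is the part of space above the graph of `φ` and `S` is the
graph. -/
structure IsGraphPatch {d : ℕ} (A S N : Set (E d)) (ν : E d) (φ : hyper ν → ℝ) (C : NNReal) :
    Prop where
  isOpen : IsOpen N
  norm_eq : ‖ν‖ = 1
  lipschitz : LipschitzWith C φ
  mem_iff : ∀ z ∈ N, z ∈ A ↔ φ (hproj ν z) < ⟪ν, z⟫
  mem_bdry_iff : ∀ z ∈ N, z ∈ S ↔ φ (hproj ν z) = ⟪ν, z⟫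

namespace IsGraphPatch

variable {d : ℕ} {A S N : Set (E d)} {ν : E d} {φ : hyper ν → ℝ} {C : NNReal}

/-- Near the point, `A` is where `⟪ν, z⟫ - φ (hproj ν z)` is positive, and `graphConormal` is the
derivative of this function. Normalizing divides by a density at least `1`, so the `o(‖z - x‖)`
error does not grow. -/
theorem isOuterNormal (h : IsGraphPatch A S N ν φ C) {x : hyper ν} (hx : graphMap ν φ x ∈ N)
    (hd : DifferentiableAt ℝ φ x) :
    IsOuterNormal A (graphMap ν φ x) (graphNormal ν φ x) := by
  refine ⟨norm_graphNormal h.norm_eq φ x, fun ε hε => ?_⟩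
  have h1 : ∀ᶠ p in 𝓝 x, ‖φ p - φ x - fderiv ℝ φ x (p - x)‖ ≤ ε * ‖p - x‖ :=
    (hasFDerivAt_iff_isLittleO.1 hd.hasFDerivAt).def hε
  have h2 : Filter.Tendsto (fun z => hproj ν z) (𝓝 (graphMap ν φ x)) (𝓝 x) := by
    have := (hproj ν).continuous.tendsto (graphMap ν φ x)
    rwa [hproj_graphMap] at this
  filter_upwards [h2.eventually h1, h.isOpen.mem_nhds hx] with z hz hzN
  have hpos := one_le_areaDensity (fderiv ℝ φ x)
  have hinner : ⟪ν, z - graphMap ν φ x⟫ = ⟪ν, z⟫ - φ x := by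
    rw [inner_sub_right, graphMap, inner_add_smul h.norm_eq]
  have hproj' : hproj ν (z - graphMap ν φ x) = hproj ν z - x := by
    rw [map_sub, hproj_graphMap]
  have hle : ‖hproj ν z - x‖ ≤ ‖z - graphMap ν φ x‖ := by
    rw [← hproj']
    exact Submodule.norm_orthogonalProjectionOnto_apply_le _ _
  have hz' := abs_le.1 (hz.trans (mul_le_mul_of_nonneg_left hle hε.le))
  have hinv : (areaDensity (fderiv ℝ φ x))⁻¹ ≤ 1 := inv_le_one_of_one_le₀ hpos
  have hinv0 : 0 < (areaDensity (fderiv ℝ φ x))⁻¹ := inv_pos.2 (zero_lt_one.trans_le hpos)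
  have hB : 0 ≤ ε * ‖z - graphMap ν φ x‖ := by positivity
  rw [inner_graphNormal, graphConormal, hinner, hproj']
  constructor
  · intro hA
    have := (h.mem_iff z hzN).1 hA
    have h3 : -(ε * ‖z - graphMap ν φ x‖) ≤
        ⟪ν, z⟫ - φ x - fderiv ℝ φ x (hproj ν z - x) := by linarith [hz'.1]
    nlinarith
  · intro hA
    have := not_lt.1 (mt (h.mem_iff z hzN).2 hA)
    have h3 : ⟪ν, z⟫ - φ x - fderiv ℝ φ x (hproj ν z - x) ≤
        ε * ‖z - graphMap ν φ x‖ := by linarith [hz'.2]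
    nlinarith

theorem graphMap_hproj (h : IsGraphPatch A S N ν φ C) {z : E d} (hz : z ∈ N) (hzS : z ∈ S) :
    graphMap ν φ (hproj ν z) = z := by
  rw [graphMap, (h.mem_bdry_iff z hz).1 hzS, hproj_add_inner h.norm_eq]

theorem inter_eq (h : IsGraphPatch A S N ν φ C) : S ∩ N = Set.range (graphMap ν φ) ∩ N := by
  ext z
  refine and_congr_left fun hz => ⟨fun hzS => ⟨_, h.graphMap_hproj hz hzS⟩, ?_⟩
  rintro ⟨x, rfl⟩
  rw [h.mem_bdry_iff _ hz, hproj_graphMap, graphMap, inner_add_smul h.norm_eq]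

end IsGraphPatch

/-! ### Surface measure and outer normals on a Lipschitz graph patch -/

theorem finrank_hyper {d : ℕ} {ν : E d} (hν : ‖ν‖ = 1) :
    Module.finrank ℝ (hyper ν) = d + 1 := by
  have h := Submodule.finrank_add_finrank_orthogonal (Submodule.span ℝ {ν})
  rw [finrank_span_singleton (by rintro rfl; simp at hν), finrank_euclideanSpace_fin] at h
  change Module.finrank ℝ (Submodule.span ℝ {ν})ᗮ = _
  omega

theorem nontrivial_hyper {d : ℕ} {ν : E d} (hν : ‖ν‖ = 1) : Nontrivial (hyper ν) :=
  Module.nontrivial_of_finrank_pos (R := ℝ) (by rw [finrank_hyper hν]; omega)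

/-- The surface measure. -/
abbrev surf (d : ℕ) : Measure (E d) := Measure.euclideanHausdorffMeasure (d + 1)

theorem surf_graphMap_null {d : ℕ} {ν : E d} (hν : ‖ν‖ = 1) {φ : hyper ν → ℝ} {C : NNReal}
    (hφ : LipschitzWith C φ) {B : Set (hyper ν)} (hB : volume B = 0) :
    surf d (graphMap ν φ '' B) = 0 := by
  refine le_antisymm ((euclideanHausdorffMeasure_image_le
    ((lipschitzWith_graphMap hν hφ).lipschitzOnWith (s := B)) (d + 1)).trans ?_) zero_le
  rw [← finrank_hyper hν, InnerProductSpace.euclideanHausdorffMeasure_eq_volume, hB, mul_zero]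

namespace IsGraphPatch

variable {d : ℕ} {A S N : Set (E d)} {ν : E d} {φ : hyper ν → ℝ} {C : NNReal}

theorem ae_outerNormal_eq (h : IsGraphPatch A S N ν φ C) :
    ∀ᵐ z ∂(surf d), z ∈ S ∩ N → outerNormal A z = graphNormal ν φ (hproj ν z) := by
  have hnull : surf d (graphMap ν φ '' {x | ¬ DifferentiableAt ℝ φ x}) = 0 :=
    surf_graphMap_null h.norm_eq h.lipschitz h.lipschitz.ae_differentiableAt
  refine measure_mono_null (fun z hz => ?_) hnull
  simp only [Set.mem_compl_iff, Set.mem_ofPred_eq, Classical.not_imp] at hz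
  obtain ⟨⟨hzS, hzN⟩, hne⟩ := hz
  have hg := h.graphMap_hproj hzN hzS
  refine ⟨hproj ν z, fun hd => hne ?_, hg⟩
  have := (h.isOuterNormal (x := hproj ν z) (by rwa [hg]) hd).outerNormal_eq
  rwa [hg] at this

/-- `outerNormal` is obtained by choice, so its measurability is available only through its almost
everywhere equality with the explicit normal of the graph. -/
theorem aestronglyMeasurable_outerNormal (h : IsGraphPatch A S N ν φ C) (hS : MeasurableSet S) :
    AEStronglyMeasurable (outerNormal A) ((surf d).restrict (S ∩ N)) := by
  refine ⟨fun z => graphNormal ν φ (hproj ν z),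
    ((measurable_graphNormal ν φ).comp (hproj ν).continuous.measurable).stronglyMeasurable, ?_⟩
  exact (ae_restrict_iff' (hS.inter h.isOpen.measurableSet)).2 h.ae_outerNormal_eq

theorem surf_inter_lt_top (h : IsGraphPatch A S N ν φ C) {K : Set (E d)} (hK : IsCompact K)
    (hKN : K ⊆ N) : surf d (S ∩ K) < ⊤ := by
  have hsub : S ∩ K ⊆ graphMap ν φ '' (hproj ν '' K) := fun z hz =>
    ⟨hproj ν z, ⟨z, hz.2, rfl⟩, h.graphMap_hproj (hKN hz.2) hz.1⟩
  refine (measure_mono hsub).trans_lt ((euclideanHausdorffMeasure_image_le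
    ((lipschitzWith_graphMap h.norm_eq h.lipschitz).lipschitzOnWith (s := hproj ν '' K))
    (d + 1)).trans_lt ?_)
  rw [← finrank_hyper h.norm_eq, InnerProductSpace.euclideanHausdorffMeasure_eq_volume]
  exact ENNReal.mul_lt_top (ENNReal.pow_lt_top ENNReal.coe_lt_top)
    (hK.image (hproj ν).continuous).measure_lt_top

/-- Surface integrals in graph coordinates. -/
theorem integral_surf (h : IsGraphPatch A S N ν φ C) (hS : MeasurableSet S) {g : E d → ℝ}
    (hg : ∀ z ∉ N, g z = 0) :
    ∫ z in S, g z ∂(surf d) = ∫ x, areaDensity (fderiv ℝ φ x) * g (graphMap ν φ x) := by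
  have := nontrivial_hyper h.norm_eq
  have hemb := measurableEmbedding_graphMap h.norm_eq h.lipschitz
  have h1 : ∫ z in S, g z ∂(surf d) = ∫ z in S ∩ N, g z ∂(surf d) :=
    (setIntegral_eq_of_subset_of_forall_sdiff_eq_zero hS Set.inter_subset_left
      fun z hz => hg z fun hzN => hz.2 ⟨hz.1, hzN⟩)
  have h2 : ∫ z in Set.range (graphMap ν φ), g z ∂(surf d) =
      ∫ z in Set.range (graphMap ν φ) ∩ N, g z ∂(surf d) :=
    setIntegral_eq_of_subset_of_forall_sdiff_eq_zero hemb.measurableSet_range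
      Set.inter_subset_left fun z hz => hg z fun hzN => hz.2 ⟨hz.1, hzN⟩
  rw [h1, h.inter_eq, ← h2, ← map_graphMap h.norm_eq (finrank_hyper h.norm_eq) h.lipschitz,
    hemb.integral_map, integral_withDensity_eq_integral_toReal_smul
    (measurable_areaDensity φ).ennreal_ofReal (Filter.Eventually.of_forall fun x => by simp)]
  refine integral_congr_ae (Filter.Eventually.of_forall fun x => ?_)
  simp only [smul_eq_mul]
  rw [ENNReal.toReal_ofReal (zero_le_one.trans (one_le_areaDensity _))]

/-- The area density of the surface measure cancels the normalization of the unit normal, which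
turns the boundary term of `integral_divergence_epigraph` into a surface integral. -/
theorem integral_divergence (h : IsGraphPatch A S N ν φ C) (hA : MeasurableSet A)
    (hS : MeasurableSet S) {v : E d → E d} (hv : Differentiable ℝ v)
    (hc : HasCompactSupport v) (hd : Continuous (divergence v)) (hvN : tsupport v ⊆ N) :
    ∫ z in A, divergence v z = ∫ z in S, ⟪v z, outerNormal A z⟫ ∂(surf d) := by
  have hv0 : ∀ z ∉ N, v z = 0 := fun z hz => image_eq_zero_of_notMem_tsupport fun h' => hz (hvN h')
  have hd0 : ∀ z ∉ N, divergence v z = 0 := fun z hz =>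
    divergence_eq_zero_of_notMem_tsupport fun h' => hz (hvN h')
  rw [h.integral_surf hS (fun z hz => by rw [hv0 z hz, inner_zero_left])]
  set D := {z : E d | φ (hproj ν z) < ⟪ν, z⟫} with hD
  have hDm : MeasurableSet D := measurableSet_lt
    (h.lipschitz.continuous.comp (hproj ν).continuous).measurable
    (innerSL ℝ ν).continuous.measurable
  have e1 : ∫ z in A, divergence v z = ∫ z in D, divergence v z := by
    rw [← integral_indicator hA, ← integral_indicator hDm]
    congr with z
    by_cases hz : z ∈ N
    · by_cases hzA : z ∈ A
      · rw [Set.indicator_of_mem hzA, Set.indicator_of_mem (s := D) ((h.mem_iff z hz).1 hzA)]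
      · rw [Set.indicator_of_notMem hzA, Set.indicator_of_notMem (s := D) (mt (h.mem_iff z hz).2 hzA)]
    · simp [Set.indicator, hd0 z hz]
  rw [e1, integral_divergence_epigraph h.norm_eq h.lipschitz hv hc hd, ← integral_neg]
  refine integral_congr_ae ?_
  filter_upwards [h.lipschitz.ae_differentiableAt (μ := volume)] with x hx
  by_cases hxN : graphMap ν φ x ∈ N
  · rw [(h.isOuterNormal hxN hx).outerNormal_eq, real_inner_comm, inner_graphNormal]
    have := (zero_lt_one.trans_le (one_le_areaDensity (fderiv ℝ φ x))).ne'
    field_simp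
  · rw [hv0 _ hxN]
    simp [graphConormal]

end IsGraphPatch

/-! ### The divergence theorem for domains with Lipschitz boundary -/

/-- In `Ω`, the set `S` is the boundary of `A`, and it is locally a Lipschitz graph. -/
def IsLipschitzIn {d : ℕ} (A S Ω : Set (E d)) : Prop :=
  ∀ x ∈ Ω, (A ∈ 𝓝 x ∧ Sᶜ ∈ 𝓝 x) ∨ (Aᶜ ∈ 𝓝 x ∧ Sᶜ ∈ 𝓝 x) ∨
    ∃ (N : Set (E d)) (ν : E d) (φ : hyper ν → ℝ) (C : NNReal), x ∈ N ∧ IsGraphPatch A S N ν φ C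

theorem IsLipschitzIn.surf_inter_lt_top {d : ℕ} {A S Ω : Set (E d)} (h : IsLipschitzIn A S Ω)
    {K : Set (E d)} (hK : IsCompact K) (hKΩ : K ⊆ Ω) : surf d (S ∩ K) < ⊤ := by
  have key : ∀ x ∈ K, ∃ t ∈ 𝓝 x, surf d (S ∩ t) < ⊤ := by
    intro x hx
    rcases h x (hKΩ hx) with ⟨-, h'⟩ | ⟨-, h'⟩ | ⟨N, ν, φ, C, hxN, hN⟩
    · exact ⟨_, h', by simp⟩
    · exact ⟨_, h', by simp⟩
    · obtain ⟨r, hr, hrN⟩ := Metric.nhds_basis_closedBall.mem_iff.1 (hN.isOpen.mem_nhds hxN)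
      exact ⟨_, Metric.closedBall_mem_nhds x hr,
        hN.surf_inter_lt_top (isCompact_closedBall x r) hrN⟩
  refine hK.induction_on (p := fun t => surf d (S ∩ t) < ⊤) (by simp)
    (fun s t hst ht => (measure_mono (Set.inter_subset_inter_right _ hst)).trans_lt ht)
    (fun s t hs ht => ?_) (fun x hx => ?_)
  · rw [Set.inter_union_distrib_left]
    exact (measure_union_le _ _).trans_lt (ENNReal.add_lt_top.2 ⟨hs, ht⟩)
  · obtain ⟨t, ht, ht'⟩ := key x hx
    exact ⟨t, mem_nhdsWithin_of_mem_nhds ht, ht'⟩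

theorem IsLipschitzIn.aestronglyMeasurable_outerNormal {d : ℕ} {A S Ω : Set (E d)}
    (h : IsLipschitzIn A S Ω) (hS : MeasurableSet S) (hSΩ : S ⊆ Ω) :
    AEStronglyMeasurable (outerNormal A) ((surf d).restrict S) := by
  have key : ∀ x : E d, ∃ t ∈ 𝓝[S] x, x ∈ S → IsOpen t ∧
      AEStronglyMeasurable (outerNormal A) ((surf d).restrict (S ∩ t)) := by
    intro x
    by_cases hx : x ∈ S
    · rcases h x (hSΩ hx) with ⟨-, h'⟩ | ⟨-, h'⟩ | ⟨N, ν, φ, C, hxN, hN⟩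
      · exact absurd hx (mem_of_mem_nhds h')
      · exact absurd hx (mem_of_mem_nhds h')
      · exact ⟨N, mem_nhdsWithin_of_mem_nhds (hN.isOpen.mem_nhds hxN), fun _ =>
          ⟨hN.isOpen, hN.aestronglyMeasurable_outerNormal hS⟩⟩
    · exact ⟨Set.univ, Filter.univ_mem, fun hx' => absurd hx' hx⟩
  choose t ht ht' using key
  obtain ⟨c, hcS, hc, hcov⟩ := TopologicalSpace.countable_cover_nhdsWithin (f := t) (s := S)
    (fun x _ => ht x)
  have hSeq : S = ⋃ x ∈ c, S ∩ t x := by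
    rw [← Set.inter_iUnion₂]
    exact (Set.inter_eq_left.2 hcov).symm
  have := hc.to_subtype
  rw [hSeq, Set.biUnion_eq_iUnion]
  rw [aestronglyMeasurable_iUnion_iff]
  intro x
  exact (ht' x (hcS x.2)).2

open scoped Manifold ContDiff in
/-- The divergence theorem for a domain with Lipschitz boundary. -/
theorem IsLipschitzIn.integral_divergence {d : ℕ} {A S Ω : Set (E d)} (h : IsLipschitzIn A S Ω)
    (hA : MeasurableSet A) (hS : MeasurableSet S) (hSΩ : S ⊆ Ω) {v : E d → E d}
    (hv : Differentiable ℝ v) (hc : HasCompactSupport v) (hd : Continuous (divergence v))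
    (hvΩ : tsupport v ⊆ Ω) :
    ∫ z in A, divergence v z = ∫ z in S, ⟪v z, outerNormal A z⟫ ∂(surf d) := by
  -- integrability of the boundary term
  have hbd : ∀ w : E d → E d, Continuous w → tsupport w ⊆ tsupport v →
      IntegrableOn (fun z => ⟪w z, outerNormal A z⟫) S (surf d) := by
    intro w hw hwv
    have hK := hc.isCompact
    have hwc : HasCompactSupport w := hK.of_isClosed_subset (isClosed_tsupport w) hwv
    obtain ⟨M, hM⟩ := hwc.exists_bound_of_continuous hw
    have hfin : IntegrableOn (fun z => ⟪w z, outerNormal A z⟫) (S ∩ tsupport v) (surf d) := by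
      refine IntegrableOn.of_bound (h.surf_inter_lt_top hK hvΩ) ?_ M
        (Filter.Eventually.of_forall fun z => ?_)
      · exact (hw.aestronglyMeasurable.inner
          (h.aestronglyMeasurable_outerNormal hS hSΩ)).mono_measure
            (Measure.restrict_mono Set.inter_subset_left le_rfl)
      · refine (norm_inner_le_norm _ _).trans ?_
        refine (mul_le_of_le_one_right (norm_nonneg _) (norm_outerNormal_le A z)).trans (hM z)
    refine IntegrableOn.of_forall_sdiff_eq_zero hfin hS fun z hz => ?_
    rw [image_eq_zero_of_notMem_tsupport fun hz' => hz.2 ⟨hz.1, hwv hz'⟩, inner_zero_left]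
  -- local sets where the formula holds
  have hloc : ∀ x : E d, ∃ N : Set (E d), IsOpen N ∧ (x ∈ tsupport v → x ∈ N ∧
      ∀ w : E d → E d, Differentiable ℝ w → HasCompactSupport w → Continuous (divergence w) →
        tsupport w ⊆ N →
        ∫ z in A, divergence w z = ∫ z in S, ⟪w z, outerNormal A z⟫ ∂(surf d)) := by
    intro x
    by_cases hx : x ∈ tsupport v
    swap
    · exact ⟨∅, isOpen_empty, fun h' => absurd h' hx⟩
    have hS0 : ∀ (N : Set (E d)) (w : E d → E d), N ⊆ Sᶜ → tsupport w ⊆ N →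
        ∫ z in S, ⟪w z, outerNormal A z⟫ ∂(surf d) = 0 := by
      intro N w hN hw
      refine setIntegral_eq_zero_of_forall_eq_zero fun z hz => ?_
      rw [image_eq_zero_of_notMem_tsupport fun hz' => hN (hw hz') hz, inner_zero_left]
    rcases h x (hvΩ hx) with ⟨h1, h2⟩ | ⟨h1, h2⟩ | ⟨N, ν, φ, C, hxN, hN⟩
    · refine ⟨interior (A ∩ Sᶜ), isOpen_interior, fun _ =>
        ⟨mem_interior_iff_mem_nhds.2 (Filter.inter_mem h1 h2), fun w hw hwc hwd hws => ?_⟩⟩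
      rw [hS0 _ w (interior_subset.trans Set.inter_subset_right) hws,
        setIntegral_eq_integral_of_forall_compl_eq_zero fun z hz =>
          divergence_eq_zero_of_notMem_tsupport fun hz' => hz (interior_subset (hws hz')).1]
      exact integral_divergence_eq_zero hw hwc
        (hwd.integrable_of_hasCompactSupport (hasCompactSupport_divergence hwc))
    · refine ⟨interior (Aᶜ ∩ Sᶜ), isOpen_interior, fun _ =>
        ⟨mem_interior_iff_mem_nhds.2 (Filter.inter_mem h1 h2), fun w hw hwc hwd hws => ?_⟩⟩
      rw [hS0 _ w (interior_subset.trans Set.inter_subset_right) hws]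
      refine setIntegral_eq_zero_of_forall_eq_zero fun z hz => ?_
      exact divergence_eq_zero_of_notMem_tsupport fun hz' => (interior_subset (hws hz')).1 hz
    · exact ⟨N, hN.isOpen, fun _ => ⟨hxN, fun w hw hwc hwd hws =>
        hN.integral_divergence hA hS hw hwc hwd hws⟩⟩
  choose N hNo hN using hloc
  obtain ⟨t, htv, ht⟩ := hc.isCompact.elim_nhds_subcover N
    (fun x hx => (hNo x).mem_nhds (hN x hx).1)
  -- The pieces `ρ i • v` remain in the admissible class: by the product rule their divergence
  -- involves only `divergence v` and `v` itself, so it is continuous although `v` need not be `C¹`.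
  obtain ⟨ρ, hρ⟩ := SmoothPartitionOfUnity.exists_isSubordinate 𝓘(ℝ, E d)
    (isClosed_tsupport v) (fun x : t => N x) (fun x => hNo x)
    (fun x hx => by simpa using ht hx)
  have hρs : ∀ i, ContDiff ℝ 1 (ρ i) := fun i =>
    ((ρ i).contMDiff.contDiff).of_le (by exact_mod_cast le_top)
  have hρd : ∀ i, Differentiable ℝ (ρ i) := fun i => (hρs i).differentiable one_ne_zero
  let w : t → E d → E d := fun i z => ρ i z • v z
  have hwsum : ∀ z, ∑ i, w i z = v z := by
    intro z
    by_cases hz : z ∈ tsupport v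
    · have := ρ.sum_eq_one hz
      rw [finsum_eq_sum_of_fintype] at this
      rw [← Finset.sum_smul, this, one_smul]
    · simp [w, image_eq_zero_of_notMem_tsupport hz]
  have hwd : ∀ i, Differentiable ℝ (w i) := fun i => (hρd i).smul hv
  have hwsub : ∀ i, tsupport (w i) ⊆ tsupport v := fun i =>
    closure_mono (Function.support_smul_subset_right (ρ i) v)
  have hwsub' : ∀ i, tsupport (w i) ⊆ N i := fun i =>
    (closure_mono (Function.support_smul_subset_left (ρ i) v)).trans (hρ i)
  have hwc : ∀ i, HasCompactSupport (w i) := fun i =>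
    hc.isCompact.of_isClosed_subset (isClosed_tsupport _) (hwsub i)
  have hwdiv : ∀ i, Continuous (divergence (w i)) := fun i => by
    have : divergence (w i) = fun z => ρ i z * divergence v z + fderiv ℝ (ρ i) z (v z) :=
      funext fun z => divergence_smul (hv z) (hρd i z)
    rw [this]
    exact ((hρs i).continuous.mul hd).add
      (((hρs i).continuous_fderiv one_ne_zero).clm_apply hv.continuous)
  have hdsum : ∀ z, divergence v z = ∑ i, divergence (w i) z := by
    intro z
    have : v = fun z => ∑ i, w i z := funext fun z => (hwsum z).symm
    conv_lhs => rw [this]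
    simp only [divergence]
    rw [Finset.sum_comm, fderiv_fun_sum fun i _ => hwd i z]
    simp
  simp_rw [hdsum]
  rw [integral_finsetSum _ fun i _ => ((hwdiv i).integrable_of_hasCompactSupport
    (hasCompactSupport_divergence (hwc i))).integrableOn]
  have hbsum : ∀ z, ⟪v z, outerNormal A z⟫ = ∑ i, ⟪w i z, outerNormal A z⟫ := fun z => by
    rw [← sum_inner, hwsum]
  simp_rw [hbsum]
  rw [integral_finsetSum _ fun i _ => hbd (w i) (hwd i).continuous (hwsub i)]
  exact Finset.sum_congr rfl fun i _ =>
    (hN i (htv i i.2)).2 (w i) (hwd i) (hwc i) (hwdiv i) (hwsub' i)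

/-! ### The Clifford algebra -/

instance instFiniteDimensionalCl (d : ℕ) : FiniteDimensional ℝ (Cl d) :=
  Module.Finite.of_basis (clBasis d)

/-- The multiplication of `Cl_n` as a continuous bilinear map. -/
def mulB (d : ℕ) : Cl d →L[ℝ] Cl d →L[ℝ] Cl d := (LinearMap.mul ℝ (Cl d)).toContinuousBilinearMap

theorem mulB_apply {d : ℕ} (a b : Cl d) : mulB d a b = a * b := rfl

/-- The embedding of `ℝⁿ` in `Cl_n` as a continuous linear map. -/
def vecL (d : ℕ) : E d →L[ℝ] Cl d :=
  LinearMap.toContinuousLinearMap (CliffordAlgebra.ι (negForm d))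

theorem vecL_apply {d : ℕ} (x : E d) : vecL d x = vec x := rfl

/-- The automorphism `a ↦ a^*` as a continuous linear map. -/
def starL (d : ℕ) : Cl d →L[ℝ] Cl d := LinearMap.toContinuousLinearMap (starCl d).toLinearMap

theorem starL_apply {d : ℕ} (a : Cl d) : starL d a = starCl d a := rfl

instance instContinuousMulCl (d : ℕ) : ContinuousMul (Cl d) where
  continuous_mul := by
    have : Continuous fun q : Cl d × Cl d => mulB d q.1 q.2 := by fun_prop
    exact this

theorem continuous_vec {d : ℕ} : Continuous (vec : E d → Cl d) := (vecL d).continuous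

theorem continuous_starCl {d : ℕ} : Continuous (starCl d) := (starL d).continuous

theorem vec_add {d : ℕ} (x y : E d) : vec (x + y) = vec x + vec y := map_add (vecL d) x y

theorem vec_sub {d : ℕ} (x y : E d) : vec (x - y) = vec x - vec y := map_sub (vecL d) x y

theorem vec_neg {d : ℕ} (x : E d) : vec (-x) = -vec x := map_neg (vecL d) x

theorem vec_smul {d : ℕ} (c : ℝ) (x : E d) : vec (c • x) = c • vec x := map_smul (vecL d) c x

theorem vec_mul_self {d : ℕ} (x : E d) : vec x * vec x = -((‖x‖ ^ 2) • (1 : Cl d)) := by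
  rw [vec, CliffordAlgebra.ι_sq_scalar, negForm_apply, Algebra.algebraMap_eq_smul_one, neg_smul]

theorem vec_mul_add_swap {d : ℕ} (x y : E d) :
    vec x * vec y + vec y * vec x = -((2 * ⟪x, y⟫) • (1 : Cl d)) := by
  have h := vec_mul_self (x + y)
  rw [vec_add, norm_add_sq_real] at h
  have hx := vec_mul_self x
  have hy := vec_mul_self y
  have e : (vec x + vec y) * (vec x + vec y) =
      vec x * vec x + (vec x * vec y + vec y * vec x) + vec y * vec y := by noncomm_ring
  rw [e, hx, hy] at h
  linear_combination (norm := module) h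

theorem starCl_vec {d : ℕ} (x : E d) : starCl d (vec x) = vec (starVec d x) :=
  CliffordAlgebra.map_apply_ι _ _

/-- The last basis vector `e_n`. -/
abbrev lastVec (d : ℕ) : E d := stdVec (Fin.last (d + 1))

theorem norm_stdVec {d : ℕ} (i : Fin (d + 2)) : ‖(stdVec i : E d)‖ = 1 := by simp [stdVec]

theorem inner_stdVec {d : ℕ} (i : Fin (d + 2)) (x : E d) : ⟪stdVec i, x⟫ = x i := by
  simp [stdVec, EuclideanSpace.inner_single_left]

theorem starVec_apply {d : ℕ} (x : E d) : starVec d x = x - (2 * lastCoord x) • lastVec d := by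
  rw [starVec, Submodule.reflection_orthogonal_apply,
    Submodule.reflection_singleton_apply, norm_stdVec, inner_stdVec]
  simp only [lastCoord, RCLike.ofReal_real_eq_id, id_eq]
  module

theorem starVec_starVec {d : ℕ} (x : E d) : starVec d (starVec d x) = x :=
  Submodule.reflection_reflection _ x

theorem starCl_starCl {d : ℕ} (a : Cl d) : starCl d (starCl d a) = a := by
  induction a using CliffordAlgebra.induction with
  | algebraMap r => simp
  | ι x =>
    have h := starCl_vec (starVec d x)
    rw [← starCl_vec, starVec_starVec] at h
    exact h
  | mul a b ha hb => rw [map_mul, map_mul, ha, hb]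
  | add a b ha hb => rw [map_add, map_add, ha, hb]

theorem lastCoord_starVec {d : ℕ} (x : E d) : lastCoord (starVec d x) = -lastCoord x := by
  rw [starVec_apply]
  simp [lastCoord, stdVec]
  ring

theorem starVec_lastVec {d : ℕ} : starVec d (lastVec d) = -lastVec d := by
  rw [starVec_apply]
  have : lastCoord (lastVec d) = 1 := by simp [lastCoord, stdVec]
  rw [this]
  module

theorem lastVec_mul_self (d : ℕ) : vec (lastVec d) * vec (lastVec d) = -1 := by
  rw [vec_mul_self, norm_stdVec]
  simp

theorem lastVec_mul_qPart {d : ℕ} (a : Cl d) :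
    vec (lastVec d) * qPart a = (1 / 2 : ℝ) • (a - starCl d a) := by
  rw [qPart, mul_neg, mul_smul_comm, ← mul_assoc, lastVec_mul_self, neg_one_mul, smul_neg, neg_neg]

theorem starCl_qPart {d : ℕ} (a : Cl d) : starCl d (qPart a) = qPart a := by
  rw [qPart, map_neg, map_smul, map_mul, map_sub, starCl_starCl, starCl_vec, starVec_lastVec,
    vec_neg, neg_mul, ← mul_neg, neg_sub]

/-- Equivalently `e_n y^* e_n = y`: conjugation by `e_n` realizes the reflection. -/
theorem lastVec_mul_starVec {d : ℕ} (y : E d) :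
    vec (lastVec d) * vec (starVec d y) = -(vec y * vec (lastVec d)) := by
  have h1 := vec_mul_add_swap (lastVec d) y
  rw [inner_stdVec] at h1
  have h1' : vec (lastVec d) * vec y + vec y * vec (lastVec d) =
      -((2 * lastCoord y) • (1 : Cl d)) := h1
  rw [starVec_apply, vec_sub, vec_smul, mul_sub, mul_smul_comm, lastVec_mul_self, smul_neg,
    sub_neg_eq_add]
  rw [eq_neg_iff_add_eq_zero]
  rw [add_right_comm, h1', neg_add_cancel]

theorem vec_starVec {d : ℕ} (x : E d) :
    vec (starVec d x) = vec x - (2 * lastCoord x) • vec (lastVec d) := by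
  rw [starVec_apply, vec_sub, vec_smul]

/-- Expanded, both sides contain `x² = (x^*)²` and `y y^*`. The mixed terms `x y^* + y x` do not
change when `x` becomes `x^*`, since `x - x^*` is a multiple of `e_n` and `e_n y^* + y e_n = 0`. For
the inverses this becomes `αβ = β^* α^*`. -/
theorem vec_sub_mul_vec_sub_starVec {d : ℕ} (x y : E d) :
    vec (x - y) * vec (x - starVec d y) =
      vec (starVec d x - y) * vec (starVec d x - starVec d y) := by
  have hx : vec (starVec d x) * vec (starVec d x) = vec x * vec x := by
    rw [vec_mul_self, vec_mul_self, LinearIsometryEquiv.norm_map]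
  have h1 := lastVec_mul_starVec y
  rw [vec_sub, vec_sub, vec_sub, vec_sub, sub_mul, sub_mul, mul_sub, mul_sub, mul_sub, mul_sub, hx]
  have h2 : vec (starVec d x) * vec (starVec d y) + vec y * vec (starVec d x) =
      vec x * vec (starVec d y) + vec y * vec x := by
    rw [vec_starVec x, sub_mul, mul_sub, smul_mul_assoc, mul_smul_comm, h1]
    module
  linear_combination (norm := module) h2

/-- Write `2 x_n e_n = (x - y^*) - (x^* - y^*)`. The first summand meets its equal directly, the
second after `vec_sub_mul_vec_sub_starVec`, and squares of vectors are scalars. -/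
theorem two_smul_mul_lastVec {d : ℕ} (x y : E d) :
    (2 * lastCoord x) • (vec (x - y) * vec (x - starVec d y) * vec (lastVec d)) =
      (‖x - y‖ ^ 2) • vec (starVec d x - y) - (‖x - starVec d y‖ ^ 2) • vec (x - y) := by
  have h0 : (2 * lastCoord x) • vec (lastVec d) =
      vec (x - starVec d y) - vec (starVec d x - starVec d y) := by
    rw [vec_sub, vec_sub, vec_starVec x]
    abel
  have hn : ‖starVec d x - starVec d y‖ = ‖x - y‖ := by
    rw [← map_sub, LinearIsometryEquiv.norm_map]
  rw [← mul_smul_comm, h0, mul_sub, mul_assoc, vec_mul_self]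
  rw [vec_sub_mul_vec_sub_starVec, mul_assoc (vec (starVec d x - y)), vec_mul_self, hn]
  simp only [mul_neg, mul_smul_comm, mul_one]
  abel

theorem vec_vecInv {d : ℕ} (x : E d) : vec (vecInv x) = -((‖x‖ ^ 2)⁻¹ • vec x) := by
  rw [vecInv, vec_neg, vec_smul]

theorem starVec_vecInv {d : ℕ} (x : E d) : starVec d (vecInv x) = vecInv (starVec d x) := by
  rw [vecInv, vecInv, map_neg, map_smul, LinearIsometryEquiv.norm_map]

/-- The algebraic identity behind Cauchy's formula for hypermonogenic functions. -/
theorem kernel_identity {d : ℕ} {x y : E d} (hx : 0 < lastCoord x) (hxy : x ≠ y)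
    (hxy' : x ≠ starVec d y) (F : Cl d) :
    vec (vecInv (x - y)) * vec (vecInv (x - starVec d y)) * F -
        (lastCoord x)⁻¹ • (vec (vecInv (x - y)) * qPart F) =
      starCl d (vec (vecInv (x - starVec d y)) * vec (vecInv (x - y)) * F -
        (lastCoord x)⁻¹ • (vec (vecInv (x - starVec d y)) * qPart F)) := by
  set α := vec (vecInv (x - y)) with hα
  set β := vec (vecInv (x - starVec d y)) with hβ
  have ha : ‖x - y‖ ^ 2 ≠ 0 := pow_ne_zero 2 (norm_ne_zero_iff.2 (sub_ne_zero.2 hxy))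
  have hb : ‖x - starVec d y‖ ^ 2 ≠ 0 := pow_ne_zero 2 (norm_ne_zero_iff.2 (sub_ne_zero.2 hxy'))
  have hna : ‖starVec d x - starVec d y‖ = ‖x - y‖ := by
    rw [← map_sub, LinearIsometryEquiv.norm_map]
  have hnb : ‖starVec d x - y‖ = ‖x - starVec d y‖ := by
    rw [← starVec_starVec y, ← map_sub, LinearIsometryEquiv.norm_map, starVec_starVec]
  have hsα : starCl d α = vec (vecInv (starVec d x - starVec d y)) := by
    rw [hα, starCl_vec, starVec_vecInv, map_sub]
  have hsβ : starCl d β = vec (vecInv (starVec d x - y)) := by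
    rw [hβ, starCl_vec, starVec_vecInv, map_sub, starVec_starVec]
  have h1 : α * β = starCl d β * starCl d α := by
    rw [hsα, hsβ, hα, hβ]
    simp only [vec_vecInv, hna, hnb, neg_mul_neg, smul_mul_assoc, mul_smul_comm]
    rw [vec_sub_mul_vec_sub_starVec, smul_comm]
  have h2 : (2 * lastCoord x) • (α * β * vec (lastVec d)) = α - starCl d β := by
    rw [hsβ, hα, hβ]
    simp only [vec_vecInv, hnb, neg_mul_neg, smul_mul_assoc, mul_smul_comm]
    rw [smul_comm, smul_comm (2 * lastCoord x), two_smul_mul_lastVec]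
    rw [smul_sub, smul_sub, smul_smul, smul_smul, smul_smul, smul_smul]
    rw [mul_assoc, inv_mul_cancel₀ ha, mul_one, mul_right_comm, inv_mul_cancel₀ hb, one_mul]
    abel
  have h3 : F - starCl d F = (2 : ℝ) • (vec (lastVec d) * qPart F) := by
    rw [lastVec_mul_qPart, smul_smul]
    norm_num
  rw [map_sub, map_smul, map_mul, map_mul, map_mul, starCl_qPart, ← h1]
  -- `F - F^* = 2 e_n QF` combined with `2 x_n αβ e_n = α - β^*`. As `β^* α^* = αβ` and `QF` is
  -- fixed by the star, this is the claim rearranged.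
  have h4 : α * β * F - α * β * starCl d F =
      (lastCoord x)⁻¹ • ((α - starCl d β) * qPart F) := by
    rw [← mul_sub, h3, ← h2, smul_mul_assoc, smul_smul, mul_smul_comm, mul_assoc (α * β)]
    congr 1
    field_simp
  rw [sub_mul, smul_sub] at h4
  linear_combination (norm := module) h4

/-- Both kernels thus come from one family with the poles `y` and `y^*` interchanged, and the star
can be taken outside sums and integrals. -/
theorem p₂_eq {d : ℕ} (x y : E d) : p₂ x y =
    starCl d ((‖x - starVec d y‖ ^ d * ‖x - y‖ ^ d)⁻¹ • vec (vecInv (x - starVec d y))) := by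
  have hnb : ‖starVec d x - y‖ = ‖x - starVec d y‖ := by
    rw [← starVec_starVec y, ← map_sub, LinearIsometryEquiv.norm_map, starVec_starVec]
  rw [p₂, map_smul, starCl_vec, starVec_vecInv, map_sub, starVec_starVec, hnb, mul_comm]

/-! ### The Gauss formula for the Dirac operator -/

/-- The Dirac operator acting from the right. -/
def rightDirac {d : ℕ} (p : E d → Cl d) (x : E d) : Cl d :=
  ∑ i : Fin (d + 2), fderiv ℝ p x (stdVec i) * vec (stdVec i)

/-- The gradient of a real function as an element of `Cl_n`. -/
def gradVec {d : ℕ} (θ : E d → ℝ) (x : E d) : Cl d :=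
  ∑ i : Fin (d + 2), fderiv ℝ θ x (stdVec i) • vec (stdVec i)

theorem norm_mul_le_mulB {d : ℕ} (a b : Cl d) : ‖a * b‖ ≤ ‖mulB d‖ * ‖a‖ * ‖b‖ :=
  (mulB d).le_opNorm₂ a b

theorem hasFDerivAt_mul {d : ℕ} {p f : E d → Cl d} {p' f' : E d →L[ℝ] Cl d} {x : E d}
    (hp : HasFDerivAt p p' x) (hf : HasFDerivAt f f' x) :
    HasFDerivAt (fun z => p z * f z)
      ((mulB d).precompR (E d) (p x) f' + (mulB d).precompL (E d) p' (f x)) x :=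
  (mulB d).hasFDerivAt_of_bilinear hp hf

theorem rightDirac_smul {d : ℕ} {θ : E d → ℝ} {p : E d → Cl d} {x : E d}
    (hθ : DifferentiableAt ℝ θ x) (hp : DifferentiableAt ℝ p x) :
    rightDirac (fun z => θ z • p z) x = θ x • rightDirac p x + p x * gradVec θ x := by
  simp only [rightDirac, gradVec]
  rw [fderiv_fun_smul hθ hp, Finset.smul_sum, Finset.mul_sum, ← Finset.sum_add_distrib]
  refine Finset.sum_congr rfl fun i _ => ?_
  simp [add_mul]

theorem rightDirac_congr {d : ℕ} {p q : E d → Cl d} {x : E d} (h : p =ᶠ[𝓝 x] q) :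
    rightDirac p x = rightDirac q x := by
  simp only [rightDirac, h.fderiv_eq]

theorem rightDirac_zero {d : ℕ} (x : E d) : rightDirac (fun _ => (0 : Cl d)) x = 0 := by
  simp [rightDirac]

theorem continuous_gradVec {d : ℕ} {θ : E d → ℝ} (hθ : ContDiff ℝ 1 θ) :
    Continuous (gradVec θ) := by
  unfold gradVec
  have := hθ.continuous_fderiv one_ne_zero
  fun_prop

/-- The real vector field with `⟪v, w⟫ = ℓ (a w b)`. -/
def cliffField {d : ℕ} (ℓ : Cl d →L[ℝ] ℝ) (a b : Cl d) : E d :=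
  ∑ i, ℓ (a * vec (stdVec i) * b) • stdVec i

theorem inner_cliffField {d : ℕ} (ℓ : Cl d →L[ℝ] ℝ) (a b : Cl d) (w : E d) :
    ⟪cliffField ℓ a b, w⟫ = ℓ (a * vec w * b) := by
  have hw : vec w = ∑ i, w i • vec (stdVec i : E d) := by
    conv_lhs => rw [← coord_sum w]
    rw [← vecL_apply, map_sum]
    simp [vecL_apply]
  rw [cliffField, sum_inner, hw, Finset.mul_sum, Finset.sum_mul, map_sum]
  refine Finset.sum_congr rfl fun i _ => ?_
  rw [real_inner_smul_left, inner_stdVec, mul_smul_comm, smul_mul_assoc, map_smul, smul_eq_mul,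
    mul_comm]

/-- The individual partial derivatives combine into the two Dirac operators, so continuity of these
alone gives a continuous divergence. -/
theorem hasFDerivAt_cliffField {d : ℕ} (ℓ : Cl d →L[ℝ] ℝ) {u f : E d → Cl d} {x : E d}
    (hu : DifferentiableAt ℝ u x) (hf : DifferentiableAt ℝ f x) :
    DifferentiableAt ℝ (fun z => cliffField ℓ (u z) (f z)) x ∧
      divergence (fun z => cliffField ℓ (u z) (f z)) x =
        ℓ (rightDirac u x * f x + u x * dirac f x) := by
  have h1 : ∀ i, ∃ D : E d →L[ℝ] Cl d, HasFDerivAt (fun z => u z * vec (stdVec i) * f z) D x ∧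
      ∀ w, D w = fderiv ℝ u x w * vec (stdVec i) * f x + u x * vec (stdVec i) * fderiv ℝ f x w := by
    intro i
    have h0 := hasFDerivAt_mul hu.hasFDerivAt (hasFDerivAt_const (vec (stdVec i) : Cl d) x)
    refine ⟨_, hasFDerivAt_mul h0 hf.hasFDerivAt, fun w => ?_⟩
    simp [mulB_apply, add_comm]
  choose D hD hD' using h1
  have h2 : HasFDerivAt (fun z => cliffField ℓ (u z) (f z))
      (∑ i, (ℓ.comp (D i)).smulRight (stdVec i)) x :=
    HasFDerivAt.fun_sum (u := Finset.univ) fun i _ =>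
      ((ℓ.hasFDerivAt.comp x (hD i)).smul_const (stdVec i))
  refine ⟨h2.differentiableAt, ?_⟩
  simp only [divergence, h2.fderiv]
  rw [rightDirac, dirac, Finset.sum_mul, Finset.mul_sum, ← Finset.sum_add_distrib, map_sum]
  refine Finset.sum_congr rfl fun i _ => ?_
  rw [← mul_assoc (u x), ← hD' i (stdVec i)]
  simp [stdVec, Pi.single_apply]

/-- The Gauss formula for the Dirac operator on a domain with Lipschitz boundary. -/
theorem IsLipschitzIn.gauss {d : ℕ} {A S Ω : Set (E d)} (h : IsLipschitzIn A S Ω)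
    (hA : MeasurableSet A) (hS : MeasurableSet S) (hSΩ : S ⊆ Ω) {W : Set (E d)} (hW : IsOpen W)
    (hWΩ : W ⊆ Ω) {p f : E d → Cl d} (hp : ∀ x ∈ W, DifferentiableAt ℝ p x)
    (hpc : ContinuousOn (rightDirac p) W) (hf : ∀ x ∈ W, DifferentiableAt ℝ f x)
    (hfc : ContinuousOn (dirac f) W) {K : Set (E d)} (hK : IsCompact K) (hKW : K ⊆ W)
    (hp0 : ∀ z ∈ A ∪ S, z ∉ K → p =ᶠ[𝓝 z] fun _ => 0) :
    IntegrableOn (fun z => rightDirac p z * f z + p z * dirac f z) A ∧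
    ∫ z in A, (rightDirac p z * f z + p z * dirac f z) =
      ∫ z in S, p z * vec (outerNormal A z) * f z ∂(surf d) := by
  -- Nothing is known about `p` and `f` outside `W`. Multiplying `p` by a cutoff that is `1` near
  -- `K` and `0` off `L ⊆ W` produces global objects, and at points of `A ∪ S` nothing changes
  -- because `p` vanishes near those off `K`.
  obtain ⟨L, hL, hKL, hLW⟩ := exists_compact_between hK hW hKW
  obtain ⟨κ, hκ1, hκ0, -⟩ := exists_contMDiffMap_one_nhds_of_subset_interior (n := 1)
    (modelWithCornersSelf ℝ (E d)) hK.isClosed hKL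
  have hκ : ContDiff ℝ 1 κ := κ.contMDiff.contDiff
  have hκd : Differentiable ℝ κ := hκ.differentiable one_ne_zero
  let u : E d → Cl d := fun z => κ z • p z
  have hu0 : ∀ z ∉ L, u =ᶠ[𝓝 z] fun _ => 0 := fun z hz => by
    filter_upwards [hL.isClosed.isOpen_compl.mem_nhds hz] with w hw
    simp [u, hκ0 w hw]
  have hu0' : ∀ z ∉ L, u z = 0 := fun z hz => (hu0 z hz).self_of_nhds
  have hud : Differentiable ℝ u := fun z => by
    by_cases hz : z ∈ L
    · exact (hκd z).smul (hp z (hLW hz))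
    · exact (hu0 z hz).differentiableAt_iff.2 (differentiableAt_const _)
  have hfcW : ContinuousOn f W := fun z hz => (hf z hz).continuousAt.continuousWithinAt
  have hpcW : ContinuousOn p W := fun z hz => (hp z hz).continuousAt.continuousWithinAt
  let D : E d → Cl d := fun z => rightDirac u z * f z + u z * dirac f z
  have hD0 : ∀ z ∉ L, D z = 0 := fun z hz => by
    simp only [D, hu0' z hz, rightDirac_congr (hu0 z hz), rightDirac_zero, zero_mul, add_zero]
  have hDc : Continuous D := by
    rw [continuous_iff_continuousAt]
    intro z
    by_cases hz : z ∈ L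
    · have hDW : ContinuousOn D W := by
        have h1 : ContinuousOn (rightDirac u) W := by
          refine ContinuousOn.congr (f := fun z => κ z • rightDirac p z + p z * gradVec κ z) ?_
            fun z hz => rightDirac_smul (hκd z) (hp z hz)
          exact (hκ.continuous.continuousOn.smul hpc).add
            (hpcW.mul (continuous_gradVec hκ).continuousOn)
        exact (h1.mul hfcW).add (hud.continuous.continuousOn.mul hfc)
      exact hDW.continuousAt (hW.mem_nhds (hLW hz))
    · have : D =ᶠ[𝓝 z] fun _ => 0 := by
        filter_upwards [hL.isClosed.isOpen_compl.mem_nhds hz] with w hw using hD0 w hw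
      exact continuousAt_const.congr this.symm
  have hDi : Integrable D := hDc.integrable_of_hasCompactSupport (HasCompactSupport.intro hL hD0)
  -- the cutoff does not change the integrands
  have hup : ∀ z ∈ A ∪ S, u =ᶠ[𝓝 z] p := fun z hz => by
    by_cases hzK : z ∈ K
    · filter_upwards [hκ1.filter_mono (nhds_le_nhdsSet hzK)] with w hw
      simp [u, hw]
    · filter_upwards [hp0 z hz hzK] with w hw
      simp [u, hw]
  have e0 : Set.EqOn (fun z => rightDirac p z * f z + p z * dirac f z) D A := fun z hz => by
    have := hup z (Or.inl hz)
    simp only [D, this.self_of_nhds, rightDirac_congr this]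
  have e1 : ∫ z in A, (rightDirac p z * f z + p z * dirac f z) = ∫ z in A, D z :=
    setIntegral_congr_fun hA e0
  have e2 : ∫ z in S, p z * vec (outerNormal A z) * f z ∂(surf d) =
      ∫ z in S, u z * vec (outerNormal A z) * f z ∂(surf d) :=
    setIntegral_congr_fun hS fun z hz => by
      simp only [(hup z (Or.inr hz)).self_of_nhds]
  have hBi : IntegrableOn (fun z => u z * vec (outerNormal A z) * f z) S (surf d) := by
    obtain ⟨M, hM⟩ := hL.exists_bound_of_continuousOn hud.continuous.continuousOn
    obtain ⟨M', hM'⟩ := hL.exists_bound_of_continuousOn (hfcW.mono hLW)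
    have hfin : IntegrableOn (fun z => u z * vec (outerNormal A z) * f z) (S ∩ L) (surf d) := by
      refine IntegrableOn.of_bound (h.surf_inter_lt_top hL (hLW.trans hWΩ)) ?_
        (‖mulB d‖ * (‖mulB d‖ * M * ‖vecL d‖) * M') ?_
      · have hn := (h.aestronglyMeasurable_outerNormal hS hSΩ).mono_measure
          (Measure.restrict_mono (Set.inter_subset_left : S ∩ L ⊆ S) le_rfl)
        have hfm : AEStronglyMeasurable f ((surf d).restrict (S ∩ L)) :=
          ((hfcW.mono hLW).mono Set.inter_subset_right).aestronglyMeasurable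
            (hS.inter hL.isClosed.measurableSet)
        exact (hud.continuous.aestronglyMeasurable.mul
          (continuous_vec.comp_aestronglyMeasurable hn)).mul hfm
      · refine (ae_restrict_iff' (hS.inter hL.isClosed.measurableSet)).2
          (Filter.Eventually.of_forall fun z hz => ?_)
        have hM0 : 0 ≤ M := (norm_nonneg _).trans (hM z hz.2)
        refine (norm_mul_le_mulB _ _).trans ?_
        gcongr
        · refine (norm_mul_le_mulB _ _).trans ?_
          gcongr
          · exact hM z hz.2
          · refine ((vecL d).le_opNorm _).trans ?_
            exact mul_le_of_le_one_right (norm_nonneg _) (norm_outerNormal_le A z)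
        · exact hM' z hz.2
    refine IntegrableOn.of_forall_sdiff_eq_zero hfin hS fun z hz => ?_
    rw [hu0' z fun hz' => hz.2 ⟨hz.1, hz'⟩, zero_mul, zero_mul]
  refine ⟨hDi.integrableOn.congr_fun e0.symm hA, ?_⟩
  rw [e1, e2]
  refine (SeparatingDual.eq_iff_forall_dual_eq (R := ℝ)).2 fun ℓ => ?_
  rw [← ℓ.integral_comp_comm hDi.integrableOn, ← ℓ.integral_comp_comm hBi]
  let v : E d → E d := fun z => cliffField ℓ (u z) (f z)
  have hv0 : ∀ z ∉ L, v =ᶠ[𝓝 z] fun _ => 0 := fun z hz => by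
    filter_upwards [hu0 z hz] with w hw
    simp [v, hw, cliffField]
  have hv : ∀ z, DifferentiableAt ℝ v z ∧ divergence v z = ℓ (D z) := fun z => by
    by_cases hz : z ∈ L
    · exact hasFDerivAt_cliffField ℓ (hud z) (hf z (hLW hz))
    · refine ⟨(hv0 z hz).differentiableAt_iff.2 (differentiableAt_const _), ?_⟩
      rw [hD0 z hz, map_zero]
      simp [divergence, (hv0 z hz).fderiv_eq]
  have hvs : tsupport v ⊆ L :=
    closure_minimal (fun z hz => by_contra fun hz' => hz (hv0 z hz').self_of_nhds) hL.isClosed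
  have hdiv : divergence v = fun z => ℓ (D z) := funext fun z => (hv z).2
  have := h.integral_divergence hA hS hSΩ (v := v) (fun z => (hv z).1)
    (hL.of_isClosed_subset (isClosed_tsupport v) hvs)
    (by rw [hdiv]; exact ℓ.continuous.comp hDc) (hvs.trans (hLW.trans hWΩ))
  rw [hdiv] at this
  rw [this]
  simp only [v, inner_cliffField]

/-! ### The kernels -/

/-- The kernel `(x - c)⁻¹ / (‖x - c‖^(n-2) ‖x - c'‖^(n-2))`. -/
def kern {d : ℕ} (c c' x : E d) : Cl d :=
  (‖x - c‖ ^ d * ‖x - c'‖ ^ d)⁻¹ • vec (vecInv (x - c))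

theorem hasFDerivAt_norm_sub {d : ℕ} {c x : E d} (h : x ≠ c) :
    HasFDerivAt (fun z : E d => ‖z - c‖) (‖x - c‖⁻¹ • innerSL ℝ (x - c)) x := by
  have hn : ‖x - c‖ ≠ 0 := norm_ne_zero_iff.2 (sub_ne_zero.2 h)
  have h1 : HasFDerivAt (fun z : E d => ‖z - c‖ ^ 2) (2 • (innerSL ℝ (x - c))) x := by
    have := ((hasFDerivAt_id x).sub_const c).norm_sq
    simpa using this
  have h2 := h1.sqrt (pow_ne_zero 2 hn)
  have h3 : (fun z : E d => √(‖z - c‖ ^ 2)) = fun z => ‖z - c‖ :=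
    funext fun z => Real.sqrt_sq (norm_nonneg _)
  rw [h3] at h2
  refine h2.congr_fderiv ?_
  rw [Real.sqrt_sq (norm_nonneg _)]
  ext w
  simp
  field_simp

theorem kern_eq {d : ℕ} (c c' x : E d) :
    kern c c' x = -((‖x - c‖ ^ (d + 2) * ‖x - c'‖ ^ d)⁻¹ • vec (x - c)) := by
  rw [kern, vec_vecInv, smul_neg, smul_smul, ← mul_inv, pow_add]
  congr 3
  ring

theorem sum_stdVec_smul {d : ℕ} (ℓ : E d →L[ℝ] ℝ) (w : E d) (h : ∀ z, ℓ z = ⟪w, z⟫) :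
    ∑ i, ℓ (stdVec i) • vec (stdVec i : E d) = vec w := by
  have hw : vec w = ∑ i, w i • vec (stdVec i : E d) := by
    conv_lhs => rw [← coord_sum w]
    rw [← vecL_apply, map_sum]
    simp [vecL_apply]
  rw [hw]
  refine Finset.sum_congr rfl fun i _ => ?_
  rw [h, real_inner_comm, inner_stdVec]

theorem sum_stdVec_mul_self (d : ℕ) :
    ∑ i, vec (stdVec i : E d) * vec (stdVec i) = -((d + 2 : ℝ) • (1 : Cl d)) := by
  simp only [vec_mul_self, norm_stdVec]
  rw [Finset.sum_const, Finset.card_univ, Fintype.card_fin, one_pow, one_smul, smul_neg,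
    ← Nat.cast_smul_eq_nsmul ℝ]
  push_cast
  rfl

theorem differentiableAt_kern {d : ℕ} {c c' x : E d} (h : x ≠ c) (h' : x ≠ c') :
    DifferentiableAt ℝ (kern c c') x := by
  have hn : ‖x - c‖ ≠ 0 := norm_ne_zero_iff.2 (sub_ne_zero.2 h)
  have hn' : ‖x - c'‖ ≠ 0 := norm_ne_zero_iff.2 (sub_ne_zero.2 h')
  have h1 := (hasFDerivAt_norm_sub h).differentiableAt
  have h2 := (hasFDerivAt_norm_sub h').differentiableAt
  have e : kern c c' = fun x => -((‖x - c‖ ^ (d + 2) * ‖x - c'‖ ^ d)⁻¹ • vecL d (x - c)) :=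
    funext fun z => kern_eq c c' z
  rw [e]
  have h3 : DifferentiableAt ℝ (fun z => (‖z - c‖ ^ (d + 2) * ‖z - c'‖ ^ d)⁻¹) x :=
    ((h1.pow (d + 2)).mul (h2.pow d)).inv (mul_ne_zero (pow_ne_zero _ hn) (pow_ne_zero _ hn'))
  have h4 : DifferentiableAt ℝ (fun z => vecL d (z - c)) x := by fun_prop
  exact (h3.fun_smul h4).fun_neg

/-- Without the factor `‖x - c'‖ ^ d` this is the Cauchy kernel, which the right Dirac operator
annihilates: the radial term cancels `∑ e_i² = -(d + 2)`. What is left is the gradient of `‖x - c'‖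
^ (-d)`. -/
theorem rightDirac_kern {d : ℕ} {c c' x : E d} (h : x ≠ c) (h' : x ≠ c') :
    rightDirac (kern c c') x = ((d : ℝ) * (‖x - c‖ ^ d * ‖x - c'‖ ^ d)⁻¹) •
      (vec (vecInv (x - c)) * vec (vecInv (x - c'))) := by
  have hn : ‖x - c‖ ≠ 0 := norm_ne_zero_iff.2 (sub_ne_zero.2 h)
  have hn' : ‖x - c'‖ ≠ 0 := norm_ne_zero_iff.2 (sub_ne_zero.2 h')
  have h1 := (hasFDerivAt_norm_sub h).pow (d + 2)
  have h2 := (hasFDerivAt_norm_sub h').pow d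
  have hne : (‖x - c‖ ^ (d + 2) * ‖x - c'‖ ^ d) ≠ 0 :=
    mul_ne_zero (pow_ne_zero _ hn) (pow_ne_zero _ hn')
  have h4 := ((hasDerivAt_inv hne).comp_hasFDerivAt x (h1.mul h2)).neg
  let θ : E d → ℝ := fun z => -(‖z - c‖ ^ (d + 2) * ‖z - c'‖ ^ d)⁻¹
  have h4' : HasFDerivAt θ _ x := h4
  have h5 : HasFDerivAt (fun z => vec (z - c)) (vecL d) x :=
    (vecL d).hasFDerivAt.comp x ((hasFDerivAt_id x).sub_const c)
  have e : kern c c' = fun z => θ z • vec (z - c) :=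
    funext fun z => by rw [kern_eq, neg_smul]
  have hgrad : gradVec θ x =
      vec (((d + 2 : ℝ) * (‖x - c‖ ^ (d + 4) * ‖x - c'‖ ^ d)⁻¹) • (x - c) +
        ((d : ℝ) * (‖x - c‖ ^ (d + 2) * ‖x - c'‖ ^ (d + 2))⁻¹) • (x - c')) := by
    refine sum_stdVec_smul _ _ fun w => ?_
    rw [h4'.fderiv, inner_add_left, real_inner_smul_left, real_inner_smul_left]
    simp only [neg_apply, smul_apply, add_apply, smul_eq_mul, innerSL_apply_apply, nsmul_eq_mul]
    -- The derivative of the power contains the truncated exponent `d - 1`, so `d = 0` is treated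
    -- apart.
    rcases Nat.eq_zero_or_pos d with rfl | hd
    · simp
      field_simp
    · obtain ⟨k, rfl⟩ := Nat.exists_eq_succ_of_ne_zero hd.ne'
      simp only [Nat.succ_eq_add_one, Nat.add_sub_cancel]
      rw [show k + 1 + 2 - 1 = k + 2 by omega]
      push_cast
      field_simp
      ring
  have hdir : rightDirac (fun z => vec (z - c)) x = -((d + 2 : ℝ) • (1 : Cl d)) := by
    rw [rightDirac, h5.fderiv]
    exact sum_stdVec_mul_self d
  rw [e, rightDirac_smul h4'.differentiableAt h5.differentiableAt, hgrad, hdir, vec_add, vec_smul,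
    vec_smul, mul_add, mul_smul_comm, mul_smul_comm, vec_mul_self, vec_vecInv, vec_vecInv,
    neg_mul_neg, smul_mul_assoc, mul_smul_comm]
  simp only [θ, smul_neg, smul_smul]
  have e1 : (d + 2 : ℝ) * (‖x - c‖ ^ (d + 4) * ‖x - c'‖ ^ d)⁻¹ * ‖x - c‖ ^ 2 =
      (‖x - c‖ ^ (d + 2) * ‖x - c'‖ ^ d)⁻¹ * (d + 2) := by
    field_simp
    ring
  have e2 : (d : ℝ) * (‖x - c‖ ^ d * ‖x - c'‖ ^ d)⁻¹ * ((‖x - c‖ ^ 2)⁻¹ * (‖x - c'‖ ^ 2)⁻¹) =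
      (d : ℝ) * (‖x - c‖ ^ (d + 2) * ‖x - c'‖ ^ (d + 2))⁻¹ := by
    field_simp
    ring
  rw [e1, e2]
  module

/-! ### The quotient of the half-space -/

section Quotient

variable {d m : ℕ} {hm : 1 < m}

theorem continuous_lastCoord : Continuous (lastCoord : E d → ℝ) := by
  unfold lastCoord
  fun_prop

theorem isOpen_upperHalf : IsOpen (upperHalf d) := isOpen_lt continuous_const continuous_lastCoord

theorem lastCoord_smul (c : ℝ) (x : E d) : lastCoord (c • x) = c * lastCoord x := rfl

theorem smul_mem_upperHalf {c : ℝ} (hc : 0 < c) {x : E d} (hx : x ∈ upperHalf d) :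
    c • x ∈ upperHalf d := by
  show 0 < lastCoord (c • x)
  rw [lastCoord_smul]
  exact mul_pos hc hx

theorem preim_eq_image (A' : Set (Splus d m hm)) :
    preim A' = Subtype.val '' ((Quotient.mk (dilationSetoid d m hm)) ⁻¹' A') := by
  ext x
  simp [preim]

theorem preim_subset (A' : Set (Splus d m hm)) : preim A' ⊆ upperHalf d := fun _ hx => hx.1

theorem preim_mono {A' B' : Set (Splus d m hm)} (h : A' ⊆ B') : preim A' ⊆ preim B' :=
  fun _ hx => ⟨hx.1, h hx.2⟩

theorem isOpen_preim {A' : Set (Splus d m hm)} (h : IsOpen A') : IsOpen (preim A') := by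
  rw [preim_eq_image]
  exact isOpen_upperHalf.isOpenMap_subtype_val _ (h.preimage continuous_quotient_mk')

theorem preim_compl (A' : Set (Splus d m hm)) : preim A'ᶜ = upperHalf d \ preim A' := by
  ext x
  constructor
  · rintro ⟨hx, h⟩
    exact ⟨hx, fun h' => h h'.2⟩
  · rintro ⟨hx, h⟩
    exact ⟨hx, fun h' => h ⟨hx, h'⟩⟩

theorem measurableSet_preim_of_isClosed {A' : Set (Splus d m hm)} (h : IsClosed A') :
    MeasurableSet (preim A') := by
  have := preim_compl A'ᶜ
  rw [compl_compl] at this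
  rw [this]
  exact isOpen_upperHalf.measurableSet.diff (isOpen_preim h.isOpen_compl).measurableSet

theorem zpow_pos_of_one_lt (hm : 1 < m) (k : ℤ) : (0 : ℝ) < (m : ℝ) ^ k :=
  zpow_pos (by exact_mod_cast zero_lt_one.trans hm) k

theorem smul_mem_preim {A' : Set (Splus d m hm)} {x : E d} (hx : x ∈ preim A') (k : ℤ) :
    (m : ℝ) ^ k • x ∈ preim A' := by
  obtain ⟨hx0, hx⟩ := hx
  refine ⟨smul_mem_upperHalf (zpow_pos_of_one_lt hm k) hx0, ?_⟩
  have : (Quotient.mk (dilationSetoid d m hm) ⟨x, hx0⟩) = Quotient.mk (dilationSetoid d m hm)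
      ⟨(m : ℝ) ^ k • x, smul_mem_upperHalf (zpow_pos_of_one_lt hm k) hx0⟩ :=
    Quotient.sound ⟨k, rfl⟩
  rwa [← this]

theorem zpow_neg_smul_zpow_smul (hm : 1 < m) (k : ℤ) (x : E d) :
    (m : ℝ) ^ (-k) • (m : ℝ) ^ k • x = x := by
  rw [smul_smul, ← zpow_add₀ (by positivity), neg_add_cancel, zpow_zero, one_smul]

theorem smul_mem_preim_iff {A' : Set (Splus d m hm)} {x : E d} (k : ℤ) :
    (m : ℝ) ^ k • x ∈ preim A' ↔ x ∈ preim A' := by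
  refine ⟨fun h => ?_, fun h => smul_mem_preim h k⟩
  have := smul_mem_preim h (-k)
  rwa [zpow_neg_smul_zpow_smul hm] at this

theorem isOpenMap_quotient_mk : IsOpenMap (Quotient.mk (dilationSetoid d m hm)) := by
  intro O hO
  rw [← isQuotientMap_quotient_mk'.isOpen_preimage]
  have hdil : ∀ k : ℤ, Continuous fun x : upperHalf d =>
      (⟨(m : ℝ) ^ k • (x : E d), smul_mem_upperHalf (zpow_pos_of_one_lt hm k) x.2⟩ :
        upperHalf d) := fun k => by fun_prop
  have : (Quotient.mk (dilationSetoid d m hm)) ⁻¹' (Quotient.mk (dilationSetoid d m hm) '' O) =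
      ⋃ k : ℤ, (fun x : upperHalf d =>
        (⟨(m : ℝ) ^ k • (x : E d), smul_mem_upperHalf (zpow_pos_of_one_lt hm k) x.2⟩ :
          upperHalf d)) ⁻¹' O := by
    ext x
    simp only [Set.mem_preimage, Set.mem_image, Set.mem_iUnion]
    constructor
    · rintro ⟨z, hz, hzx⟩
      obtain ⟨k, hk⟩ := Quotient.exact hzx.symm
      refine ⟨k, ?_⟩
      convert hz
      exact hk.symm
    · rintro ⟨k, hk⟩
      have hx : Quotient.mk (dilationSetoid d m hm) x = Quotient.mk (dilationSetoid d m hm)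
          ⟨(m : ℝ) ^ k • (x : E d), smul_mem_upperHalf (zpow_pos_of_one_lt hm k) x.2⟩ :=
        Quotient.sound ⟨k, rfl⟩
      exact ⟨_, hk, hx.symm⟩
  exact this ▸ isOpen_iUnion fun k => hO.preimage (hdil k)

/-- The hypothesis describes only `K'` near its frontier; here the frontier itself, a set taken in
the quotient, is recognized as the graph upstairs. -/
theorem isLipschitzIn_preim {K' : Set (Splus d m hm)} (hK : IsOpen K')
    (hLip : HasLipschitzBoundary K') :
    IsLipschitzIn (preim K') (preim (frontier K')) (upperHalf d) := by
  intro x hx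
  have hfr : frontier K' = closure K' \ K' := hK.frontier_eq
  by_cases h1 : x ∈ preim K'
  · refine Or.inl ⟨(isOpen_preim hK).mem_nhds h1, ?_⟩
    filter_upwards [(isOpen_preim hK).mem_nhds h1] with z hz hz'
    have := hz'.2
    rw [hfr] at this
    exact this.2 hz.2
  have hco : IsOpen (preim (closure K')ᶜ) := isOpen_preim isClosed_closure.isOpen_compl
  by_cases h2 : x ∈ preim (closure K')
  swap
  · have hx' : x ∈ preim (closure K')ᶜ := by rw [preim_compl]; exact ⟨hx, h2⟩
    refine Or.inr (Or.inl ⟨?_, ?_⟩)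
    · filter_upwards [hco.mem_nhds hx'] with z hz hz'
      exact hz.2 (subset_closure hz'.2)
    · filter_upwards [hco.mem_nhds hx'] with z hz hz'
      exact hz.2 (frontier_subset_closure hz'.2)
  have hxS : x ∈ preim (frontier K') := ⟨hx, by rw [hfr]; exact ⟨h2.2, fun h => h1 ⟨hx, h⟩⟩⟩
  obtain ⟨ν, hν, φ, C, hφ, hev⟩ := hLip x hxS
  obtain ⟨N₀, hN₀, hN₀o, hxN₀⟩ := eventually_nhds_iff.1 hev
  refine Or.inr (Or.inr ⟨N₀ ∩ upperHalf d, ν, φ, C, ⟨hxN₀, hx⟩, ?_⟩)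
  refine ⟨hN₀o.inter isOpen_upperHalf, hν, hφ, fun z hz => hN₀ z hz.1, fun z hz => ⟨?_, ?_⟩⟩
  · rintro ⟨hz0, hzS⟩
    rw [hfr] at hzS
    have hzA : z ∉ preim K' := fun h => hzS.2 h.2
    have hle : ⟪ν, z⟫ ≤ φ (hproj ν z) := not_lt.1 (mt (hN₀ z hz.1).2 hzA)
    refine le_antisymm ?_ hle
    by_contra! hlt
    -- A point strictly below the graph cannot lie over the closure: the image of `O` is open in the
    -- quotient, so it would meet `K'`, while `O` contains no point of `preim K'`.
    let O : Set (E d) := N₀ ∩ {z | ⟪ν, z⟫ < φ (hproj ν z)}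
    have hO : IsOpen O := hN₀o.inter (isOpen_lt (innerSL ℝ ν).continuous
      (hφ.continuous.comp (hproj ν).continuous))
    have himg : IsOpen (Quotient.mk (dilationSetoid d m hm) '' (Subtype.val ⁻¹' O)) :=
      isOpenMap_quotient_mk _ (hO.preimage continuous_subtype_val)
    obtain ⟨q, ⟨w, hw, rfl⟩, hq⟩ := mem_closure_iff.1 hzS.1 _ himg
      ⟨⟨z, hz0⟩, ⟨hz.1, hlt⟩, rfl⟩
    have hwA : (w : E d) ∈ preim K' := ⟨w.2, hq⟩
    exact lt_asymm ((hN₀ w hw.1).1 hwA) hw.2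
  · intro heq
    refine ⟨hz.2, ?_⟩
    rw [hfr]
    refine ⟨?_, fun h => ((hN₀ z hz.1).1 ⟨hz.2, h⟩).ne heq⟩
    by_contra hcl
    have hz' : z ∈ preim (closure K')ᶜ := ⟨hz.2, hcl⟩
    -- Moving up along `ν` from a point of the graph leads into `preim K'` at once, so the point is
    -- not exterior.
    have hlim : Filter.Tendsto (fun t : ℝ => z + t • ν) (𝓝[>] 0) (𝓝 z) := by
      have : Continuous fun t : ℝ => z + t • ν := by fun_prop
      simpa using (this.tendsto 0).mono_left nhdsWithin_le_nhds
    obtain ⟨t, ⟨ht1, ht2⟩, ht0⟩ := ((hlim.eventually ((hN₀o.mem_nhds hz.1))).and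
      (hlim.eventually (hco.mem_nhds hz')) |>.and self_mem_nhdsWithin).exists
    have ht0' : (0 : ℝ) < t := ht0
    have hin : z + t • ν ∈ preim K' := by
      refine (hN₀ _ ht1).2 ?_
      have hp : (hproj ν) (z + t • ν) = hproj ν z := by
        rw [map_add, map_smul, hproj_normal, smul_zero, add_zero]
      change φ (hproj ν (z + t • ν)) < _
      rw [hp, heq, inner_add_right, inner_smul_right, real_inner_self_eq_norm_sq, hν]
      linarith
    exact ht2.2 (subset_closure hin.2)

/-- A compact set that meets every orbit in the preimage of a compact set. -/
theorem exists_compact_transversal {L : Set (Splus d m hm)} (hL : IsCompact L)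
    (hLc : IsClosed L) :
    ∃ C : Set (E d), IsCompact C ∧ C ⊆ preim L ∧ ∀ x ∈ preim L, ∃ k : ℤ, (m : ℝ) ^ k • x ∈ C := by
  have hloc : ∀ x : upperHalf d, ∃ r : ℝ, 0 < r ∧ Metric.closedBall (x : E d) r ⊆ upperHalf d :=
    fun x => by
      obtain ⟨r, hr, h⟩ := Metric.nhds_basis_closedBall.mem_iff.1 (isOpen_upperHalf.mem_nhds x.2)
      exact ⟨r, hr, h⟩
  choose r hr hrU using hloc
  obtain ⟨t, ht⟩ := hL.elim_finite_subcover
    (fun x : upperHalf d => Quotient.mk (dilationSetoid d m hm) ''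
      (Subtype.val ⁻¹' Metric.ball (x : E d) (r x)))
    (fun x => isOpenMap_quotient_mk _ (Metric.isOpen_ball.preimage continuous_subtype_val))
    (fun q _ => by
      obtain ⟨x, rfl⟩ := Quotient.exists_rep q
      exact Set.mem_iUnion.2 ⟨x, x, Metric.mem_ball_self (hr x), rfl⟩)
  let C₀ : Set (E d) := ⋃ x ∈ t, Metric.closedBall (x : E d) (r x)
  have hC₀ : IsCompact C₀ := t.isCompact_biUnion fun x _ => isCompact_closedBall _ _
  have hC₀U : C₀ ⊆ upperHalf d := Set.iUnion₂_subset fun x _ => hrU x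
  refine ⟨C₀ \ preim Lᶜ, hC₀.diff (isOpen_preim hLc.isOpen_compl), fun x hx => ?_, fun x hx => ?_⟩
  · by_contra h
    exact hx.2 (by rw [preim_compl]; exact ⟨hC₀U hx.1, h⟩)
  · obtain ⟨hx0, hxL⟩ := hx
    obtain ⟨x', hx't, z, hz, hzx⟩ : ∃ x' ∈ t, ∃ z : upperHalf d,
        (z : E d) ∈ Metric.ball (x' : E d) (r x') ∧
          Quotient.mk (dilationSetoid d m hm) z = Quotient.mk _ ⟨x, hx0⟩ := by
      obtain ⟨x', hx', z, hz, hzx⟩ := Set.mem_iUnion₂.1 (ht hxL)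
      exact ⟨x', hx', z, hz, hzx⟩
    obtain ⟨k, hk⟩ := Quotient.exact hzx.symm
    refine ⟨k, ?_, ?_⟩
    · rw [← show (z : E d) = (m : ℝ) ^ k • x from hk]
      exact Set.mem_biUnion hx't (Metric.ball_subset_closedBall hz)
    · intro h
      exact h.2 (smul_mem_preim ⟨hx0, hxL⟩ k).2

/-- The set is invariant under the dilation and the defining inequalities are homogeneous. Where no
normal exists, both sides are the default value `0`. -/
theorem outerNormal_smul {A' : Set (Splus d m hm)} (k : ℤ) (x : E d) :
    outerNormal (preim A') ((m : ℝ) ^ k • x) = outerNormal (preim A') x := by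
  have key : ∀ (k : ℤ) (x ν : E d), IsOuterNormal (preim A') x ν →
      IsOuterNormal (preim A') ((m : ℝ) ^ k • x) ν := by
    rintro k x ν ⟨h1, h2⟩
    refine ⟨h1, fun ε hε => ?_⟩
    have hc : Filter.Tendsto (fun z : E d => (m : ℝ) ^ (-k) • z) (𝓝 ((m : ℝ) ^ k • x)) (𝓝 x) := by
      have : Continuous fun z : E d => (m : ℝ) ^ (-k) • z := by fun_prop
      have h := this.tendsto ((m : ℝ) ^ k • x)
      rwa [zpow_neg_smul_zpow_smul hm] at h
    filter_upwards [hc.eventually (h2 ε hε)] with z hz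
    rw [smul_mem_preim_iff] at hz
    have hpos := zpow_pos_of_one_lt hm k
    have e : z - (m : ℝ) ^ k • x = (m : ℝ) ^ k • ((m : ℝ) ^ (-k) • z - x) := by
      rw [smul_sub, smul_smul, ← zpow_add₀ (by positivity), add_neg_cancel, zpow_zero, one_smul]
    rw [e, inner_smul_right, norm_smul, Real.norm_of_nonneg hpos.le]
    refine ⟨fun h => ?_, fun h => ?_⟩
    · have := mul_le_mul_of_nonneg_left (hz.1 h) hpos.le
      linarith
    · have := mul_le_mul_of_nonneg_left (hz.2 h) hpos.le
      linarith
  have : IsOuterNormal (preim A') ((m : ℝ) ^ k • x) = IsOuterNormal (preim A') x := by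
    funext ν
    refine propext ⟨fun h => ?_, key k x ν⟩
    have := key (-k) _ ν h
    rwa [zpow_neg_smul_zpow_smul hm] at this
  by_cases h : ∃ ν, IsOuterNormal (preim A') x ν
  · obtain ⟨ν, hν⟩ := h
    rw [hν.outerNormal_eq, (key k x ν hν).outerNormal_eq]
  · rw [outerNormal, outerNormal, dif_neg h, dif_neg (by rwa [this])]

end Quotient

/-! ### Unfolding of surface integrals -/

section Unfolding

variable {d m : ℕ} {V : Type*} [NormedAddCommGroup V] [NormedSpace ℝ V]

/-- The dilation by `c` as a measurable equivalence. -/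
def dilation (d : ℕ) (c : ℝ) (hc : 0 < c) : E d ≃ᵐ E d :=
  (Homeomorph.smulOfNeZero c hc.ne').toMeasurableEquiv

theorem dilation_apply {c : ℝ} (hc : 0 < c) (x : E d) : dilation d c hc x = c • x := rfl

open scoped Pointwise in
theorem map_dilation_surf {c : ℝ} (hc : 0 < c) :
    (surf d).map (dilation d c hc) = ENNReal.ofReal (c ^ (d + 1))⁻¹ • surf d := by
  ext T _
  have h1 : dilation d c hc ⁻¹' T = c⁻¹ • T := by
    ext x
    rw [Set.mem_preimage, dilation_apply, Set.mem_inv_smul_set_iff₀ hc.ne']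
  rw [(dilation d c hc).map_apply, h1,
    Measure.euclideanHausdorffMeasure_smul₀ _ (inv_ne_zero hc.ne'), Measure.smul_apply]
  rw [ENNReal.smul_def, smul_eq_mul, smul_eq_mul]
  congr 1
  rw [ENNReal.ofReal, ENNReal.coe_inj]
  ext
  rw [NNReal.coe_pow, coe_nnnorm, norm_inv, Real.norm_of_nonneg hc.le, inv_pow,
    Real.coe_toNNReal _ (by positivity)]

theorem preimage_dilation {c : ℝ} (hc : 0 < c) (T : Set (E d)) :
    dilation d c hc ⁻¹' (dilation d c hc '' T) = T :=
  Set.preimage_image_eq _ (dilation d c hc).injective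

theorem setIntegral_dilation {c : ℝ} (hc : 0 < c) (g : E d → V) (T : Set (E d)) :
    ∫ x in dilation d c hc '' T, g x ∂(surf d) = ∫ x in T, c ^ (d + 1) • g (c • x) ∂(surf d) := by
  have h := setIntegral_map_equiv (μ := surf d) (dilation d c hc) g (dilation d c hc '' T)
  rw [preimage_dilation, map_dilation_surf hc, Measure.restrict_smul, integral_smul_measure,
    ENNReal.toReal_ofReal (by positivity)] at h
  rw [integral_smul]
  simp only [dilation_apply] at h
  rw [← h, smul_smul, mul_inv_cancel₀ (by positivity), one_smul]

theorem integrableOn_dilation_iff {c : ℝ} (hc : 0 < c) {g : E d → V} {T : Set (E d)} :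
    IntegrableOn g (dilation d c hc '' T) (surf d) ↔
      IntegrableOn (fun x => c ^ (d + 1) • g (c • x)) T (surf d) := by
  have h := integrableOn_map_equiv (μ := surf d) (dilation d c hc) (f := g)
    (s := dilation d c hc '' T)
  rw [preimage_dilation, map_dilation_surf hc, IntegrableOn, Measure.restrict_smul,
    integrable_smul_measure (by simp; positivity) ENNReal.ofReal_ne_top] at h
  rw [IntegrableOn, h, IntegrableOn, IntegrableOn, integrable_fun_smul_iff (by positivity)]
  rfl

theorem pairwise_disjoint_dilation (hm : 1 < m) {F : Set (E d)} (hF : IsFundamentalSet d m F)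
    (T : Set (E d)) : Pairwise (Function.onFun Disjoint fun k : ℤ =>
      dilation d ((m : ℝ) ^ k) (zpow_pos_of_one_lt hm k) '' (T ∩ F)) := by
  intro j k hjk
  rw [Function.onFun, Set.disjoint_left]
  rintro _ ⟨x, hx, rfl⟩ ⟨z, hz, hzx⟩
  rw [dilation_apply, dilation_apply] at hzx
  obtain ⟨i, -, hi⟩ := hF.2.2 x (hF.2.1 hx.2)
  have h0 : (0 : ℤ) = i := hi 0 (by simpa using hx.2)
  have h1 : j - k = i := by
    refine hi _ ?_
    have e : (m : ℝ) ^ (j - k) • x = z := by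
      rw [sub_eq_neg_add, zpow_add₀ (by positivity), ← smul_smul, ← hzx,
        zpow_neg_smul_zpow_smul hm]
    exact (congrArg (· ∈ F) e).mpr hz.2
  omega

theorem iUnion_dilation (hm : 1 < m) {F : Set (E d)} (hF : IsFundamentalSet d m F)
    {T : Set (E d)} (hT : T ⊆ upperHalf d) (hinv : ∀ x ∈ T, ∀ k : ℤ, (m : ℝ) ^ k • x ∈ T) :
    ⋃ k : ℤ, dilation d ((m : ℝ) ^ k) (zpow_pos_of_one_lt hm k) '' (T ∩ F) = T := by
  refine Set.Subset.antisymm (Set.iUnion_subset fun k => ?_) fun x hx => ?_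
  · rintro _ ⟨x, hx, rfl⟩
    exact hinv x hx.1 k
  · obtain ⟨k, hk, -⟩ := hF.2.2 x (hT hx)
    refine Set.mem_iUnion.2 ⟨-k, (m : ℝ) ^ k • x, ⟨hinv x hx k, hk⟩, ?_⟩
    rw [dilation_apply, zpow_neg_smul_zpow_smul hm]

/-- The half-shell `1 ≤ ‖x‖ < m` is a fundamental set. -/
theorem isFundamentalSet_shell (hm : 1 < m) :
    IsFundamentalSet d m {x ∈ upperHalf d | 1 ≤ ‖x‖ ∧ ‖x‖ < m} := by
  refine ⟨?_, fun x hx => hx.1, fun x hx => ?_⟩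
  · exact isOpen_upperHalf.measurableSet.inter
      ((measurableSet_le measurable_const measurable_norm).inter
        (measurableSet_lt measurable_norm measurable_const))
  · have hm1 : (1 : ℝ) < m := by exact_mod_cast hm
    have hx0 : 0 < ‖x‖ := by
      refine norm_pos_iff.2 ?_
      rintro rfl
      exact lt_irrefl (0 : ℝ) hx
    obtain ⟨j, hj1, hj2⟩ := exists_mem_Ico_zpow hx0 hm1
    have key : ∀ k : ℤ, (m : ℝ) ^ k • x ∈ {x ∈ upperHalf d | 1 ≤ ‖x‖ ∧ ‖x‖ < m} ↔
        (m : ℝ) ^ (-k) ≤ ‖x‖ ∧ ‖x‖ < (m : ℝ) ^ (-k + 1) := by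
      intro k
      have hp := zpow_pos_of_one_lt hm k
      have h1 : (m : ℝ) ^ k * (m : ℝ) ^ (-k) = 1 := by
        rw [← zpow_add₀ (by positivity), add_neg_cancel, zpow_zero]
      have h2 : (m : ℝ) ^ k * (m : ℝ) ^ (-k + 1) = m := by
        rw [← zpow_add₀ (by positivity), add_neg_cancel_left, zpow_one]
      simp only [Set.mem_ofPred_eq, smul_mem_upperHalf hp hx, true_and, norm_smul,
        Real.norm_of_nonneg hp.le]
      constructor
      · rintro ⟨ha, hb⟩
        exact ⟨le_of_mul_le_mul_left (h1 ▸ ha) hp, lt_of_mul_lt_mul_left (h2.symm ▸ hb) hp.le⟩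
      · rintro ⟨ha, hb⟩
        exact ⟨h1 ▸ mul_le_mul_of_nonneg_left ha hp.le,
          lt_of_lt_of_eq (mul_lt_mul_of_pos_left hb hp) h2⟩
    refine ⟨-j, (key _).2 (by simpa using ⟨hj1, hj2⟩), fun k hk => ?_⟩
    obtain ⟨h1, h2⟩ := (key k).1 hk
    have h3 := (zpow_lt_zpow_iff_right₀ hm1).1 (h1.trans_lt hj2)
    have h4 := (zpow_lt_zpow_iff_right₀ hm1).1 (hj1.trans_lt h2)
    omega

open scoped Pointwise in
/-- A function on a dilation invariant set is integrable if its dilates are bounded on the shell by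
the terms of a convergent series. -/
theorem integrableOn_of_dilation_bound (hm : 1 < m) {F : Set (E d)} (hF : IsFundamentalSet d m F)
    {T : Set (E d)} (hT : T ⊆ upperHalf d) (hTm : MeasurableSet T)
    (hinv : ∀ x ∈ T, ∀ k : ℤ, (m : ℝ) ^ k • x ∈ T) (hfin : surf d (T ∩ F) < ⊤) {g : E d → V}
    (hg : AEStronglyMeasurable g ((surf d).restrict T)) {b : ℤ → ℝ} (hb : Summable b)
    (hgb : ∀ k : ℤ, ∀ x ∈ T ∩ F, ‖((m : ℝ) ^ k) ^ (d + 1) • g ((m : ℝ) ^ k • x)‖ ≤ b k) :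
    IntegrableOn g T (surf d) := by
  have hTF : MeasurableSet (T ∩ F) := hTm.inter hF.1
  have hU := iUnion_dilation hm hF hT hinv
  have hi : ∀ k : ℤ, IntegrableOn g
      (dilation d ((m : ℝ) ^ k) (zpow_pos_of_one_lt hm k) '' (T ∩ F)) (surf d) := by
    intro k
    have hsub : dilation d ((m : ℝ) ^ k) (zpow_pos_of_one_lt hm k) '' (T ∩ F) ⊆ T :=
      (Set.subset_iUnion (fun k : ℤ =>
        dilation d ((m : ℝ) ^ k) (zpow_pos_of_one_lt hm k) '' (T ∩ F)) k).trans hU.subset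
    have hmeas := (dilation d ((m : ℝ) ^ k) (zpow_pos_of_one_lt hm k)).measurableSet_image.2 hTF
    have hp := zpow_pos_of_one_lt hm k
    refine IntegrableOn.of_bound ?_ (hg.mono_measure (Measure.restrict_mono hsub le_rfl))
      ((((m : ℝ) ^ k) ^ (d + 1))⁻¹ * b k) ?_
    · change surf d ((m : ℝ) ^ k • (T ∩ F)) < ⊤
      rw [Measure.euclideanHausdorffMeasure_smul₀ _ hp.ne', ENNReal.smul_def, smul_eq_mul]
      exact ENNReal.mul_lt_top ENNReal.coe_lt_top hfin
    · refine (ae_restrict_iff' hmeas).2 (Filter.Eventually.of_forall ?_)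
      rintro _ ⟨x, hx, rfl⟩
      have := hgb k x hx
      rw [norm_smul, Real.norm_of_nonneg (by positivity)] at this
      rw [dilation_apply, ← div_eq_inv_mul, le_div_iff₀' (by positivity)]
      exact this
  rw [← hU]
  refine integrableOn_iUnion_of_summable_integral_norm hi ?_
  refine Summable.of_nonneg_of_le (fun k => integral_nonneg fun x => norm_nonneg _) (fun k => ?_)
    (hb.mul_right ((surf d).real (T ∩ F)))
  rw [setIntegral_dilation]
  refine (Real.le_norm_self _).trans (norm_setIntegral_le_of_norm_le_const hfin fun x hx => ?_)
  have := hgb k x hx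
  rwa [norm_smul, ← norm_norm (g _), ← norm_smul] at this

/-- Unfolding: the integral over a dilation invariant set is the integral of the periodization over
a fundamental set. -/
theorem integral_unfold (hm : 1 < m) {F : Set (E d)} (hF : IsFundamentalSet d m F)
    {T : Set (E d)} (hT : T ⊆ upperHalf d) (hTm : MeasurableSet T)
    (hinv : ∀ x ∈ T, ∀ k : ℤ, (m : ℝ) ^ k • x ∈ T) {g : E d → V} [CompleteSpace V]
    (hg : IntegrableOn g T (surf d)) {h : E d → V}
    (hsum : ∀ x ∈ T ∩ F, HasSum (fun k : ℤ => ((m : ℝ) ^ k) ^ (d + 1) • g ((m : ℝ) ^ k • x)) (h x)) :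
    IntegrableOn h (T ∩ F) (surf d) ∧ ∫ x in T ∩ F, h x ∂(surf d) = ∫ x in T, g x ∂(surf d) := by
  have hTF : MeasurableSet (T ∩ F) := hTm.inter hF.1
  have hU := iUnion_dilation hm hF hT hinv
  have hmeas : ∀ k : ℤ, MeasurableSet
      (dilation d ((m : ℝ) ^ k) (zpow_pos_of_one_lt hm k) '' (T ∩ F)) := fun k =>
    (dilation d ((m : ℝ) ^ k) (zpow_pos_of_one_lt hm k)).measurableSet_image.2 hTF
  have hg' := hg
  rw [← hU] at hg'
  have hk : ∀ k : ℤ, IntegrableOn (fun x => ((m : ℝ) ^ k) ^ (d + 1) • g ((m : ℝ) ^ k • x)) (T ∩ F)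
      (surf d) := fun k => (integrableOn_dilation_iff _).1 (hg'.mono_set (Set.subset_iUnion
        (fun k : ℤ => dilation d ((m : ℝ) ^ k) (zpow_pos_of_one_lt hm k) '' (T ∩ F)) k))
  -- Integrability over the disjoint union of the dilates is summability of the `L¹` norms, which
  -- justifies the exchange of sum and integral.
  have hn : Summable fun k : ℤ =>
      ∫ x in T ∩ F, ‖((m : ℝ) ^ k) ^ (d + 1) • g ((m : ℝ) ^ k • x)‖ ∂(surf d) := by
    have := (hasSum_integral_iUnion hmeas (pairwise_disjoint_dilation hm hF T) hg'.norm).summable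
    refine this.congr fun k => ?_
    rw [setIntegral_dilation]
    refine integral_congr_ae (Filter.Eventually.of_forall fun x => ?_)
    simp only [norm_smul, smul_eq_mul]
    rw [Real.norm_of_nonneg (by have := zpow_pos_of_one_lt hm k; positivity)]
  have e0 : Set.EqOn h (fun x => ∑' k : ℤ, ((m : ℝ) ^ k) ^ (d + 1) • g ((m : ℝ) ^ k • x)) (T ∩ F) :=
    fun x hx => (hsum x hx).tsum_eq.symm
  constructor
  · refine ⟨?_, ?_⟩
    · refine aestronglyMeasurable_of_tendsto_ae (Filter.atTop : Filter (Finset ℤ))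
        (f := fun t x => ∑ k ∈ t, ((m : ℝ) ^ k) ^ (d + 1) • g ((m : ℝ) ^ k • x))
        (fun t => Finset.aestronglyMeasurable_fun_sum t fun k _ => (hk k).1) ?_
      exact (ae_restrict_iff' hTF).2 (Filter.Eventually.of_forall fun x hx => hsum x hx)
    · calc ∫⁻ x in T ∩ F, ‖h x‖ₑ ∂(surf d)
          ≤ ∫⁻ x in T ∩ F, ∑' k : ℤ, ‖((m : ℝ) ^ k) ^ (d + 1) • g ((m : ℝ) ^ k • x)‖ₑ
              ∂(surf d) :=
            setLIntegral_mono' hTF fun x hx => by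
              rw [e0 hx]
              exact enorm_tsum_le_tsum_enorm
        _ = ∑' k : ℤ, ENNReal.ofReal (∫ x in T ∩ F,
              ‖((m : ℝ) ^ k) ^ (d + 1) • g ((m : ℝ) ^ k • x)‖ ∂(surf d)) := by
            rw [lintegral_tsum fun k => (hk k).1.enorm]
            exact tsum_congr fun k => (ofReal_integral_norm_eq_lintegral_enorm (hk k)).symm
        _ < ⊤ := hn.tsum_ofReal_lt_top
  · rw [setIntegral_congr_fun hTF e0, ← (hasSum_integral_of_summable_integral_norm hk hn).tsum_eq]
    conv_rhs => rw [← hU]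
    rw [integral_iUnion hmeas (pairwise_disjoint_dilation hm hF T) hg']
    exact tsum_congr fun k => (setIntegral_dilation _ _ _).symm

end Unfolding

/-! ### Bounds for the kernels -/

section Bounds

variable {d m : ℕ}

/-- The size of the `k`-th term of the periodized kernels. -/
def growth (d m : ℕ) (s : ℝ) (k : ℤ) : ℝ :=
  (m : ℝ) ^ ((k : ℝ) * s) * ((1 + (m : ℝ) ^ k) ^ (2 * d + 1))⁻¹

theorem growth_nonneg (d m : ℕ) (s : ℝ) (k : ℤ) : 0 ≤ growth d m s k := by
  unfold growth
  positivity

/-- Geometric in both directions: the ratio is `m^(s - (2d + 1))` for `k → ∞` and `m^(-s)` for `k →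
-∞`. Both bounds on `s` enter here; `2d + 1 = 2n - 3`. -/
theorem summable_growth (hm : 1 < m) {s : ℝ} (hs₀ : 0 < s) (hs₁ : s < 2 * (d : ℝ) + 1) :
    Summable (growth d m s) := by
  have hm1 : (1 : ℝ) < m := by exact_mod_cast hm
  have hm0 : (0 : ℝ) < m := zero_lt_one.trans hm1
  refine Summable.of_nat_of_neg ?_ ?_
  · have hg : Summable fun n : ℕ => ((m : ℝ) ^ (s - (2 * d + 1))) ^ n :=
      summable_geometric_of_lt_one (by positivity)
        (Real.rpow_lt_one_of_one_lt_of_neg hm1 (by linarith))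
    refine hg.of_nonneg_of_le (fun n => growth_nonneg _ _ _ _) fun n => ?_
    have e : ((m : ℝ) ^ (s - (2 * d + 1))) ^ n =
        (m : ℝ) ^ ((n : ℝ) * s) * (((m : ℝ) ^ n) ^ (2 * d + 1))⁻¹ := by
      rw [← Real.rpow_natCast, ← Real.rpow_natCast, ← Real.rpow_natCast, ← Real.rpow_mul hm0.le,
        ← Real.rpow_mul hm0.le, ← Real.rpow_neg hm0.le, ← Real.rpow_add hm0]
      congr 1
      push_cast
      ring
    rw [e, growth, zpow_natCast, Int.cast_natCast]
    gcongr
    linarith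
  · have hg : Summable fun n : ℕ => ((m : ℝ) ^ (-s)) ^ n :=
      summable_geometric_of_lt_one (by positivity)
        (Real.rpow_lt_one_of_one_lt_of_neg hm1 (by linarith))
    refine hg.of_nonneg_of_le (fun n => growth_nonneg _ _ _ _) fun n => ?_
    have e : ((m : ℝ) ^ (-s)) ^ n = (m : ℝ) ^ (((-(n : ℤ) : ℤ) : ℝ) * s) := by
      rw [← Real.rpow_natCast, ← Real.rpow_mul hm0.le]
      congr 1
      push_cast
      ring
    rw [e, growth]
    refine mul_le_of_le_one_right (by positivity) (inv_le_one_of_one_le₀ (one_le_pow₀ ?_))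
    have := zpow_pos_of_one_lt hm (-(n : ℤ))
    linarith

/-- The scaling of surface measure times the automorphy factor of the section is the weight of the
periodization. -/
theorem zpow_pow_mul_rpow (hm : 1 < m) (s : ℝ) (k : ℤ) :
    ((m : ℝ) ^ k) ^ (d + 1) * (m : ℝ) ^ (-((k : ℝ) * ((d : ℝ) + 1 - s))) =
      (m : ℝ) ^ ((k : ℝ) * s) := by
  have hm0 : (0 : ℝ) < m := by exact_mod_cast zero_lt_one.trans hm
  rw [← Real.rpow_intCast, ← Real.rpow_natCast, ← Real.rpow_mul hm0.le, ← Real.rpow_add hm0]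
  congr 1
  push_cast
  ring

theorem norm_sub_le_norm_sub_starVec {x y : E d} (hx : x ∈ upperHalf d) (hy : y ∈ upperHalf d) :
    ‖x - y‖ ≤ ‖x - starVec d y‖ := by
  refine le_of_sq_le_sq ?_ (norm_nonneg _)
  rw [norm_sub_sq_real, norm_sub_sq_real, LinearIsometryEquiv.norm_map, starVec_apply,
    inner_sub_right, inner_smul_right, real_inner_comm (lastVec d) x]
  have h : ⟪lastVec d, x⟫ = lastCoord x := inner_stdVec _ _
  rw [h]
  have h1 : 0 < lastCoord x := hx
  have h2 : 0 < lastCoord y := hy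
  nlinarith [mul_pos h1 h2]

theorem norm_vecInv (x : E d) : ‖vecInv x‖ = ‖x‖⁻¹ := by
  rw [vecInv, norm_neg, norm_smul, norm_inv, norm_pow, norm_norm]
  rcases eq_or_ne ‖x‖ 0 with h | h
  · simp [h]
  · field_simp

theorem norm_kern_le (c c' x : E d) :
    ‖kern c c' x‖ ≤ ‖vecL d‖ * ((‖x - c‖ ^ d * ‖x - c'‖ ^ d)⁻¹ * ‖x - c‖⁻¹) := by
  rw [kern, norm_smul, Real.norm_of_nonneg (by positivity), mul_left_comm]
  gcongr
  rw [← norm_vecInv]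
  exact (vecL d).le_opNorm _

theorem norm_kern_le_of_le {c c' x : E d} {t : ℝ} (ht : 0 < t) (h : t ≤ ‖x - c‖)
    (h' : t ≤ ‖x - c'‖) : ‖kern c c' x‖ ≤ ‖vecL d‖ * (t ^ (2 * d + 1))⁻¹ := by
  refine (norm_kern_le c c' x).trans ?_
  rw [show t ^ (2 * d + 1) = t ^ d * t ^ d * t by ring, mul_inv _ t]
  gcongr

theorem exists_kern_bound {y : E d} (hy : y ∈ upperHalf d) {ε : ℝ} (hε : 0 < ε) :
    ∃ M : ℝ, 0 ≤ M ∧ ∀ x ∈ upperHalf d, ε ≤ ‖x - y‖ →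
      ‖kern y (starVec d y) x‖ ≤ M * ((1 + ‖x‖) ^ (2 * d + 1))⁻¹ ∧
      ‖kern (starVec d y) y x‖ ≤ M * ((1 + ‖x‖) ^ (2 * d + 1))⁻¹ := by
  -- From `1 + ‖x‖ ≤ ‖x - y‖ + (1 + ‖y‖)` and `1 ≤ ‖x - y‖ / ε`. The same lower bound `δ (1 + ‖x‖)`
  -- holds for the distance to `y^*`, which is farther away.
  set δ : ℝ := (1 + (1 + ‖y‖) / ε)⁻¹ with hδ
  have hδ0 : 0 < δ := by positivity
  refine ⟨‖vecL d‖ * (δ ^ (2 * d + 1))⁻¹, by positivity, fun x hx hxy => ?_⟩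
  have h1 : δ * (1 + ‖x‖) ≤ ‖x - y‖ := by
    rw [hδ, inv_mul_le_iff₀ (by positivity)]
    have h2 : ‖x‖ ≤ ‖x - y‖ + ‖y‖ := norm_le_norm_sub_add x y
    have h3 : 1 + ‖y‖ ≤ (1 + ‖y‖) / ε * ‖x - y‖ := by
      rw [div_mul_eq_mul_div, le_div_iff₀ hε]
      gcongr
    linarith
  have h2 := h1.trans (norm_sub_le_norm_sub_starVec hx hy)
  have e : ‖vecL d‖ * (δ ^ (2 * d + 1))⁻¹ * ((1 + ‖x‖) ^ (2 * d + 1))⁻¹ =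
      ‖vecL d‖ * ((δ * (1 + ‖x‖)) ^ (2 * d + 1))⁻¹ := by
    rw [mul_pow, mul_inv, mul_assoc]
  rw [e]
  exact ⟨norm_kern_le_of_le (by positivity) h1 h2, norm_kern_le_of_le (by positivity) h2 h1⟩

theorem continuousOn_kern (c c' : E d) : ContinuousOn (kern c c') {x | x ≠ c ∧ x ≠ c'} :=
  fun _ hx => (differentiableAt_kern hx.1 hx.2).continuousAt.continuousWithinAt

theorem ne_starVec {x y : E d} (hx : x ∈ upperHalf d) (hy : y ∈ upperHalf d) :
    x ≠ starVec d y := by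
  rintro rfl
  have h1 : 0 < lastCoord (starVec d y) := hx
  rw [lastCoord_starVec] at h1
  have h2 : 0 < lastCoord y := hy
  linarith

/-- The part of the preimage of a compact set in an annulus is compact. -/
theorem isCompact_preim_inter_annulus {hm : 1 < m} {L : Set (Splus d m hm)} (hL : IsCompact L)
    (hLc : IsClosed L) {a : ℝ} (ha : 0 < a) (b : ℝ) :
    IsCompact (preim L ∩ {x | a ≤ ‖x‖ ∧ ‖x‖ ≤ b}) := by
  have hm1 : (1 : ℝ) < m := by exact_mod_cast hm
  obtain ⟨C, hC, hCL, hCx⟩ := exists_compact_transversal hL hLc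
  have hC0 : ∀ x ∈ C, ‖x‖ ≠ 0 := by
    intro x hx h0
    have := preim_subset L (hCL hx)
    rw [norm_eq_zero.1 h0] at this
    exact lt_irrefl (0 : ℝ) this
  -- The norms on the transversal `C` are bounded above and away from zero, so only finitely many of
  -- its dilates reach the annulus.
  obtain ⟨R, hR⟩ := hC.exists_bound_of_continuousOn (f := fun x : E d => ‖x‖)
    continuous_norm.continuousOn
  obtain ⟨R', hR'⟩ := hC.exists_bound_of_continuousOn (f := fun x : E d => ‖x‖⁻¹)
    (continuous_norm.continuousOn.inv₀ hC0)
  obtain ⟨N, hN⟩ := pow_unbounded_of_one_lt (max (R / a) (R' * b)) hm1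
  have e : preim L ∩ {x | a ≤ ‖x‖ ∧ ‖x‖ ≤ b} =
      (⋃ k ∈ Finset.Icc (-(N : ℤ)) N, (fun x : E d => (m : ℝ) ^ k • x) '' C) ∩
        {x | a ≤ ‖x‖ ∧ ‖x‖ ≤ b} := by
    ext x
    refine ⟨fun ⟨hx, hx'⟩ => ⟨?_, hx'⟩, fun ⟨hx, hx'⟩ => ⟨?_, hx'⟩⟩
    · obtain ⟨k, hk⟩ := hCx x hx
      have hp := zpow_pos_of_one_lt hm k
      have hx0 : 0 < ‖x‖ := ha.trans_le hx'.1
      have h1 := hR _ hk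
      have h2 := hR' _ hk
      rw [norm_norm, norm_smul, Real.norm_of_nonneg hp.le] at h1
      rw [norm_inv, norm_norm, norm_smul, Real.norm_of_nonneg hp.le] at h2
      have h3 : (m : ℝ) ^ k < (m : ℝ) ^ (N : ℤ) := by
        rw [zpow_natCast]
        refine lt_of_le_of_lt ?_ ((le_max_left _ _).trans_lt hN)
        rw [le_div_iff₀ ha]
        exact (mul_le_mul_of_nonneg_left hx'.1 hp.le).trans h1
      have h4 : (m : ℝ) ^ (-k) < (m : ℝ) ^ (N : ℤ) := by
        rw [zpow_natCast, zpow_neg]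
        refine lt_of_le_of_lt ?_ ((le_max_right _ _).trans_lt hN)
        rw [mul_inv, ← div_eq_mul_inv, div_le_iff₀ hx0] at h2
        have hR0 : 0 ≤ R' := by
          by_contra! hneg
          have : R' * ‖x‖ < 0 := mul_neg_of_neg_of_pos hneg hx0
          have : (0 : ℝ) < ((m : ℝ) ^ k)⁻¹ := inv_pos.2 hp
          linarith
        exact h2.trans (mul_le_mul_of_nonneg_left hx'.2 hR0)
      have h5 := (zpow_lt_zpow_iff_right₀ hm1).1 h3
      have h6 := (zpow_lt_zpow_iff_right₀ hm1).1 h4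
      refine Set.mem_biUnion (x := -k) (Finset.mem_coe.2 (Finset.mem_Icc.2 ⟨by omega, by omega⟩))
        ⟨_, hk, zpow_neg_smul_zpow_smul hm k x⟩
    · obtain ⟨k, -, z, hz, rfl⟩ := Set.mem_iUnion₂.1 hx
      exact smul_mem_preim (hCL hz) k
  rw [e]
  refine IsCompact.inter_right ?_ ?_
  · exact (Finset.Icc (-(N : ℤ)) N).isCompact_biUnion fun k _ =>
      hC.image (continuous_const_smul _)
  · exact (isClosed_le continuous_const continuous_norm).inter
      (isClosed_le continuous_norm continuous_const)

/-- The dilates of a kernel times a section. -/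
theorem norm_kern_mul_section_le (hm : 1 < m) {s M M' M'' : ℝ} {κ κ' a a' : Cl d} {z : E d} {k : ℤ}
    (hM : 0 ≤ M) (hz : 1 ≤ ‖z‖)
    (hκ : ‖κ‖ ≤ M * ((1 + ‖(m : ℝ) ^ k • z‖) ^ (2 * d + 1))⁻¹)
    (ha : a' = (m : ℝ) ^ (-((k : ℝ) * ((d : ℝ) + 1 - s))) • a) (haM : ‖a‖ ≤ M')
    (hκ' : ‖κ'‖ ≤ M'') :
    ((m : ℝ) ^ k) ^ (d + 1) * ‖κ * κ' * a'‖ ≤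
      ‖mulB d‖ * ‖mulB d‖ * M'' * M * M' * growth d m s k := by
  have hp := zpow_pos_of_one_lt hm k
  have hκ2 : ‖κ‖ ≤ M * ((1 + (m : ℝ) ^ k) ^ (2 * d + 1))⁻¹ := by
    refine hκ.trans ?_
    gcongr
    rw [norm_smul, Real.norm_of_nonneg hp.le]
    exact le_mul_of_one_le_right hp.le hz
  have hM'' : 0 ≤ M'' := (norm_nonneg _).trans hκ'
  have h1 : ‖κ * κ' * a'‖ ≤ ‖mulB d‖ * (‖mulB d‖ * (M * ((1 + (m : ℝ) ^ k) ^ (2 * d + 1))⁻¹) *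
      M'') * ((m : ℝ) ^ (-((k : ℝ) * ((d : ℝ) + 1 - s))) * M') := by
    refine (norm_mul_le_mulB _ _).trans ?_
    gcongr
    · refine (norm_mul_le_mulB _ _).trans ?_
      gcongr
    · rw [ha, norm_smul, Real.norm_of_nonneg (by positivity)]
      gcongr
  refine (mul_le_mul_of_nonneg_left h1 (by positivity)).trans (le_of_eq ?_)
  rw [growth, ← zpow_pow_mul_rpow (d := d) hm s k]
  ring

theorem summable_dilates (hm : 1 < m) {s : ℝ} (hs₀ : 0 < s) (hs₁ : s < 2 * (d : ℝ) + 1)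
    {κ : E d → Cl d} {x : E d} (hx : x ∈ upperHalf d) {M : ℝ} (hM : 0 ≤ M)
    (hκ : ∀ k : ℤ, ‖κ ((m : ℝ) ^ k • x)‖ ≤ M * ((1 + ‖(m : ℝ) ^ k • x‖) ^ (2 * d + 1))⁻¹) :
    Summable fun k : ℤ => (m : ℝ) ^ ((k : ℝ) * s) • κ ((m : ℝ) ^ k • x) := by
  have hx0 : 0 < ‖x‖ := by
    refine norm_pos_iff.2 ?_
    rintro rfl
    exact lt_irrefl (0 : ℝ) hx
  -- Chosen so that `c (1 + m^k) ≤ 1 + m^k ‖x‖`, which reduces the bound to `growth` for this fixed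
  -- `x`.
  set c := min 1 ‖x‖
  have hc : 0 < c := lt_min one_pos hx0
  refine Summable.of_norm_bounded (g := fun k => M * (c ^ (2 * d + 1))⁻¹ * growth d m s k)
    ((summable_growth hm hs₀ hs₁).mul_left _) fun k => ?_
  have hp := zpow_pos_of_one_lt hm k
  rw [norm_smul, Real.norm_of_nonneg (by positivity)]
  have h1 : c * (1 + (m : ℝ) ^ k) ≤ 1 + ‖(m : ℝ) ^ k • x‖ := by
    rw [norm_smul, Real.norm_of_nonneg hp.le, mul_add, mul_one, mul_comm c]
    exact add_le_add (min_le_left _ _) (mul_le_mul_of_nonneg_left (min_le_right _ _) hp.le)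
  calc (m : ℝ) ^ ((k : ℝ) * s) * ‖κ ((m : ℝ) ^ k • x)‖
      ≤ (m : ℝ) ^ ((k : ℝ) * s) * (M * ((c * (1 + (m : ℝ) ^ k)) ^ (2 * d + 1))⁻¹) := by
        gcongr
        refine (hκ k).trans ?_
        gcongr
    _ = M * (c ^ (2 * d + 1))⁻¹ * growth d m s k := by
        rw [growth, mul_pow, mul_inv]
        ring

/-- A kernel on the half-space with its only singularity at `y` and the decay of `p₁`. -/
structure IsDecayingKernel (y : E d) (κ : E d → Cl d) : Prop where
  continuousOn : ContinuousOn κ (upperHalf d \ {y})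
  bound : ∀ ε > 0, ∃ M : ℝ, 0 ≤ M ∧ ∀ x ∈ upperHalf d, ε ≤ ‖x - y‖ →
    ‖κ x‖ ≤ M * ((1 + ‖x‖) ^ (2 * d + 1))⁻¹

theorem isDecayingKernel_kern {y : E d} (hy : y ∈ upperHalf d) :
    IsDecayingKernel y (kern y (starVec d y)) where
  continuousOn := (continuousOn_kern _ _).mono fun _ hx => ⟨hx.2, ne_starVec hx.1 hy⟩
  bound _ hε :=
    let ⟨M, hM, h⟩ := exists_kern_bound hy hε
    ⟨M, hM, fun x hx hxy => (h x hx hxy).1⟩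

theorem isDecayingKernel_kern_starVec {y : E d} (hy : y ∈ upperHalf d) :
    IsDecayingKernel y (kern (starVec d y) y) where
  continuousOn := (continuousOn_kern _ _).mono fun _ hx => ⟨ne_starVec hx.1 hy, hx.2⟩
  bound _ hε :=
    let ⟨M, hM, h⟩ := exists_kern_bound hy hε
    ⟨M, hM, fun x hx hxy => (h x hx hxy).2⟩

end Bounds

/-! ### Integrals over the boundary -/

/-- A section over a neighbourhood of the closure of a relatively compact Lipschitz domain. -/
structure IsSectionOnDomain {d m : ℕ} {hm : 1 < m} (s : ℝ) (U' K' : Set (Splus d m hm))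
    (f : E d → Cl d) : Prop where
  pos : 0 < s
  lt : s < 2 * (d : ℝ) + 1
  isOpen_nhd : IsOpen U'
  isOpen : IsOpen K'
  isCompact : IsCompact (closure K')
  subset : closure K' ⊆ U'
  lipschitz : HasLipschitzBoundary K'
  isSection : IsHypermonogenicSection ((d : ℝ) + 1 - s) U' f

namespace IsSectionOnDomain

variable {d m : ℕ} {hm : 1 < m} {s : ℝ} {U' K' : Set (Splus d m hm)} {f : E d → Cl d} {y : E d}

theorem continuousOn (h : IsSectionOnDomain s U' K' f) : ContinuousOn f (preim U') :=
  fun x hx => (h.isSection.2.1 x hx).continuousAt.continuousWithinAt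

theorem preim_closure_subset (h : IsSectionOnDomain s U' K' f) : preim (closure K') ⊆ preim U' :=
  preim_mono h.subset

theorem preim_frontier_subset (h : IsSectionOnDomain s U' K' f) :
    preim (frontier K') ⊆ preim U' :=
  preim_mono (frontier_subset_closure.trans h.subset)

theorem measurableSet_bdry (K' : Set (Splus d m hm)) : MeasurableSet (preim (frontier K')) :=
  measurableSet_preim_of_isClosed isClosed_frontier

theorem le_norm_sub (h : IsSectionOnDomain s U' K' f) {ε : ℝ}
    (hε : Metric.closedBall y ε ⊆ preim K') {x : E d} (hx : x ∈ preim (frontier K')) :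
    ε ≤ ‖x - y‖ := by
  by_contra! hlt
  have h1 : x ∈ preim K' := hε (by rw [Metric.mem_closedBall, dist_eq_norm]; exact hlt.le)
  have := hx.2
  rw [h.isOpen.frontier_eq] at this
  exact this.2 h1.2

theorem exists_closedBall_subset (h : IsSectionOnDomain s U' K' f) (hy : y ∈ preim K') :
    ∃ ε > 0, Metric.closedBall y ε ⊆ preim K' :=
  Metric.nhds_basis_closedBall.mem_iff.1 ((isOpen_preim h.isOpen).mem_nhds hy)

theorem exists_bound (h : IsSectionOnDomain s U' K' f) (b : ℝ) :
    ∃ M, ∀ z ∈ preim (closure K'), 1 ≤ ‖z‖ → ‖z‖ ≤ b → ‖f z‖ ≤ M := by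
  obtain ⟨M, hM⟩ := (isCompact_preim_inter_annulus h.isCompact isClosed_closure one_pos
    b).exists_bound_of_continuousOn (h.continuousOn.mono
      (Set.inter_subset_left.trans h.preim_closure_subset))
  exact ⟨M, fun z hz h1 h2 => hM z ⟨hz, h1, h2⟩⟩

theorem surf_shell_lt_top (h : IsSectionOnDomain s U' K' f) :
    surf d (preim (frontier K') ∩ {x ∈ upperHalf d | 1 ≤ ‖x‖ ∧ ‖x‖ < m}) < ⊤ := by
  refine (measure_mono ?_).trans_lt ((isLipschitzIn_preim h.isOpen h.lipschitz).surf_inter_lt_top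
    (isCompact_preim_inter_annulus h.isCompact isClosed_closure one_pos m)
    (Set.inter_subset_left.trans (preim_subset _)))
  exact fun x hx => ⟨hx.1, preim_mono frontier_subset_closure hx.1, hx.2.2.1, hx.2.2.2.le⟩

theorem norm_vec_outerNormal_le (A : Set (E d)) (x : E d) : ‖vec (outerNormal A x)‖ ≤ ‖vecL d‖ :=
  ((vecL d).le_opNorm _).trans (mul_le_of_le_one_right (norm_nonneg _) (norm_outerNormal_le A x))

theorem aestronglyMeasurable_boundary (h : IsSectionOnDomain s U' K' f) (hy : y ∈ preim K')
    {κ : E d → Cl d} (hκ : ContinuousOn κ (upperHalf d \ {y})) :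
    AEStronglyMeasurable (fun x => κ x * vec (outerNormal (preim K') x) * f x)
      ((surf d).restrict (preim (frontier K'))) := by
  obtain ⟨ε, hε, hball⟩ := h.exists_closedBall_subset hy
  have hS := measurableSet_bdry K'
  have h1 : AEStronglyMeasurable κ ((surf d).restrict (preim (frontier K'))) := by
    refine (hκ.mono fun x hx => ⟨preim_subset _ hx, ?_⟩).aestronglyMeasurable hS
    rintro rfl
    have := h.le_norm_sub hball hx
    simp at this
    linarith
  have h2 := (isLipschitzIn_preim h.isOpen h.lipschitz).aestronglyMeasurable_outerNormal hS
    (preim_subset _)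
  have h3 : AEStronglyMeasurable f ((surf d).restrict (preim (frontier K'))) :=
    (h.continuousOn.mono h.preim_frontier_subset).aestronglyMeasurable hS
  exact (h1.mul (continuous_vec.comp_aestronglyMeasurable h2)).mul h3

/-- The boundary accumulates at the origin and at infinity. On the shell `1 ≤ ‖x‖ < m` it has finite
area and `f` is bounded, and the transformation law of `f` transports the bound to all other shells
with the summable factor `growth`. -/
theorem integrableOn_boundary (h : IsSectionOnDomain s U' K' f) (hy : y ∈ preim K')
    {κ : E d → Cl d} (hκ : IsDecayingKernel y κ) :
    IntegrableOn (fun x => κ x * vec (outerNormal (preim K') x) * f x) (preim (frontier K'))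
      (surf d) := by
  obtain ⟨ε, hε, hball⟩ := h.exists_closedBall_subset hy
  obtain ⟨M, hM, hκM⟩ := hκ.bound ε hε
  obtain ⟨M', hM'⟩ := h.exists_bound m
  refine integrableOn_of_dilation_bound hm (isFundamentalSet_shell hm) (preim_subset _)
    (measurableSet_bdry K') (fun x hx k => smul_mem_preim hx k) h.surf_shell_lt_top
    (h.aestronglyMeasurable_boundary hy hκ.continuousOn)
    ((summable_growth hm h.pos h.lt).mul_left (‖mulB d‖ * ‖mulB d‖ * ‖vecL d‖ * M * M'))
    fun k x hx => ?_
  have hk := smul_mem_preim hx.1 k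
  have hp := zpow_pos_of_one_lt hm k
  rw [norm_smul, Real.norm_of_nonneg (by positivity)]
  exact norm_kern_mul_section_le hm hM hx.2.2.1
    (hκM _ (preim_subset _ hk) (h.le_norm_sub hball hk))
    (h.isSection.1 x (h.preim_frontier_subset hx.1) k)
    (hM' x (preim_mono frontier_subset_closure hx.1) hx.2.2.1 hx.2.2.2.le)
    (norm_vec_outerNormal_le _ _)

theorem summable_kernel (h : IsSectionOnDomain s U' K' f) (hy : y ∈ preim K')
    {κ : E d → Cl d} (hκ : IsDecayingKernel y κ) {x : E d} (hx : x ∈ preim (frontier K')) :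
    Summable fun k : ℤ => (m : ℝ) ^ ((k : ℝ) * s) • κ ((m : ℝ) ^ k • x) := by
  obtain ⟨ε, hε, hball⟩ := h.exists_closedBall_subset hy
  obtain ⟨M, hM, hκM⟩ := hκ.bound ε hε
  exact summable_dilates hm h.pos h.lt (preim_subset _ hx) hM fun k =>
    hκM _ (preim_subset _ (smul_mem_preim hx k)) (h.le_norm_sub hball (smul_mem_preim hx k))

/-- The integral over `S'` of a periodized kernel is the integral over `p⁻¹(S')`. -/
theorem unfold_boundary (h : IsSectionOnDomain s U' K' f) (hy : y ∈ preim K')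
    {κ : E d → Cl d} (hκ : IsDecayingKernel y κ) {F : Set (E d)} (hF : IsFundamentalSet d m F) :
    IntegrableOn (fun x => (∑' k : ℤ, (m : ℝ) ^ ((k : ℝ) * s) • κ ((m : ℝ) ^ k • x)) *
        vec (outerNormal (preim K') x) * f x) (preim (frontier K') ∩ F) (surf d) ∧
      ∫ x in preim (frontier K') ∩ F, (∑' k : ℤ, (m : ℝ) ^ ((k : ℝ) * s) • κ ((m : ℝ) ^ k • x)) *
          vec (outerNormal (preim K') x) * f x ∂(surf d) =
        ∫ x in preim (frontier K'), κ x * vec (outerNormal (preim K') x) * f x ∂(surf d) := by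
  refine integral_unfold hm hF (preim_subset _) (measurableSet_bdry K')
    (fun x hx k => smul_mem_preim hx k) (h.integrableOn_boundary hy hκ) fun x hx => ?_
  have : IsTopologicalSemiring (Cl d) := {}
  have h1 := ((h.summable_kernel hy hκ hx.1).hasSum.mul_right
    (vec (outerNormal (preim K') x))).mul_right (f x)
  have e : (fun k : ℤ => ((m : ℝ) ^ k) ^ (d + 1) • (κ ((m : ℝ) ^ k • x) *
      vec (outerNormal (preim K') ((m : ℝ) ^ k • x)) * f ((m : ℝ) ^ k • x))) = fun k : ℤ =>
      (m : ℝ) ^ ((k : ℝ) * s) • κ ((m : ℝ) ^ k • x) * vec (outerNormal (preim K') x) * f x := by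
    funext k
    rw [outerNormal_smul, h.isSection.1 x (h.preim_frontier_subset hx.1) k,
      ← zpow_pow_mul_rpow (d := d) hm s k]
    simp only [smul_mul_assoc, mul_smul_comm, smul_smul]
  rw [e]
  exact h1

end IsSectionOnDomain

/-! ### Cutoff functions -/

section Cutoff

variable {d : ℕ}

/-- A smooth function that is `1` for `‖x - c‖ ≤ r` and `0` for `‖x - c‖ ≥ 2 r`. -/
def cutoff (c : E d) (r : ℝ) (x : E d) : ℝ := Real.smoothTransition (2 - ‖x - c‖ ^ 2 / r ^ 2)

theorem contDiff_cutoff (c : E d) (r : ℝ) : ContDiff ℝ 1 (cutoff c r) :=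
  smoothTransition_contDiff.comp
    (contDiff_const.sub (((contDiff_id.sub contDiff_const).norm_sq ℝ).div_const _))

theorem cutoff_nonneg (c : E d) (r : ℝ) (x : E d) : 0 ≤ cutoff c r x :=
  Real.smoothTransition.nonneg _

theorem cutoff_le_one (c : E d) (r : ℝ) (x : E d) : cutoff c r x ≤ 1 :=
  Real.smoothTransition.le_one _

theorem cutoff_eq_one {c x : E d} {r : ℝ} (hr : 0 < r) (h : ‖x - c‖ ≤ r) : cutoff c r x = 1 := by
  refine Real.smoothTransition.one_of_one_le ?_
  have : ‖x - c‖ ^ 2 / r ^ 2 ≤ 1 := by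
    rw [div_le_one (by positivity)]
    gcongr
  linarith

theorem cutoff_eq_zero {c x : E d} {r : ℝ} (hr : 0 < r) (h : 2 * r ≤ ‖x - c‖) :
    cutoff c r x = 0 := by
  refine Real.smoothTransition.zero_of_nonpos ?_
  have : 2 ≤ ‖x - c‖ ^ 2 / r ^ 2 := by
    rw [le_div_iff₀ (by positivity)]
    nlinarith
  linarith

theorem gradVec_cutoff (c : E d) (r : ℝ) (x : E d) :
    gradVec (cutoff c r) x =
      -((2 / r ^ 2 * deriv Real.smoothTransition (2 - ‖x - c‖ ^ 2 / r ^ 2)) • vec (x - c)) := by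
  rw [← vec_smul, ← vec_neg]
  refine sum_stdVec_smul _ _ fun w => ?_
  have h1 : HasFDerivAt (fun z : E d => ‖z - c‖ ^ 2) (2 • (innerSL ℝ (x - c))) x := by
    have := ((hasFDerivAt_id x).sub_const c).norm_sq
    simpa using this
  have h2 := (h1.mul_const (r ^ 2)⁻¹).const_sub 2
  have h3 := (smoothTransition_contDiff.differentiable one_ne_zero
    (2 - ‖x - c‖ ^ 2 * (r ^ 2)⁻¹)).hasDerivAt.comp_hasFDerivAt x h2
  have h4 : HasFDerivAt (cutoff c r) _ x := h3
  rw [h4.fderiv, inner_neg_left, real_inner_smul_left]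
  simp only [neg_apply, smul_apply, smul_eq_mul, innerSL_apply_apply, nsmul_eq_mul,
    div_eq_mul_inv]
  push_cast
  ring

theorem gradVec_cutoff_eq_zero_of_lt {c x : E d} {r : ℝ} (hr : 0 < r) (h : ‖x - c‖ < r) :
    gradVec (cutoff c r) x = 0 := by
  have : ‖x - c‖ ^ 2 / r ^ 2 < 1 := by
    rw [div_lt_one (by positivity)]
    gcongr
  rw [gradVec_cutoff, deriv_smoothTransition_eq_zero, mul_zero, zero_smul, neg_zero]
  intro h
  linarith [h.2]

theorem gradVec_cutoff_eq_zero_of_gt {c x : E d} {r : ℝ} (hr : 0 < r) (h : 2 * r < ‖x - c‖) :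
    gradVec (cutoff c r) x = 0 := by
  have : 2 < ‖x - c‖ ^ 2 / r ^ 2 := by
    rw [lt_div_iff₀ (by positivity)]
    nlinarith
  rw [gradVec_cutoff, deriv_smoothTransition_eq_zero, mul_zero, zero_smul, neg_zero]
  intro h
  linarith [h.1]

theorem exists_norm_gradVec_cutoff_le (d : ℕ) : ∃ G : ℝ, ∀ (c x : E d) (r : ℝ), 0 < r →
    ‖gradVec (cutoff c r) x‖ ≤ G * r⁻¹ := by
  obtain ⟨M, hM⟩ := hasCompactSupport_deriv_smoothTransition.exists_bound_of_continuous
    continuous_deriv_smoothTransition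
  have hM0 : 0 ≤ M := (norm_nonneg _).trans (hM 0)
  refine ⟨4 * M * ‖vecL d‖, fun c x r hr => ?_⟩
  rcases lt_or_ge (2 * r) ‖x - c‖ with h | h
  · rw [gradVec_cutoff_eq_zero_of_gt hr h, norm_zero]
    positivity
  · rw [gradVec_cutoff, norm_neg, norm_smul, norm_mul, Real.norm_of_nonneg (by positivity)]
    calc 2 / r ^ 2 * ‖deriv Real.smoothTransition (2 - ‖x - c‖ ^ 2 / r ^ 2)‖ * ‖vec (x - c)‖
        ≤ 2 / r ^ 2 * M * (‖vecL d‖ * (2 * r)) := by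
          gcongr
          · exact hM _
          · exact ((vecL d).le_opNorm _).trans (by gcongr)
      _ = 4 * M * ‖vecL d‖ * r⁻¹ := by
          field_simp
          ring

theorem gradVec_sub {θ η : E d → ℝ} (hθ : ContDiff ℝ 1 θ) (hη : ContDiff ℝ 1 η) (x : E d) :
    gradVec (fun z => θ z - η z) x = gradVec θ x - gradVec η x := by
  simp only [gradVec]
  rw [fderiv_fun_sub (hθ.differentiable one_ne_zero x) (hη.differentiable one_ne_zero x),
    ← Finset.sum_sub_distrib]
  simp [sub_smul]

end Cutoff

/-! ### The Gauss formula for the kernels -/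

namespace IsSectionOnDomain

variable {d m : ℕ} {hm : 1 < m} {s : ℝ} {U' K' : Set (Splus d m hm)} {f : E d → Cl d} {y : E d}

theorem dirac_eq (h : IsSectionOnDomain s U' K' f) {x : E d} (hx : x ∈ preim U') :
    dirac f x = -(((d : ℝ) * (lastCoord x)⁻¹) • qPart (f x)) := by
  have h0 : 0 < lastCoord x := preim_subset _ hx
  have h1 := h.isSection.2.2 x hx
  have h2 : dirac f x = (lastCoord x)⁻¹ • (lastCoord x • dirac f x) := by
    rw [smul_smul, inv_mul_cancel₀ h0.ne', one_smul]
  rw [h2, eq_neg_of_add_eq_zero_left h1, smul_neg, smul_smul, mul_comm]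

theorem continuous_qPart : Continuous (qPart : Cl d → Cl d) := by
  unfold qPart
  exact ((continuous_const.mul (continuous_id.sub continuous_starCl)).const_smul (1 / 2 : ℝ)).neg

/-- The equation expresses `dirac f` by the values of `f`, hence continuity without any assumption
on the partial derivatives. -/
theorem continuousOn_dirac (h : IsSectionOnDomain s U' K' f) :
    ContinuousOn (dirac f) (preim U') := by
  refine ContinuousOn.congr ?_ fun x hx => h.dirac_eq hx
  refine ContinuousOn.neg (ContinuousOn.smul (continuousOn_const.mul
    (continuous_lastCoord.continuousOn.inv₀ fun x hx => ?_))
    (continuous_qPart.comp_continuousOn h.continuousOn))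
  have : 0 < lastCoord x := preim_subset _ hx
  exact this.ne'

theorem kern_hypermonogenic (h : IsSectionOnDomain s U' K' f) (hy : y ∈ upperHalf d) {x : E d}
    (hx : x ∈ preim U') (hxy : x ≠ y) :
    rightDirac (kern y (starVec d y)) x * f x + kern y (starVec d y) x * dirac f x =
      starCl d (rightDirac (kern (starVec d y) y) x * f x +
        kern (starVec d y) y x * dirac f x) := by
  have h1 := kernel_identity (preim_subset _ hx) hxy (ne_starVec (preim_subset _ hx) hy) (f x)
  have hne := ne_starVec (preim_subset _ hx) hy
  rw [rightDirac_kern hxy hne, rightDirac_kern hne hxy, h.dirac_eq hx, kern, kern,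
    mul_comm (‖x - starVec d y‖ ^ d)]
  set N := (‖x - y‖ ^ d * ‖x - starVec d y‖ ^ d)⁻¹
  have e : ∀ a b : Cl d, ((d : ℝ) * N) • (a * b) * f x +
      N • a * -(((d : ℝ) * (lastCoord x)⁻¹) • qPart (f x)) =
      ((d : ℝ) * N) • (a * b * f x - (lastCoord x)⁻¹ • (a * qPart (f x))) := by
    intro a b
    rw [smul_mul_assoc, mul_neg, mul_smul_comm, smul_mul_assoc]
    module
  rw [e, e, h1, map_smul]

theorem integrableOn_grad (h : IsSectionOnDomain s U' K' f)
    {κ : E d → Cl d} (hκ : ContinuousOn κ (upperHalf d \ {y})) {θ : E d → ℝ} (hθ : ContDiff ℝ 1 θ)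
    {K : Set (E d)} (hK : IsCompact K) (hKU : K ⊆ preim U' \ {y})
    (hθ0 : ∀ z ∈ preim K', z ∉ K → gradVec θ z = 0) :
    IntegrableOn (fun x => κ x * gradVec θ x * f x) (preim K') := by
  have hc : ContinuousOn (fun x => κ x * gradVec θ x * f x) K :=
    ((hκ.mono fun x hx => ⟨preim_subset _ (hKU hx).1, (hKU hx).2⟩).mul
      (continuous_gradVec hθ).continuousOn).mul (h.continuousOn.mono fun x hx => (hKU hx).1)
  refine IntegrableOn.of_forall_sdiff_eq_zero (s := preim K' ∩ K)
    ((hc.integrableOn_compact hK).mono_set Set.inter_subset_right)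
    (isOpen_preim h.isOpen).measurableSet fun z hz => ?_
  rw [hθ0 z hz.1 fun hz' => hz.2 ⟨hz.1, hz'⟩, mul_zero, zero_mul]

/-- The Gauss formula for the pair of kernels, with a cutoff function. -/
theorem gauss_kern (h : IsSectionOnDomain s U' K' f) (hy : y ∈ upperHalf d)
    {θ : E d → ℝ} (hθ : ContDiff ℝ 1 θ)
    {K : Set (E d)} (hK : IsCompact K) (hKU : K ⊆ preim U' \ {y})
    (hθ0 : ∀ z ∈ preim (closure K'), z ∉ K → θ =ᶠ[𝓝 z] fun _ => 0) :
    (∫ x in preim (frontier K'), θ x • (kern y (starVec d y) x *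
        vec (outerNormal (preim K') x) * f x) ∂(surf d)) -
      starCl d (∫ x in preim (frontier K'), θ x • (kern (starVec d y) y x *
        vec (outerNormal (preim K') x) * f x) ∂(surf d)) =
    (∫ x in preim K', kern y (starVec d y) x * gradVec θ x * f x) -
      starCl d (∫ x in preim K', kern (starVec d y) y x * gradVec θ x * f x) := by
  have hA := (isOpen_preim h.isOpen).measurableSet
  have hAcl : preim K' ⊆ preim (closure K') := preim_mono subset_closure
  have hθd := hθ.differentiable one_ne_zero
  have hgrad0 : ∀ z ∈ preim K', z ∉ K → gradVec θ z = 0 := fun z hz hzK => by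
    simp only [gradVec, (hθ0 z (hAcl hz) hzK).fderiv_eq]
    simp
  have key : ∀ c c' : E d, (∀ x ∈ preim U' \ {y}, x ≠ c ∧ x ≠ c') →
      (IntegrableOn (fun z => rightDirac (fun x => θ x • kern c c' x) z * f z +
        (θ z • kern c c' z) * dirac f z) (preim K') ∧
      ∫ z in preim K', (rightDirac (fun x => θ x • kern c c' x) z * f z +
        (θ z • kern c c' z) * dirac f z) =
      ∫ x in preim (frontier K'), θ x • (kern c c' x *
        vec (outerNormal (preim K') x) * f x) ∂(surf d)) := by
    intro c c' hcc
    have hW : IsOpen (preim U' \ {y}) := (isOpen_preim h.isOpen_nhd).sdiff isClosed_singleton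
    have hkd : ∀ x ∈ preim U' \ {y}, DifferentiableAt ℝ (kern c c') x := fun x hx =>
      differentiableAt_kern (hcc x hx).1 (hcc x hx).2
    have hkc : ContinuousOn (kern c c') (preim U' \ {y}) := fun x hx =>
      (hkd x hx).continuousAt.continuousWithinAt
    have hrc : ContinuousOn (rightDirac (kern c c')) (preim U' \ {y}) := by
      have hn : ∀ b : E d, ContinuousOn (fun x : E d => ‖x - b‖) (preim U' \ {y}) := fun b =>
        (continuous_id.sub continuous_const).norm.continuousOn
      have h0 : ∀ b : E d, (∀ x ∈ preim U' \ {y}, x ≠ b) → ∀ x ∈ preim U' \ {y}, ‖x - b‖ ≠ 0 :=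
        fun b hb x hx => norm_ne_zero_iff.2 (sub_ne_zero.2 (hb x hx))
      have hv : ∀ b : E d, (∀ x ∈ preim U' \ {y}, x ≠ b) →
          ContinuousOn (fun x : E d => vec (vecInv (x - b))) (preim U' \ {y}) := fun b hb => by
        unfold vecInv
        exact continuous_vec.comp_continuousOn ((((hn b).pow 2).inv₀ fun x hx =>
          pow_ne_zero 2 (h0 b hb x hx)).smul (continuous_id.sub continuous_const).continuousOn).neg
      have hc1 : ∀ x ∈ preim U' \ {y}, x ≠ c := fun x hx => (hcc x hx).1
      have hc2 : ∀ x ∈ preim U' \ {y}, x ≠ c' := fun x hx => (hcc x hx).2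
      refine ContinuousOn.congr ?_ fun x hx => rightDirac_kern (hcc x hx).1 (hcc x hx).2
      refine (continuousOn_const.mul ((((hn c).pow d).mul ((hn c').pow d)).inv₀ fun x hx => ?_)).smul
        ((hv c hc1).mul (hv c' hc2))
      exact mul_ne_zero (pow_ne_zero _ (h0 c hc1 x hx)) (pow_ne_zero _ (h0 c' hc2 x hx))
    have := (isLipschitzIn_preim h.isOpen h.lipschitz).gauss hA (measurableSet_bdry K')
      (preim_subset _) hW (Set.sdiff_subset.trans (preim_subset _))
      (p := fun x => θ x • kern c c' x) (f := f)
      (fun x hx => (hθd x).fun_smul (hkd x hx))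
      (ContinuousOn.congr ((hθ.continuous.continuousOn.smul hrc).add
        (hkc.mul (continuous_gradVec hθ).continuousOn))
        fun x hx => rightDirac_smul (hθd x) (hkd x hx))
      (fun x hx => h.isSection.2.1 x hx.1) (h.continuousOn_dirac.mono Set.sdiff_subset) hK hKU
      (fun z hz hzK => by
        have hz' : z ∈ preim (closure K') :=
          hz.elim (fun hz => hAcl hz) fun hz => preim_mono frontier_subset_closure hz
        filter_upwards [hθ0 z hz' hzK] with w hw
        rw [hw, zero_smul])
    refine ⟨this.1, this.2.trans (integral_congr_ae (Filter.Eventually.of_forall fun x => ?_))⟩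
    simp only [smul_mul_assoc]
  obtain ⟨ip, ep⟩ := key y (starVec d y) fun x hx => ⟨hx.2, ne_starVec (preim_subset _ hx.1) hy⟩
  obtain ⟨iq, eq⟩ := key (starVec d y) y fun x hx => ⟨ne_starVec (preim_subset _ hx.1) hy, hx.2⟩
  have jp := h.integrableOn_grad (isDecayingKernel_kern hy).continuousOn hθ hK hKU hgrad0
  have jq := h.integrableOn_grad (isDecayingKernel_kern_starVec hy).continuousOn hθ hK hKU hgrad0
  rw [← ep, ← eq]
  simp only [← starL_apply]
  rw [← (starL d).integral_comp_comm iq, ← (starL d).integral_comp_comm jq,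
    ← integral_sub ip ((starL d).integrable_comp iq),
    ← integral_sub jp ((starL d).integrable_comp jq)]
  -- After the product rule the terms carrying `θ` itself cancel by `kern_hypermonogenic`; those
  -- carrying its gradient remain.
  refine setIntegral_congr_fun hA fun x hx => ?_
  simp only [starL_apply]
  by_cases hxK : x ∈ K
  · have hxU := (hKU hxK).1
    have hxy : x ≠ y := (hKU hxK).2
    have hne := ne_starVec (preim_subset _ hxU) hy
    rw [rightDirac_smul (hθd x) (differentiableAt_kern hxy hne),
      rightDirac_smul (hθd x) (differentiableAt_kern hne hxy)]
    have := h.kern_hypermonogenic hy hxU hxy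
    have e : ∀ a b : Cl d, (θ x • a + b * gradVec θ x) * f x + θ x • b * dirac f x =
        θ x • (a * f x + b * dirac f x) + b * gradVec θ x * f x := by
      intro a b
      rw [add_mul, smul_mul_assoc, smul_mul_assoc]
      module
    rw [e, e, this, map_add (starCl d) (θ x • _), map_smul]
    abel
  · have h0 := hθ0 x (hAcl hx) hxK
    have h1 : ∀ c c' : E d, rightDirac (fun x => θ x • kern c c' x) x = 0 := fun c c' => by
      rw [rightDirac_congr (q := fun _ => 0), rightDirac_zero]
      filter_upwards [h0] with w hw
      rw [hw, zero_smul]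
    simp only [h1, h0.self_of_nhds, hgrad0 x hx hxK, zero_smul, zero_mul, mul_zero, add_zero,
      map_zero]

end IsSectionOnDomain

/-! ### Exhaustion of the domain -/

namespace IsSectionOnDomain

variable {d m : ℕ} {hm : 1 < m} {s : ℝ} {U' K' : Set (Splus d m hm)} {f : E d → Cl d} {y : E d}

/-- With `r = m^k`, the gradient is `O(1 / r)` on the shell `r ≤ ‖x‖ ≤ 2 r` of volume `O(r^n)` and
zero elsewhere. Together with `f = O(r^(-(n-1-s)))` and the decay of `κ` this gives `r^s (1 +
r)^(-(2n-3))`. -/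
theorem exists_shell_bound (h : IsSectionOnDomain s U' K' f) {κ : E d → Cl d}
    (hκ : IsDecayingKernel y κ) {ε : ℝ} (hε : 0 < ε) :
    ∃ C : ℝ, ∀ k : ℤ, (∀ x : E d, (m : ℝ) ^ k ≤ ‖x‖ → ‖x‖ ≤ 2 * (m : ℝ) ^ k → ε ≤ ‖x - y‖) →
      ‖∫ x in preim K', κ x * gradVec (cutoff 0 ((m : ℝ) ^ k)) x * f x‖ ≤ C * growth d m s k := by
  obtain ⟨M, hM, hκM⟩ := hκ.bound ε hε
  obtain ⟨M₀, hM₀⟩ := h.exists_bound 2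
  obtain ⟨G, hG⟩ := exists_norm_gradVec_cutoff_le d
  -- The annulus may contain no point of the domain, in which case `M₀` could be negative.
  set M' := max M₀ 0
  have hM' : 0 ≤ M' := le_max_right _ _
  have hG0 : 0 ≤ G := by simpa using (norm_nonneg _).trans (hG 0 0 1 one_pos)
  set c := ‖mulB d‖ * ‖mulB d‖ * G * M * M' with hc
  set v := (volume : Measure (E d)).real (Metric.ball 0 1) with hv
  refine ⟨c * 2 ^ (d + 2) * v, fun k hk => ?_⟩
  have hp := zpow_pos_of_one_lt hm k
  have hg0 := growth_nonneg d m s k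
  set r := (m : ℝ) ^ k with hr
  have hA := (isOpen_preim h.isOpen).measurableSet
  rw [setIntegral_eq_of_subset_of_forall_sdiff_eq_zero hA
    (Set.inter_subset_left : preim K' ∩ Metric.closedBall 0 (2 * r) ⊆ preim K') fun x hx => ?_]
  swap
  · rw [gradVec_cutoff_eq_zero_of_gt hp, mul_zero, zero_mul]
    by_contra! hle
    exact hx.2 ⟨hx.1, by rwa [Metric.mem_closedBall, dist_eq_norm]⟩
  have hvol : (volume : Measure (E d)).real (preim K' ∩ Metric.closedBall 0 (2 * r)) ≤
      (2 * r) ^ (d + 2) * v := by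
    refine (measureReal_mono Set.inter_subset_right measure_closedBall_lt_top.ne).trans (le_of_eq ?_)
    rw [Measure.addHaar_real_closedBall _ _ (by positivity), finrank_euclideanSpace_fin]
  have hbd : ∀ x ∈ preim K' ∩ Metric.closedBall 0 (2 * r),
      ‖κ x * gradVec (cutoff 0 r) x * f x‖ ≤ c * growth d m s k * (r ^ (d + 2))⁻¹ := by
    rintro x ⟨hxA, hx2⟩
    have hx2' : ‖x‖ ≤ 2 * r := by simpa using hx2
    rcases lt_or_ge ‖x‖ r with hlt | hge
    · rw [gradVec_cutoff_eq_zero_of_lt hp (by simpa using hlt), mul_zero, zero_mul, norm_zero]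
      positivity
    · set z := (m : ℝ) ^ (-k) • x with hz
      have hzx : x = r • z := by
        rw [hz, hr, smul_smul, ← zpow_add₀ (by positivity), add_neg_cancel, zpow_zero, one_smul]
      have hnz : ‖x‖ = r * ‖z‖ := by rw [hzx, norm_smul, Real.norm_of_nonneg hp.le]
      have hzA : z ∈ preim K' := smul_mem_preim hxA (-k)
      have hz1 : 1 ≤ ‖z‖ := by
        rw [hnz] at hge
        exact le_of_mul_le_mul_left (by simpa using hge) hp
      have hz2 : ‖z‖ ≤ 2 := by
        rw [hnz, mul_comm] at hx2'
        exact le_of_mul_le_mul_right hx2' hp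
      have hzcl : z ∈ preim (closure K') := preim_mono subset_closure hzA
      have key := norm_kern_mul_section_le (s := s) (κ := κ x) (κ' := gradVec (cutoff 0 r) x)
        (a' := f x) (a := f z) (k := k) hm hM hz1
        (by rw [← hr, ← hzx]; exact hκM x (preim_subset _ hxA) (hk x hge hx2'))
        (by rw [hzx]; exact h.isSection.1 z (h.preim_closure_subset hzcl) k)
        ((hM₀ z hzcl hz1 hz2).trans (le_max_left M₀ 0)) (hG 0 x r hp)
      rw [← le_div_iff₀' (by positivity)] at key
      refine key.trans (le_of_eq ?_)
      rw [hc, ← hr]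
      change _ * M' * _ / _ = _
      field_simp
      ring
  refine (norm_setIntegral_le_of_norm_le_const
    ((measure_mono Set.inter_subset_right).trans_lt measure_closedBall_lt_top) hbd).trans ?_
  refine (mul_le_mul_of_nonneg_left hvol (by positivity)).trans (le_of_eq ?_)
  rw [mul_pow]
  field_simp

theorem tendsto_zpow_natCast (hm : 1 < m) :
    Filter.Tendsto (fun N : ℕ => (m : ℝ) ^ (N : ℤ)) Filter.atTop Filter.atTop := by
  simp only [zpow_natCast]
  exact tendsto_pow_atTop_atTop_of_one_lt (by exact_mod_cast hm)

theorem tendsto_zpow_neg_natCast (hm : 1 < m) :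
    Filter.Tendsto (fun N : ℕ => (m : ℝ) ^ (-(N : ℤ))) Filter.atTop (𝓝 0) := by
  simp only [zpow_neg]
  exact (tendsto_zpow_natCast hm).inv_tendsto_atTop

theorem tendsto_integral_cutoff (h : IsSectionOnDomain s U' K' f) (hy : y ∈ preim K')
    {κ : E d → Cl d} (hκ : IsDecayingKernel y κ) :
    Filter.Tendsto (fun N : ℕ => ∫ x in preim (frontier K'),
      (cutoff 0 ((m : ℝ) ^ (N : ℤ)) x - cutoff 0 ((m : ℝ) ^ (-(N : ℤ))) x) •
        (κ x * vec (outerNormal (preim K') x) * f x) ∂(surf d)) Filter.atTop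
      (𝓝 (∫ x in preim (frontier K'), κ x * vec (outerNormal (preim K') x) * f x ∂(surf d))) := by
  have hintg := h.integrableOn_boundary hy hκ
  refine tendsto_integral_of_dominated_convergence _ (fun N => ?_) hintg.norm (fun N => ?_) ?_
  · exact ((contDiff_cutoff _ _).continuous.sub
      (contDiff_cutoff _ _).continuous).aestronglyMeasurable.smul hintg.1
  · refine Filter.Eventually.of_forall fun x => ?_
    rw [norm_smul]
    refine mul_le_of_le_one_left (norm_nonneg _) (abs_le.2 ⟨?_, ?_⟩)
    · linarith [cutoff_nonneg 0 ((m : ℝ) ^ (N : ℤ)) x, cutoff_le_one 0 ((m : ℝ) ^ (-(N : ℤ))) x]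
    · linarith [cutoff_le_one 0 ((m : ℝ) ^ (N : ℤ)) x, cutoff_nonneg 0 ((m : ℝ) ^ (-(N : ℤ))) x]
  · refine (ae_restrict_iff' (measurableSet_bdry K')).2 (Filter.Eventually.of_forall fun x hx => ?_)
    have hx0 : 0 < ‖x‖ := by
      refine norm_pos_iff.2 ?_
      rintro rfl
      exact lt_irrefl (0 : ℝ) hx.1
    refine Filter.Tendsto.congr' ?_ tendsto_const_nhds
    filter_upwards [(tendsto_zpow_natCast hm).eventually_ge_atTop ‖x‖,
      (tendsto_zpow_neg_natCast hm).eventually_lt_const (half_pos hx0)] with N h1 h2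
    rw [cutoff_eq_one (zpow_pos_of_one_lt hm _) (by simpa using h1),
      cutoff_eq_zero (zpow_pos_of_one_lt hm _) (by rw [sub_zero]; linarith), sub_zero, one_smul]

/-- The boundary integrals expressed by an integral over a neighbourhood of `y`. -/
theorem boundary_eq (h : IsSectionOnDomain s U' K' f) (hy : y ∈ preim K') {ε : ℝ} (hε : 0 < ε)
    (hball : Metric.closedBall y (2 * ε) ⊆ preim K') :
    (∫ x in preim (frontier K'), kern y (starVec d y) x *
        vec (outerNormal (preim K') x) * f x ∂(surf d)) -
      starCl d (∫ x in preim (frontier K'), kern (starVec d y) y x *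
        vec (outerNormal (preim K') x) * f x ∂(surf d)) =
    -((∫ x in preim K', kern y (starVec d y) x * gradVec (cutoff y ε) x * f x) -
      starCl d (∫ x in preim K', kern (starVec d y) y x * gradVec (cutoff y ε) x * f x)) := by
  have hyU : y ∈ upperHalf d := preim_subset _ hy
  have hkp := isDecayingKernel_kern hyU
  have hkq := isDecayingKernel_kern_starVec hyU
  have hyn : 2 * ε < ‖y‖ := by
    by_contra! hle
    have : (0 : E d) ∈ preim K' := hball (by simpa [dist_eq_norm] using hle)
    exact lt_irrefl (0 : ℝ) (preim_subset _ this)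
  let I : (E d → Cl d) → ℤ → Cl d := fun κ k =>
    ∫ x in preim K', κ x * gradVec (cutoff 0 ((m : ℝ) ^ k)) x * f x
  let J : (E d → Cl d) → Cl d := fun κ => ∫ x in preim K', κ x * gradVec (cutoff y ε) x * f x
  -- For such `N` the outer shell begins beyond the ball of radius `2 * ε` around `y` and the inner
  -- shell ends before it.
  have hev : ∀ᶠ N : ℕ in Filter.atTop, ‖y‖ + 2 * ε ≤ (m : ℝ) ^ (N : ℤ) ∧
      2 * (m : ℝ) ^ (-(N : ℤ)) < ‖y‖ - 2 * ε := by
    filter_upwards [(tendsto_zpow_natCast hm).eventually_ge_atTop (‖y‖ + 2 * ε),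
      (tendsto_zpow_neg_natCast hm).eventually_lt_const
        (show 0 < (‖y‖ - 2 * ε) / 2 by linarith)] with N h1 h2
    exact ⟨h1, by linarith⟩
  have hgrow : Filter.Tendsto (growth d m s) Filter.cofinite (𝓝 0) :=
    (summable_growth hm h.pos h.lt).tendsto_cofinite_zero
  have hI : ∀ κ, IsDecayingKernel y κ →
      Filter.Tendsto (fun N : ℕ => I κ N - I κ (-N)) Filter.atTop (𝓝 0) := by
    intro κ hκ
    obtain ⟨C, hC⟩ := h.exists_shell_bound hκ hε
    have hpos : Filter.Tendsto (fun N : ℕ => I κ N) Filter.atTop (𝓝 0) := by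
      refine squeeze_zero_norm' (a := fun N : ℕ => C * growth d m s N) ?_ ?_
      · filter_upwards [hev] with N hN
        refine hC N fun x hx1 hx2 => ?_
        have := norm_le_norm_sub_add x y
        linarith [hN.1]
      · have := hgrow.comp (Nat.cofinite_eq_atTop ▸ (Nat.cast_injective (R := ℤ)).tendsto_cofinite)
        simpa using this.const_mul C
    have hneg : Filter.Tendsto (fun N : ℕ => I κ (-N)) Filter.atTop (𝓝 0) := by
      refine squeeze_zero_norm' (a := fun N : ℕ => C * growth d m s (-N)) ?_ ?_
      · filter_upwards [hev] with N hN
        refine hC (-N) fun x hx1 hx2 => ?_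
        have := norm_le_norm_sub_add y x
        rw [norm_sub_rev] at this
        linarith [hN.2]
      · have := hgrow.comp (Nat.cofinite_eq_atTop ▸
          (neg_injective.comp (Nat.cast_injective (R := ℤ))).tendsto_cofinite)
        simpa using this.const_mul C
    simpa using hpos.sub hneg
  have hlim1 := (h.tendsto_integral_cutoff hy hkp).sub
    (((starL d).continuous.tendsto _).comp (h.tendsto_integral_cutoff hy hkq))
  have hlim2 : Filter.Tendsto (fun N : ℕ => (I (kern y (starVec d y)) N -
      I (kern y (starVec d y)) (-N) - J (kern y (starVec d y))) -
      starL d (I (kern (starVec d y) y) N - I (kern (starVec d y) y) (-N) -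
        J (kern (starVec d y) y))) Filter.atTop
      (𝓝 (0 - J (kern y (starVec d y)) - starL d (0 - J (kern (starVec d y) y)))) :=
    ((hI _ hkp).sub_const _).sub (((starL d).continuous.tendsto _).comp ((hI _ hkq).sub_const _))
  have hlim := tendsto_nhds_unique (hlim1.congr' ?_) hlim2
  · refine hlim.trans ?_
    rw [zero_sub, zero_sub, map_neg, starL_apply]
    simp only [J]
    abel
  filter_upwards [hev] with N hN
  obtain ⟨hN1, hN2⟩ := hN
  have hp1 := zpow_pos_of_one_lt hm (N : ℤ)
  have hp2 := zpow_pos_of_one_lt hm (-(N : ℤ))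
  set r := (m : ℝ) ^ (N : ℤ) with hr
  set t := (m : ℝ) ^ (-(N : ℤ)) with ht
  let K : Set (E d) := (preim (closure K') ∩ {x | t ≤ ‖x‖ ∧ ‖x‖ ≤ 2 * r}) \ Metric.ball y ε
  have hK : IsCompact K :=
    (isCompact_preim_inter_annulus h.isCompact isClosed_closure hp2 _).diff Metric.isOpen_ball
  have hKU : K ⊆ preim U' \ {y} := by
    rintro x ⟨⟨hx, -⟩, hx'⟩
    refine ⟨h.preim_closure_subset hx, ?_⟩
    rintro rfl
    exact hx' (Metric.mem_ball_self hε)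
  have hcases : ∀ z ∈ preim (closure K'), z ∉ K → ‖z‖ < t ∨ 2 * r < ‖z‖ ∨ ‖z - y‖ < ε := by
    intro z hz hzK
    by_contra! hcon
    refine hzK ⟨⟨hz, hcon.1, hcon.2.1⟩, ?_⟩
    rw [Metric.mem_ball, dist_eq_norm, not_lt]
    exact hcon.2.2
  have htri : ∀ z : E d, ‖z‖ ≤ ‖z - y‖ + ‖y‖ := fun z => norm_le_norm_sub_add z y
  have htri' : ∀ z : E d, ‖y‖ ≤ ‖z - y‖ + ‖z‖ := fun z => by
    rw [norm_sub_rev]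
    exact norm_le_norm_sub_add y z
  have hAcl : preim K' ⊆ preim (closure K') := preim_mono subset_closure
  have g1 : ∀ z ∈ preim K', z ∉ K → gradVec (cutoff 0 r) z = 0 := fun z hz hzK => by
    rcases hcases z (hAcl hz) hzK with hc | hc | hc
    · exact gradVec_cutoff_eq_zero_of_lt hp1 (by rw [sub_zero]; linarith)
    · exact gradVec_cutoff_eq_zero_of_gt hp1 (by rwa [sub_zero])
    · exact gradVec_cutoff_eq_zero_of_lt hp1 (by rw [sub_zero]; linarith [htri z])
  have g2 : ∀ z ∈ preim K', z ∉ K → gradVec (cutoff 0 t) z = 0 := fun z hz hzK => by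
    rcases hcases z (hAcl hz) hzK with hc | hc | hc
    · exact gradVec_cutoff_eq_zero_of_lt hp2 (by rwa [sub_zero])
    · exact gradVec_cutoff_eq_zero_of_gt hp2 (by rw [sub_zero]; linarith)
    · exact gradVec_cutoff_eq_zero_of_gt hp2 (by rw [sub_zero]; linarith [htri' z])
  have g3 : ∀ z ∈ preim K', z ∉ K → gradVec (cutoff y ε) z = 0 := fun z hz hzK => by
    rcases hcases z (hAcl hz) hzK with hc | hc | hc
    · exact gradVec_cutoff_eq_zero_of_gt hε (by linarith [htri' z])
    · exact gradVec_cutoff_eq_zero_of_gt hε (by linarith [htri z])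
    · exact gradVec_cutoff_eq_zero_of_lt hε hc
  -- Zero near the origin, near infinity and near the pole `y`, and one in between. The gradients of
  -- the three terms have disjoint supports, and the last term vanishes on the boundary.
  let θ : E d → ℝ := fun x => cutoff 0 r x - cutoff 0 t x - cutoff y ε x
  have hχ : ContDiff ℝ 1 fun x : E d => cutoff 0 r x - cutoff 0 t x :=
    (contDiff_cutoff 0 r).sub (contDiff_cutoff 0 t)
  have hθ : ContDiff ℝ 1 θ := hχ.sub (contDiff_cutoff y ε)
  have hθ0 : ∀ z ∈ preim (closure K'), z ∉ K → θ =ᶠ[𝓝 z] fun _ => 0 := fun z hz hzK => by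
    rcases hcases z hz hzK with hc | hc | hc
    · filter_upwards [(isOpen_lt continuous_norm continuous_const).mem_nhds hc] with w hw
      have hw' : ‖w‖ < t := hw
      simp only [θ]
      rw [cutoff_eq_one hp1 (by rw [sub_zero]; linarith), cutoff_eq_one hp2 (by rw [sub_zero]; linarith),
        cutoff_eq_zero hε (by linarith [htri' w])]
      ring
    · filter_upwards [(isOpen_lt continuous_const continuous_norm).mem_nhds hc] with w hw
      have hw' : 2 * r < ‖w‖ := hw
      simp only [θ]
      rw [cutoff_eq_zero hp1 (by rw [sub_zero]; linarith),
        cutoff_eq_zero hp2 (by rw [sub_zero]; linarith), cutoff_eq_zero hε (by linarith [htri w])]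
      ring
    · filter_upwards [(isOpen_lt (continuous_id.sub continuous_const).norm
        continuous_const).mem_nhds hc] with w hw
      have hw' : ‖w - y‖ < ε := hw
      simp only [θ]
      rw [cutoff_eq_one hp1 (by rw [sub_zero]; linarith [htri w]),
        cutoff_eq_zero hp2 (by rw [sub_zero]; linarith [htri' w]), cutoff_eq_one hε hw'.le]
      ring
  have hgauss := h.gauss_kern hyU hθ hK hKU hθ0
  have hS : ∀ κ : E d → Cl d, ∫ x in preim (frontier K'), θ x • (κ x *
        vec (outerNormal (preim K') x) * f x) ∂(surf d) =
      ∫ x in preim (frontier K'), (cutoff 0 r x - cutoff 0 t x) • (κ x *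
        vec (outerNormal (preim K') x) * f x) ∂(surf d) := fun κ =>
    setIntegral_congr_fun (measurableSet_bdry K') fun x hx => by
      simp only [θ]
      rw [cutoff_eq_zero hε (h.le_norm_sub hball hx), sub_zero]
  have hV : ∀ κ, IsDecayingKernel y κ → ∫ x in preim K', κ x * gradVec θ x * f x =
      I κ N - I κ (-N) - J κ := fun κ hκ => by
    have i1 := h.integrableOn_grad hκ.continuousOn (contDiff_cutoff 0 r) hK hKU g1
    have i2 := h.integrableOn_grad hκ.continuousOn (contDiff_cutoff 0 t) hK hKU g2
    have i3 := h.integrableOn_grad hκ.continuousOn (contDiff_cutoff y ε) hK hKU g3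
    simp only [I, J]
    rw [← hr, ← ht, ← integral_sub i1 i2]
    refine Eq.trans ?_ (integral_sub (i1.sub i2) i3)
    refine integral_congr_ae (Filter.Eventually.of_forall fun x => ?_)
    simp only [θ]
    rw [gradVec_sub hχ (contDiff_cutoff y ε), gradVec_sub (contDiff_cutoff 0 r) (contDiff_cutoff 0 t),
      mul_sub, mul_sub, sub_mul, sub_mul]
  rw [hS, hS, hV _ hkp, hV _ hkq] at hgauss
  exact hgauss

end IsSectionOnDomain

/-! ### Concentration at the singularity -/

section Peak

variable {d : ℕ}

/-- The radial peak function of width `ε` with integral `ω_n`. -/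
def peak (d : ℕ) (ε r : ℝ) : ℝ :=
  2 / ε ^ 2 * deriv Real.smoothTransition (2 - r ^ 2 / ε ^ 2) * (r ^ d)⁻¹

theorem deriv_smoothTransition_nonneg (t : ℝ) : 0 ≤ deriv Real.smoothTransition t :=
  Real.smoothTransition.monotone.deriv_nonneg

theorem peak_nonneg (ε : ℝ) {r : ℝ} (hr : 0 ≤ r) : 0 ≤ peak d ε r :=
  mul_nonneg (mul_nonneg (by positivity) (deriv_smoothTransition_nonneg _)) (by positivity)

theorem peak_eq_zero {ε r : ℝ} (hε : 0 < ε) (h : 2 * ε < r) : peak d ε r = 0 := by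
  have : 2 < r ^ 2 / ε ^ 2 := by
    rw [lt_div_iff₀ (by positivity)]
    nlinarith
  rw [peak, deriv_smoothTransition_eq_zero, mul_zero, zero_mul]
  intro h
  linarith [h.1]

/-- `r^(d+1) r^(-d) = r` makes the integrand the derivative of `-Real.smoothTransition (2 - r² /
ε²)`, which increases from `-1` to `0`. -/
theorem integral_pow_mul_peak {ε : ℝ} (hε : 0 < ε) :
    ∫ r in Set.Ioi (0 : ℝ), r ^ (d + 1) * peak d ε r = 1 := by
  have hd : ∀ r : ℝ, HasDerivAt (fun r => -Real.smoothTransition (2 - r ^ 2 / ε ^ 2))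
      (2 * r / ε ^ 2 * deriv Real.smoothTransition (2 - r ^ 2 / ε ^ 2)) r := fun r => by
    have h1 : HasDerivAt (fun r : ℝ => 2 - r ^ 2 / ε ^ 2) (-(2 * r / ε ^ 2)) r := by
      have := ((hasDerivAt_pow 2 r).div_const (ε ^ 2)).const_sub 2
      simpa using this
    have h2 := ((smoothTransition_contDiff.differentiable one_ne_zero
      (2 - r ^ 2 / ε ^ 2)).hasDerivAt.comp r h1).neg
    refine h2.congr_deriv ?_
    ring
  have e : ∫ r in Set.Ioi (0 : ℝ), r ^ (d + 1) * peak d ε r = ∫ r in Set.Ioi (0 : ℝ),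
      2 * r / ε ^ 2 * deriv Real.smoothTransition (2 - r ^ 2 / ε ^ 2) := by
    refine setIntegral_congr_fun measurableSet_Ioi fun r hr => ?_
    have hr0 : (0 : ℝ) < r := hr
    simp only [peak]
    field_simp
    ring
  have hlim : Filter.Tendsto (fun r : ℝ => -Real.smoothTransition (2 - r ^ 2 / ε ^ 2))
      Filter.atTop (𝓝 0) := by
    refine tendsto_const_nhds.congr' ?_
    filter_upwards [Filter.eventually_ge_atTop (2 * ε)] with r hr
    rw [Real.smoothTransition.zero_of_nonpos, neg_zero]
    have : 2 ≤ r ^ 2 / ε ^ 2 := by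
      rw [le_div_iff₀ (by positivity)]
      nlinarith
    linarith
  rw [e, integral_Ioi_of_hasDerivAt_of_nonneg (hd 0).continuousAt.continuousWithinAt
    (fun r _ => hd r) (fun r hr => ?_) hlim]
  · rw [Real.smoothTransition.one_of_one_le (by norm_num)]
    norm_num
  · have hr0 : (0 : ℝ) < r := hr
    exact mul_nonneg (by positivity) (deriv_smoothTransition_nonneg _)

theorem sphereArea_pos (d : ℕ) : 0 < sphereArea d := by
  rw [sphereArea, ← measureReal_def, Measure.toSphere_real_apply_univ, finrank_euclideanSpace_fin]
  have : 0 < (volume : Measure (E d)).real (Metric.ball 0 1) :=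
    ENNReal.toReal_pos (Metric.measure_ball_pos _ _ one_pos).ne' measure_ball_lt_top.ne
  positivity

theorem integral_peak (y : E d) {ε : ℝ} (hε : 0 < ε) :
    ∫ x : E d, peak d ε ‖x - y‖ = sphereArea d := by
  rw [integral_sub_right_eq_self (fun x : E d => peak d ε ‖x‖) y,
    integral_fun_norm_addHaar volume (peak d ε), sphereArea, ← measureReal_def,
    Measure.toSphere_real_apply_univ, finrank_euclideanSpace_fin]
  simp only [smul_eq_mul, nsmul_eq_mul, show d + 2 - 1 = d + 1 by omega]
  rw [integral_pow_mul_peak hε]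
  ring

/-- A function that is not integrable has Bochner integral `0`, so the nonzero value of
`integral_peak` already implies integrability. -/
theorem integrable_peak (y : E d) {ε : ℝ} (hε : 0 < ε) :
    Integrable fun x : E d => peak d ε ‖x - y‖ :=
  Integrable.of_integral_ne_zero (by rw [integral_peak y hε]; exact (sphereArea_pos d).ne')

theorem vec_vecInv_mul_vec {x : E d} (hx : x ≠ 0) : vec (vecInv x) * vec x = 1 := by
  have : ‖x‖ ≠ 0 := norm_ne_zero_iff.2 hx
  rw [vec_vecInv, neg_mul, smul_mul_assoc, vec_mul_self, smul_neg, neg_neg, smul_smul,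
    inv_mul_cancel₀ (by positivity), one_smul]

/-- The gradient of the cutoff is a multiple of `x - y`, which cancels the inverse in the kernel and
leaves a scalar. At `x = y` both sides vanish. -/
theorem kern_mul_gradVec_cutoff {x y : E d} {ε : ℝ} (hε : 0 < ε) (y' : E d) :
    kern y y' x * gradVec (cutoff y ε) x =
      -(peak d ε ‖x - y‖ • (‖x - y'‖ ^ d)⁻¹ • (1 : Cl d)) := by
  by_cases hxy : x = y
  · subst hxy
    rw [gradVec_cutoff_eq_zero_of_lt hε (by simpa using hε), peak, sub_self, norm_zero,
      deriv_smoothTransition_eq_zero (fun h => by norm_num at h), mul_zero, mul_zero, zero_mul,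
      zero_smul, neg_zero]
  · rw [gradVec_cutoff, kern, mul_neg, mul_smul_comm, smul_mul_assoc,
      vec_vecInv_mul_vec (sub_ne_zero.2 hxy), smul_smul, smul_smul, peak, mul_inv, mul_assoc,
      mul_assoc, mul_assoc]

/-- Here the inverse belongs to the other pole, so a factor `x - y` remains and this kernel
contributes nothing in the limit. -/
theorem kern_swap_mul_gradVec_cutoff (x y y' : E d) (ε : ℝ) :
    kern y' y x * gradVec (cutoff y ε) x =
      -(peak d ε ‖x - y‖ • (‖x - y'‖ ^ d)⁻¹ • (vec (vecInv (x - y')) * vec (x - y))) := by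
  rw [gradVec_cutoff, kern, mul_neg, mul_smul_comm, smul_mul_assoc, smul_smul, smul_smul, peak,
    mul_inv]
  congr 2
  ring

theorem norm_sub_starVec_self {y : E d} (hy : y ∈ upperHalf d) :
    ‖y - starVec d y‖ = 2 * lastCoord y := by
  have h0 : 0 < lastCoord y := hy
  rw [starVec_apply, sub_sub_cancel, norm_smul, lastVec, norm_stdVec, mul_one,
    Real.norm_of_nonneg (by positivity)]

end Peak

namespace IsSectionOnDomain

variable {d m : ℕ} {hm : 1 < m} {s : ℝ} {U' K' : Set (Splus d m hm)} {f : E d → Cl d} {y : E d}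

/-- Cauchy's formula on the preimage of the domain. -/
theorem cauchy_formula (h : IsSectionOnDomain s U' K' f) (hy : y ∈ preim K') :
    (∫ x in preim (frontier K'), kern y (starVec d y) x *
        vec (outerNormal (preim K') x) * f x ∂(surf d)) -
      starCl d (∫ x in preim (frontier K'), kern (starVec d y) y x *
        vec (outerNormal (preim K') x) * f x ∂(surf d)) =
    (sphereArea d * ((2 * lastCoord y) ^ d)⁻¹) • f y := by
  set L := (∫ x in preim (frontier K'), kern y (starVec d y) x *
        vec (outerNormal (preim K') x) * f x ∂(surf d)) -
      starCl d (∫ x in preim (frontier K'), kern (starVec d y) y x *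
        vec (outerNormal (preim K') x) * f x ∂(surf d)) with hL
  have hyU : y ∈ upperHalf d := preim_subset _ hy
  have hA := (isOpen_preim h.isOpen).measurableSet
  -- The boundary integrals equal the average of `g` against `peak d ε`, of mass `ω_n`; they do not
  -- depend on `ε`, so continuity of `g` at `y` determines their value `ω_n g(y)`.
  let g : E d → Cl d := fun x => (‖x - starVec d y‖ ^ d)⁻¹ • f x -
    starCl d ((‖x - starVec d y‖ ^ d)⁻¹ •
      (vec (vecInv (x - starVec d y)) * vec (x - y) * f x))
  have hgy : g y = ((2 * lastCoord y) ^ d)⁻¹ • f y := by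
    have : vec (0 : E d) = 0 := map_zero (vecL d)
    simp only [g]
    rw [norm_sub_starVec_self hyU, sub_self, this, mul_zero, zero_mul, smul_zero, map_zero,
      sub_zero]
  have hgc : ContinuousAt g y := by
    have hfc : ContinuousAt f y := (h.isSection.2.1 y
      (h.preim_closure_subset (preim_mono subset_closure hy))).continuousAt
    have hn : ContinuousAt (fun x : E d => ‖x - starVec d y‖) y := by fun_prop
    have hn0 : ‖y - starVec d y‖ ≠ 0 := norm_ne_zero_iff.2 (sub_ne_zero.2 (ne_starVec hyU hyU))
    have hn1 : ContinuousAt (fun x : E d => (‖x - starVec d y‖ ^ d)⁻¹) y :=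
      (hn.pow d).inv₀ (pow_ne_zero d hn0)
    have hv : ContinuousAt (fun x : E d => vec (vecInv (x - starVec d y))) y := by
      unfold vecInv
      exact continuous_vec.continuousAt.comp (((hn.pow 2).inv₀ (pow_ne_zero 2 hn0)).smul
        (continuous_id.sub continuous_const).continuousAt).neg
    have hv' : ContinuousAt (fun x : E d => vec (x - y)) y :=
      (continuous_vec.comp (continuous_id.sub continuous_const)).continuousAt
    exact (hn1.smul hfc).sub (continuous_starCl.continuousAt.comp
      (hn1.smul ((hv.mul hv').mul hfc)))
  have key : ∀ η > 0, ‖L - sphereArea d • g y‖ ≤ η * sphereArea d := by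
    intro η hη
    obtain ⟨δ, hδ, hgδ⟩ := Metric.continuousAt_iff.1 hgc η hη
    obtain ⟨r, hr, hball⟩ := h.exists_closedBall_subset hy
    -- `2 * ε < δ` for the continuity estimate, and `2 * ε ≤ r` to remain inside the domain.
    set ε := min (δ / 3) (r / 2) with hεdef
    have hε : 0 < ε := lt_min (by positivity) (by positivity)
    have hεδ : 2 * ε < δ := by linarith [min_le_left (δ / 3) (r / 2)]
    have hball' : Metric.closedBall y (2 * ε) ⊆ preim K' :=
      (Metric.closedBall_subset_closedBall (by linarith [min_le_right (δ / 3) (r / 2)])).trans hball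
    have hK : IsCompact (Metric.closedBall y (2 * ε) \ Metric.ball y ε) :=
      (isCompact_closedBall _ _).diff Metric.isOpen_ball
    have hKU : Metric.closedBall y (2 * ε) \ Metric.ball y ε ⊆ preim U' \ {y} := by
      rintro x ⟨hx, hx'⟩
      refine ⟨h.preim_closure_subset (preim_mono subset_closure (hball' hx)), ?_⟩
      rintro rfl
      exact hx' (Metric.mem_ball_self hε)
    have hgrad : ∀ z ∈ preim K', z ∉ Metric.closedBall y (2 * ε) \ Metric.ball y ε →
        gradVec (cutoff y ε) z = 0 := by
      intro z _ hz
      rcases lt_or_ge (2 * ε) ‖z - y‖ with h1 | h1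
      · exact gradVec_cutoff_eq_zero_of_gt hε h1
      · rcases lt_or_ge ‖z - y‖ ε with h2 | h2
        · exact gradVec_cutoff_eq_zero_of_lt hε h2
        · refine absurd ⟨?_, ?_⟩ hz
          · rwa [Metric.mem_closedBall, dist_eq_norm]
          · rwa [Metric.mem_ball, dist_eq_norm, not_lt]
    have ip := h.integrableOn_grad (isDecayingKernel_kern hyU).continuousOn (contDiff_cutoff y ε)
      hK hKU hgrad
    have iq := h.integrableOn_grad (isDecayingKernel_kern_starVec hyU).continuousOn
      (contDiff_cutoff y ε) hK hKU hgrad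
    have hpg : ∀ x, -(kern y (starVec d y) x * gradVec (cutoff y ε) x * f x -
        starL d (kern (starVec d y) y x * gradVec (cutoff y ε) x * f x)) =
        peak d ε ‖x - y‖ • g x := by
      intro x
      rw [kern_mul_gradVec_cutoff hε, kern_swap_mul_gradVec_cutoff, starL_apply]
      simp only [g, neg_mul, smul_mul_assoc, one_mul, map_neg, map_smul, smul_sub]
      abel
    have iD := (ip.sub ((starL d).integrable_comp iq)).neg
    have hLp : L = ∫ x in preim K', peak d ε ‖x - y‖ • g x := by
      rw [hL, h.boundary_eq hy hε hball', ← starL_apply, ← (starL d).integral_comp_comm iq,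
        ← integral_sub ip ((starL d).integrable_comp iq), ← integral_neg]
      exact integral_congr_ae (Filter.Eventually.of_forall hpg)
    have ig : IntegrableOn (fun x => peak d ε ‖x - y‖ • g x) (preim K') :=
      iD.congr (Filter.Eventually.of_forall hpg)
    have ipk : IntegrableOn (fun x => peak d ε ‖x - y‖) (preim K') :=
      (integrable_peak y hε).integrableOn
    have hpeak : ∫ x in preim K', peak d ε ‖x - y‖ = sphereArea d := by
      rw [← integral_peak y hε]
      refine setIntegral_eq_integral_of_forall_compl_eq_zero fun x hx => peak_eq_zero hε ?_
      by_contra! hle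
      exact hx (hball' (by rwa [Metric.mem_closedBall, dist_eq_norm]))
    have hdiff : L - sphereArea d • g y =
        ∫ x in preim K', (peak d ε ‖x - y‖ • g x - peak d ε ‖x - y‖ • g y) := by
      rw [integral_sub ig (ipk.smul_const _), integral_smul_const, hpeak, hLp]
    rw [hdiff, ← hpeak, ← integral_const_mul]
    refine norm_integral_le_of_norm_le (ipk.const_mul η) (Filter.Eventually.of_forall fun x => ?_)
    rw [← smul_sub, norm_smul, Real.norm_of_nonneg (peak_nonneg ε (norm_nonneg _)), mul_comm]
    rcases lt_or_ge (2 * ε) ‖x - y‖ with h1 | h1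
    · rw [peak_eq_zero hε h1, mul_zero, mul_zero]
    · refine mul_le_mul_of_nonneg_right ?_ (peak_nonneg ε (norm_nonneg _))
      have := hgδ (x := x) (by rw [dist_eq_norm]; linarith)
      rw [dist_eq_norm] at this
      exact this.le
  have h0 : ‖L - sphereArea d • g y‖ ≤ 0 := by
    have hω := sphereArea_pos d
    refine le_of_forall_pos_le_add fun η hη => ?_
    have := key (η / sphereArea d) (by positivity)
    rwa [div_mul_cancel₀ _ hω.ne', ← zero_add η] at this
  rw [sub_eq_zero.1 (norm_le_zero_iff.1 h0), hgy, smul_smul]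

end IsSectionOnDomain

/-! ### Cauchy's formula over the quotient -/

namespace IsSectionOnDomain

/-- Cauchy's formula with the periodized kernels. -/
theorem cauchy_formula_periodized {d m : ℕ} {hm : 1 < m} {s : ℝ} {U' K' : Set (Splus d m hm)}
    {f : E d → Cl d} {y : E d} (h : IsSectionOnDomain s U' K' f) (hy : y ∈ preim K')
    {F : Set (E d)} (hF : IsFundamentalSet d m F) :
    (∀ x ∈ preim (frontier K'),
      Summable (periodTerm m s p₁ x y) ∧ Summable (periodTerm m s p₂ x y)) ∧
    IntegrableOn (integrand₁ m s (preim K') f y) (preim (frontier K') ∩ F) (surf d) ∧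
    IntegrableOn (integrand₂ m s (preim K') f y) (preim (frontier K') ∩ F) (surf d) ∧
    f y = (2 ^ d * lastCoord y ^ d / sphereArea d) •
      ((∫ x in preim (frontier K') ∩ F, integrand₁ m s (preim K') f y x ∂(surf d)) -
        ∫ x in preim (frontier K') ∩ F, integrand₂ m s (preim K') f y x ∂(surf d)) := by
  have hyU : y ∈ upperHalf d := preim_subset _ hy
  have hkp := isDecayingKernel_kern hyU
  have hkq := isDecayingKernel_kern_starVec hyU
  have e₂ : ∀ x k, periodTerm m s p₂ x y k =
      starL d ((m : ℝ) ^ ((k : ℝ) * s) • kern (starVec d y) y ((m : ℝ) ^ k • x)) := fun x k => by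
    rw [periodTerm, p₂_eq, starL_apply, ← map_smul]
    rfl
  have hsum : ∀ x ∈ preim (frontier K'), Summable (periodTerm m s p₁ x y) ∧
      Summable (periodTerm m s p₂ x y) := fun x hx =>
    ⟨h.summable_kernel hy hkp hx,
      (((starL d).summable (h.summable_kernel hy hkq hx))).congr fun k => (e₂ x k).symm⟩
  obtain ⟨i₁, u₁⟩ := h.unfold_boundary hy hkp hF
  obtain ⟨i₂, u₂⟩ := h.unfold_boundary hy hkq hF
  -- The star is a continuous algebra automorphism, so it passes through the series and the product
  -- and turns the unfolded `q`-integrand into the one with `h₂`, `n^*` and `f^*`.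
  have hm₂ : Set.EqOn (fun x => starL d ((∑' k : ℤ, (m : ℝ) ^ ((k : ℝ) * s) •
      kern (starVec d y) y ((m : ℝ) ^ k • x)) * vec (outerNormal (preim K') x) * f x))
      (integrand₂ m s (preim K') f y) (preim (frontier K') ∩ F) := fun x hx => by
    simp only [integrand₂, h₂]
    rw [starL_apply, map_mul, map_mul, ← starL_apply,
      (starL d).map_tsum (h.summable_kernel hy hkq hx.1)]
    simp only [e₂]
  have hSF : MeasurableSet (preim (frontier K') ∩ F) :=
    (measurableSet_bdry K').inter hF.1
  refine ⟨hsum, i₁, ((starL d).integrable_comp i₂).congr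
    ((ae_restrict_iff' hSF).2 (Filter.Eventually.of_forall hm₂)), ?_⟩
  have hc := h.cauchy_formula hy
  rw [← u₁, ← u₂, ← starL_apply, ← (starL d).integral_comp_comm i₂,
    setIntegral_congr_fun hSF hm₂] at hc
  have hy0 : 0 < lastCoord y := hyU
  have hω := sphereArea_pos d
  have hc' : f y = (2 ^ d * lastCoord y ^ d / sphereArea d) •
      ((sphereArea d * ((2 * lastCoord y) ^ d)⁻¹) • f y) := by
    rw [smul_smul, mul_pow]
    have : 2 ^ d * lastCoord y ^ d / sphereArea d *
        (sphereArea d * (2 ^ d * lastCoord y ^ d)⁻¹) = 1 := by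
      field_simp
    rw [this, one_smul]
  rw [← hc] at hc'
  exact hc'

end IsSectionOnDomain

end HalfHopf

end

theorem theorem2 (d m : ℕ) (hm : 1 < m) (s : ℝ) (hs₀ : 0 < s) (hs₁ : s < 2 * (d : ℝ) + 1)
    (U' K' : Set (HalfHopf.Splus d m hm)) (hU : IsOpen U') (hK : IsOpen K')
    (hKc : IsCompact (closure K')) (hKU : closure K' ⊆ U')
    (hLip : HalfHopf.HasLipschitzBoundary K')
    (f : HalfHopf.E d → HalfHopf.Cl d)
    (hf : HalfHopf.IsHypermonogenicSection ((d : ℝ) + 1 - s) U' f)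
    (y : HalfHopf.E d) (hy : y ∈ HalfHopf.preim K')
    (F : Set (HalfHopf.E d)) (hF : HalfHopf.IsFundamentalSet d m F) :
    (∀ x ∈ HalfHopf.preim (frontier K'),
      Summable (HalfHopf.periodTerm m s HalfHopf.p₁ x y) ∧
      Summable (HalfHopf.periodTerm m s HalfHopf.p₂ x y)) ∧
    IntegrableOn (HalfHopf.integrand₁ m s (HalfHopf.preim K') f y)
      (HalfHopf.preim (frontier K') ∩ F) (Measure.euclideanHausdorffMeasure (d + 1)) ∧
    IntegrableOn (HalfHopf.integrand₂ m s (HalfHopf.preim K') f y)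
      (HalfHopf.preim (frontier K') ∩ F) (Measure.euclideanHausdorffMeasure (d + 1)) ∧
    f y = (2 ^ d * HalfHopf.lastCoord y ^ d / HalfHopf.sphereArea d) •
      ((∫ x in HalfHopf.preim (frontier K') ∩ F,
          HalfHopf.integrand₁ m s (HalfHopf.preim K') f y x
            ∂(Measure.euclideanHausdorffMeasure (d + 1))) -
        ∫ x in HalfHopf.preim (frontier K') ∩ F,
          HalfHopf.integrand₂ m s (HalfHopf.preim K') f y x
            ∂(Measure.euclideanHausdorffMeasure (d + 1))) := by
  have h : HalfHopf.IsSectionOnDomain s U' K' f := ⟨hs₀, hs₁, hU, hK, hKc, hKU, hLip, hf⟩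
  exact h.cauchy_formula_periodized hy hF
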